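/- Work in the upper half-space model $\mathbb{H}^3=\{(z,t): z\in\mathbb{C},\ t>0\}$, with sphere at infinity $\mathbb{C}\cup\{\infty\}$. Let $\Gamma$ be a discrete group of isometries of $\mathbb{H}^3$ of finite covolume such that the orbifold $\mathbb{H}^3/\Gamma$ is mixed-platonic: there is a $\Gamma$-invariant, locally finite, face-to-face tiling $\mathcal{P}$ of $\mathbb{H}^3$ by regular ideal tetrahedra and regular ideal octahedra, with finitely many $\Gamma$-orbits of tiles, and at least one of each kind. Suppose that $\mathcal{P}$ is in standard position: one of its tiles is the regular ideal tetrahedron with ideal vertices $0,1,\infty,\tfrac12(1+i\sqrt3)$ or the regular ideal octahedron with ideal vertices $0,1,\infty,1+i,i,\tfrac12(1+i)$. For a regular ideal tetrahedron or octahedron $P$, let $\mathcal{H}_P$ be the unique maximal packing by horoballs centered at the ideal vertices of $P$ that is invariant under all self-isometries of $P$. Let $\mathcal{H}$ be the ($\Gamma$-invariant, unique) horoball packing associated with $\mathcal{P}$: its set of centers is the set of ideal vertices of tiles of $\mathcal{P}$, and for each tile $P$ the horoballs of $\mathcal{H}$ centered at ideal vertices of $P$ are those of $\mathcal{H}_P$.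 Let $B_\infty\in\mathcal{H}$ be its horoball centered at $\infty$, let $\mathcal{T}=\mathcal{P}\cap\partial B_\infty$ be the peripheral tiling (viewed as a tiling of $\mathbb{C}$ through $(z,t)\mapsto z$), and let $$V_\infty=\{x\in\mathbb{H}^3 : d(x,B_\infty)\le d(x,B')\text{ for all }B'\in\mathcal{H}\}$$ be the Voronoi cell of $B_\infty$. Then $V_\infty$ is a convex polyhedron: it is closed and convex with non-empty interior, and its collection of sides (the maximal non-empty convex subsets of $\partial V_\infty$) is locally finite. Its sides correspond bijectively to the edges of $\mathcal{P}$ with one ideal endpoint at $\infty$: the side corresponding to the edge $e$ from $\infty$ to $q$ is the set $F_e$ of points of $V_\infty$ equidistant from $B_\infty$ and from the horoball of $\mathcal{H}$ centered at $q$, and $e$ meets $\partial V_\infty$ in exactly one point, which lies in $F_e$. Moreover: 1. For any two sides of $V_\infty$ meeting along an edge, the dihedral angle of $V_\infty$ along this edge is $2\pi/3$. 2. Under the vertical projection $(z,t)\mapsto z$ (that is, along the geodesics orthogonal to $\partial B_\infty$), the collection of sides of $V_\infty$ is mapped onto the Voronoi tessellation of $\mathbb{C}$ determined by the set of vertices of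 $\mathcal{T}$, the side $F_e$ going to the Voronoi cell of the endpoint $q\in\mathbb{C}$ of $e$. This is a locally finite edge-to-edge tiling of the plane by compact convex polygons, and it is dual to $\mathcal{T}$: there are inclusion-reversing bijections from the vertices, edges and tiles of $\mathcal{T}$ to its tiles, edges and vertices. 3. For each edge $e$ of $\mathcal{P}$ from $\infty$ to $q$, the types ($T$ for tetrahedron, $O$ for octahedron) of the tiles around $e$, listed in a suitable cyclic order, spell one of the four words $TTTTTT$, $OOTTT$, $OTOTT$, $OOOO$. The projection of $F_e$ to $\mathbb{C}$ is the image, under an isometry of the plane taking $0$ to $q$, of the convex hull of the centers of the equilateral triangles ($T$) and squares ($O$) of side length $1$ placed consecutively around $0$ in the order given by the word; under this isometry, each of these centers goes to an interior point of the cross-section with $\partial B_\infty$ of the corresponding tile. -/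

import Mathlib

noncomputable section

namespace MixedPlatonic

open Set Metric Topology MeasureTheory

/-! ### Hyperbolic 3-space: the upper half-space model -/

/-- The upper half-space `{(z, t) : z ∈ ℂ, t > 0}`. -/
@[ext]
structure H3 where
  z : ℂ
  t : ℝ
  t_pos : 0 < t

namespace H3

/-- The inclusion of the upper half-space in Euclidean space `ℂ × ℝ` (with its Euclidean norm). -/
def toEuc (x : H3) : WithLp 2 (ℂ × ℝ) := WithLp.toLp 2 (x.z, x.t)

/-- The Euclidean mirror image `(z, -t)`. -/
def mirror (x : H3) : WithLp 2 (ℂ × ℝ) := WithLp.toLp 2 (x.z, -x.t)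

instance : TopologicalSpace H3 := TopologicalSpace.induced toEuc inferInstance

/-- The hyperbolic distance: `sinh (d(x,y) / 2) = |x - y| / (2 √(t(x) t(y)))`,
i.e. `cosh d(x,y) = 1 + |x - y|² / (2 t(x) t(y))`. -/
instance : Dist H3 :=
  ⟨fun x y => 2 * Real.arsinh (dist x.toEuc y.toEuc / (2 * √(x.t * y.t)))⟩

theorem dist_def (x y : H3) :
    dist x y = 2 * Real.arsinh (dist x.toEuc y.toEuc / (2 * √(x.t * y.t))) := rfl

theorem euc_dist_sq (x y : H3) :
    dist x.toEuc y.toEuc ^ 2 = dist x.z y.z ^ 2 + (x.t - y.t) ^ 2 := by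
  rw [WithLp.prod_dist_eq_of_L2, Real.sq_sqrt (by positivity)]
  simp [toEuc, Real.dist_eq, sq_abs]

theorem mirror_dist_sq (x y : H3) :
    dist x.toEuc y.mirror ^ 2 = dist x.z y.z ^ 2 + (x.t + y.t) ^ 2 := by
  rw [WithLp.prod_dist_eq_of_L2, Real.sq_sqrt (by positivity)]
  simp [toEuc, mirror, Real.dist_eq, sq_abs]

theorem mirror_dist_comm (x y : H3) : dist x.toEuc y.mirror = dist y.toEuc x.mirror := by
  rw [← sq_eq_sq₀ dist_nonneg dist_nonneg, mirror_dist_sq, mirror_dist_sq, dist_comm x.z]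
  ring

theorem self_mirror_dist (x : H3) : dist x.toEuc x.mirror = 2 * x.t := by
  have := x.t_pos
  rw [← sq_eq_sq₀ dist_nonneg (by positivity), mirror_dist_sq]
  simp
  ring

theorem sinh_half_dist (x y : H3) :
    Real.sinh (dist x y / 2) = dist x.toEuc y.toEuc / (2 * √(x.t * y.t)) := by
  rw [dist_def, mul_div_cancel_left₀ _ two_ne_zero, Real.sinh_arsinh]

theorem cosh_half_dist (x y : H3) :
    Real.cosh (dist x y / 2) = dist x.toEuc y.mirror / (2 * √(x.t * y.t)) := by
  have hx := x.t_pos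
  have hy := y.t_pos
  rw [← sq_eq_sq₀ (Real.cosh_pos _).le (by positivity), Real.cosh_sq', sinh_half_dist, div_pow,
    div_pow, mul_pow, Real.sq_sqrt (by positivity), euc_dist_sq, mirror_dist_sq]
  field_simp
  ring

/-- The defining formula of the hyperbolic metric in its most common form. -/
theorem cosh_dist (x y : H3) :
    Real.cosh (dist x y) = 1 + (dist x.z y.z ^ 2 + (x.t - y.t) ^ 2) / (2 * x.t * y.t) := by
  have hx := x.t_pos
  have hy := y.t_pos
  have h : dist x y = 2 * (dist x y / 2) := by ring
  rw [h, Real.cosh_two_mul, Real.cosh_sq', sinh_half_dist, div_pow, mul_pow,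
    Real.sq_sqrt (by positivity), euc_dist_sq]
  field_simp
  ring

theorem hdist_comm (x y : H3) : dist x y = dist y x := by
  simp only [dist_def, dist_comm x.toEuc, mul_comm]

theorem sinh_half_dist_add (a b c : H3) : Real.sinh ((dist a b + dist b c) / 2) =
    (dist a.toEuc b.toEuc * dist c.toEuc b.mirror + dist b.toEuc c.toEuc * dist a.toEuc b.mirror) /
      (2 * √(a.t * c.t) * dist b.toEuc b.mirror) := by
  have ha := a.t_pos
  have hb := b.t_pos
  have hc := c.t_pos
  rw [add_div, Real.sinh_add, sinh_half_dist, cosh_half_dist, sinh_half_dist, cosh_half_dist,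
    self_mirror_dist, mirror_dist_comm b c]
  have h1 : √(a.t * b.t) * √(b.t * c.t) = √(a.t * c.t) * b.t := by
    rw [← Real.sqrt_mul (by positivity), show a.t * b.t * (b.t * c.t) = (a.t * c.t) * b.t ^ 2 by ring,
      Real.sqrt_mul (by positivity), Real.sqrt_sq hb.le]
  rw [div_mul_div_comm, div_mul_div_comm, ← add_div]
  rw [show 2 * √(a.t * b.t) * (2 * √(b.t * c.t)) = 4 * (√(a.t * b.t) * √(b.t * c.t)) by ring, h1]
  congr 1 <;> ring

theorem hdist_triangle (a b c : H3) : dist a c ≤ dist a b + dist b c := by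
  have ha := a.t_pos
  have hb := b.t_pos
  have hc := c.t_pos
  rw [← div_le_div_iff_of_pos_right (zero_lt_two' ℝ), ← Real.sinh_le_sinh, sinh_half_dist_add,
    sinh_half_dist, div_mul_eq_div_div _ _ (dist _ _), le_div_iff₀, div_mul_eq_mul_div]
  · gcongr
    exact EuclideanGeometry.mul_dist_le_mul_dist_add_mul_dist a.toEuc b.toEuc c.toEuc b.mirror
  · rw [self_mirror_dist]; positivity

theorem toEuc_injective : Function.Injective toEuc := by
  intro x y h
  have h' := congrArg WithLp.ofLp h
  simp only [toEuc, Prod.mk.injEq] at h'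
  exact H3.ext h'.1 h'.2

/-- Auxiliary metric structure, whose topology is replaced below by the Euclidean one. -/
abbrev metricSpaceAux : MetricSpace H3 where
  dist := dist
  dist_self x := by rw [dist_def, dist_self, zero_div, Real.arsinh_zero, mul_zero]
  dist_comm := hdist_comm
  dist_triangle := hdist_triangle
  eq_of_dist_eq_zero {x y} h := by
    have hx := x.t_pos
    have hy := y.t_pos
    have h0 : (2 * √(x.t * y.t)) ≠ 0 := by positivity
    rw [dist_def, mul_eq_zero, Real.arsinh_eq_zero_iff, div_eq_zero_iff] at h
    rcases h with h | h | h
    · norm_num at h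
    · exact toEuc_injective (dist_eq_zero.1 h)
    · exact absurd h h0

theorem continuous_toEuc : Continuous toEuc := continuous_induced_dom

theorem continuous_z : Continuous H3.z :=
  (continuous_fst.comp (WithLp.prod_continuous_ofLp 2 ℂ ℝ)).comp continuous_toEuc

theorem continuous_t : Continuous H3.t :=
  (continuous_snd.comp (WithLp.prod_continuous_ofLp 2 ℂ ℝ)).comp continuous_toEuc

/-- Hyperbolic 3-space as a metric space; its topology is the one induced from `ℂ × ℝ`. -/
instance : MetricSpace H3 :=
  metricSpaceAux.replaceTopology <| by
    refine le_antisymm (continuous_id_iff_le.1 ?_) ?_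
    · refine (@continuous_iff_continuous_dist H3 H3 metricSpaceAux.toPseudoMetricSpace _ _).2 ?_
      have h : ∀ x : H3 × H3, 2 * √(x.1.t * x.2.t) ≠ 0 := fun x => by
        have := x.1.t_pos
        have := x.2.t_pos
        positivity
      change Continuous fun x : H3 × H3 =>
        2 * Real.arsinh (dist x.1.toEuc x.2.toEuc / (2 * √(x.1.t * x.2.t)))
      refine continuous_const.mul (Continuous.arsinh (Continuous.div ?_ ?_ h))
      · exact (continuous_toEuc.comp continuous_fst).dist (continuous_toEuc.comp continuous_snd)
      · exact continuous_const.mul (Real.continuous_sqrt.comp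
          ((continuous_t.comp continuous_fst).mul (continuous_t.comp continuous_snd)))
    · let : MetricSpace H3 := metricSpaceAux
      refine le_of_nhds_le_nhds fun x => ?_
      rw [nhds_induced]
      refine (nhds_basis_ball.le_basis_iff (nhds_basis_ball.comap _)).2 fun R hR => ?_
      have hx := x.t_pos
      refine ⟨2 * Real.arsinh (R / (2 * √(x.t * (x.t + R)))), ?_, ?_⟩
      · have : 0 < Real.arsinh (R / (2 * √(x.t * (x.t + R)))) := by
          rw [Real.arsinh_pos_iff]; positivity
        linarith
      · intro y hy
        have hyt := y.t_pos
        change dist y x < _ at hy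
        change dist y.toEuc x.toEuc < R
        by_contra! hle
        have h1 : dist y.toEuc x.toEuc / (2 * √(y.t * x.t)) < R / (2 * √(x.t * (x.t + R))) := by
          rw [dist_def] at hy
          exact Real.arsinh_lt_arsinh.1 (by linarith)
        set e := dist y.toEuc x.toEuc with he
        have h2 : y.t ≤ x.t + e := by
          have h3 : (y.t - x.t) ^ 2 ≤ e ^ 2 := by
            rw [he, euc_dist_sq]
            nlinarith [sq_nonneg (dist y.z x.z)]
          have h3' := (abs_le.1 (abs_le_of_sq_le_sq h3 dist_nonneg)).2
          linarith
        have h4 : (e / (2 * √(y.t * x.t))) ^ 2 < (R / (2 * √(x.t * (x.t + R)))) ^ 2 := by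
          have : 0 ≤ e := dist_nonneg
          gcongr
        rw [div_pow, div_pow, mul_pow, mul_pow, Real.sq_sqrt (by positivity),
          Real.sq_sqrt (by positivity), div_lt_div_iff₀ (by positivity) (by positivity)] at h4
        have h5 : e ^ 2 * (x.t + R) < R ^ 2 * y.t := by
          have : x.t * (e ^ 2 * (x.t + R)) < x.t * (R ^ 2 * y.t) := by nlinarith
          exact lt_of_mul_lt_mul_left this hx.le
        have h6 : R ^ 2 * y.t ≤ R ^ 2 * (x.t + e) := by gcongr
        have h7 : 0 ≤ (e - R) * (x.t * (e + R) + e * R) := by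
          have : 0 ≤ e - R := by linarith
          have : 0 ≤ e := dist_nonneg
          positivity
        nlinarith

instance : MeasurableSpace H3 := borel H3

instance : BorelSpace H3 := ⟨rfl⟩

/-- Hyperbolic volume, `dx dy dt / t³`. -/
def vol : Measure H3 :=
  (Measure.comap (fun x : H3 => (x.z, x.t)) (volume : Measure (ℂ × ℝ))).withDensity
    fun x => ENNReal.ofReal (1 / x.t ^ 3)

/-- The tautological action of the isometry group. -/
instance : MulAction (H3 ≃ᵢ H3) H3 where
  smul φ x := φ x
  one_smul _ := rfl
  mul_smul _ _ _ := rfl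

end H3

/-- The sphere at infinity `ℂ ∪ {∞}`. -/
abbrev Ideal3 := OnePoint ℂ

/-- The ideal point `∞`. -/
abbrev inftyPt : Ideal3 := OnePoint.infty

/-- The ideal point `q ∈ ℂ`. -/
abbrev finPt (q : ℂ) : Ideal3 := (q : OnePoint ℂ)

/-! ### Half-spaces, planes, ideal polyhedra, convexity -/

/-- Coefficients of a closed half-space `A (|z|² + t²) + 2 Re (b̄ z) + C ≥ 0` with
`A C < |b|²`: it is bounded by a vertical plane if `A = 0` and by a hemisphere with centre
in `ℂ` otherwise. -/
structure HalfSpace where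
  A : ℝ
  b : ℂ
  C : ℝ
  nondeg : A * C < Complex.normSq b

namespace HalfSpace

/-- The defining function of a half-space. -/
def eval (h : HalfSpace) (x : H3) : ℝ :=
  h.A * (Complex.normSq x.z + x.t ^ 2) + 2 * (starRingEnd ℂ h.b * x.z).re + h.C

/-- The closed half-space. -/
def carrier (h : HalfSpace) : Set H3 := {x | 0 ≤ h.eval x}

/-- The geodesic plane bounding the half-space. -/
def plane (h : HalfSpace) : Set H3 := {x | h.eval x = 0}

/-- The boundary value of the defining function at an ideal point (its leading coefficient
at `∞`). -/
def idealEval (h : HalfSpace) (p : Ideal3) : ℝ :=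
  p.elim h.A fun q => h.A * Complex.normSq q + 2 * (starRingEnd ℂ h.b * q).re + h.C

/-- The ideal points of the closed half-space. -/
def idealCarrier (h : HalfSpace) : Set Ideal3 := {p | 0 ≤ h.idealEval p}

/-- The ideal points of the bounding plane. -/
def idealPlane (h : HalfSpace) : Set Ideal3 := {p | h.idealEval p = 0}

/-- (Half of) the Euclidean gradient of the defining function: a vector normal to the bounding
plane, pointing into the half-space. -/
def normal (h : HalfSpace) (x : H3) : WithLp 2 (ℂ × ℝ) :=
  WithLp.toLp 2 ((h.A : ℂ) * x.z + h.b, h.A * x.t)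

end HalfSpace

/-- The convex hull in hyperbolic space of a set of ideal points. -/
def idealHull (V : Set Ideal3) : Set H3 :=
  {x | ∀ h : HalfSpace, V ⊆ h.idealCarrier → x ∈ h.carrier}

/-- `W` is the set of ideal vertices of a face (of any dimension) of the ideal polyhedron with
ideal vertex set `V`, i.e. the vertices on a supporting plane. -/
def IsIdealFace (V W : Set Ideal3) : Prop :=
  ∃ h : HalfSpace, V ⊆ h.idealCarrier ∧ W = V ∩ h.idealPlane

/-- Geodesic convexity: the set contains the geodesic segment between any two of its points. -/
def GConvex (S : Set H3) : Prop :=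
  ∀ x ∈ S, ∀ y ∈ S, ∀ w, dist x w + dist w y = dist x y → w ∈ S

/-- The sides of a convex set with non-empty interior: the maximal non-empty convex subsets of
its boundary. -/
def sides (C : Set H3) : Set (Set H3) :=
  {S | Maximal (fun S : Set H3 => S.Nonempty ∧ S ⊆ frontier C ∧ GConvex S) S}

/-- A (three-dimensional) convex polyhedron: a closed convex set with non-empty interior whose
collection of sides is locally finite. -/
structure IsConvexPolyhedron (C : Set H3) : Prop where
  isClosed : IsClosed C
  convex : GConvex C
  interior_nonempty : (interior C).Nonempty
  locallyFinite : LocallyFinite fun S : sides C => (S : Set H3)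

/-- The dihedral angle of `C` between its sides `F` and `F'` is `θ`: if `h`, `h'` are the
half-spaces containing `C` whose boundary planes cut out `F` and `F'`, then `π - θ` is the angle
between the normals of the planes at their common points. (The model is conformal, so that
angles are Euclidean angles.) -/
def HasDihedralAngle (C F F' : Set H3) (θ : ℝ) : Prop :=
  ∃ h h' : HalfSpace, C ⊆ h.carrier ∧ C ⊆ h'.carrier ∧ F = C ∩ h.plane ∧ F' = C ∩ h'.plane ∧
    ∀ x ∈ h.plane ∩ h'.plane,
      Real.pi - InnerProductGeometry.angle (h.normal x) (h'.normal x) = θ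

/-! ### Regular ideal tetrahedra and octahedra, tilings

An ideal polyhedron is recorded by its set of ideal vertices; the polyhedron itself is
`idealHull` of that set. -/

/-- The point `ω = (1 + i√3)/2`. -/
def omega : ℂ := (1 + Complex.I * (√3 : ℝ)) / 2

/-- The regular ideal tetrahedron in standard position. -/
def stdTet : Set Ideal3 := {inftyPt, finPt 0, finPt 1, finPt omega}

/-- The regular ideal octahedron in standard position. -/
def stdOct : Set Ideal3 :=
  {inftyPt, finPt 0, finPt 1, finPt (1 + Complex.I), finPt Complex.I,
    finPt ((1 + Complex.I) / 2)}

/-- The two types of tiles: `T`etrahedra and `O`ctahedra. -/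
inductive TileType
  | T
  | O

/-- The model of each type in standard position. -/
def TileType.std : TileType → Set Ideal3
  | .T => stdTet
  | .O => stdOct

/-- `V` is the ideal vertex set of a regular ideal tetrahedron (octahedron): the image of the
standard one under a Möbius transformation. (The standard ones have orientation-reversing
symmetries, so orientation-reversing isometries give nothing else.) -/
def IsRegular (τ : TileType) (V : Set Ideal3) : Prop :=
  ∃ g : GL (Fin 2) ℂ, V = (fun p : Ideal3 => g • p) '' τ.std

/-- A locally finite, face-to-face tiling of hyperbolic 3-space by regular ideal tetrahedra
and/or octahedra. -/
structure IsTiling (P : Set (Set Ideal3)) : Prop where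
  regular : ∀ V ∈ P, ∃ τ, IsRegular τ V
  covers : ⋃ V ∈ P, idealHull V = univ
  locallyFinite : LocallyFinite fun V : P => idealHull (V : Set Ideal3)
  face_left : ∀ V ∈ P, ∀ W ∈ P, V ≠ W → IsIdealFace V (V ∩ W)
  inter : ∀ V ∈ P, ∀ W ∈ P, V ≠ W → idealHull V ∩ idealHull W = idealHull (V ∩ W)

/-- `Γ` is a discrete group of isometries of finite covolume, so that `ℍ³/Γ` is a (connected,
complete) hyperbolic 3-orbifold of finite volume. -/
structure IsLattice (Γ : Subgroup (H3 ≃ᵢ H3)) : Prop where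
  discrete : ProperlyDiscontinuousSMul Γ H3
  finite_covolume : ∃ D : Set H3, IsFundamentalDomain Γ D H3.vol ∧ H3.vol D < ⊤

/-- `P` is a `Γ`-invariant tiling exhibiting `ℍ³/Γ` as a mixed-platonic orbifold: there are
finitely many `Γ`-orbits of tiles, at least one of tetrahedra and at least one of octahedra. -/
structure IsMixedPlatonic (Γ : Subgroup (H3 ≃ᵢ H3)) (P : Set (Set Ideal3)) : Prop where
  lattice : IsLattice Γ
  tiling : IsTiling P
  invariant : ∀ γ ∈ Γ, ∀ V ∈ P, ∃ W ∈ P, γ '' idealHull V = idealHull W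
  finite_orbits : ∃ R : Set (Set Ideal3), R.Finite ∧ R ⊆ P ∧
    ∀ V ∈ P, ∃ W ∈ R, ∃ γ ∈ Γ, γ '' idealHull W = idealHull V
  exists_tet : ∃ V ∈ P, IsRegular .T V
  exists_oct : ∃ V ∈ P, IsRegular .O V

/-- The tiling has a tile in standard position. -/
def InStandardPosition (P : Set (Set Ideal3)) : Prop := ∃ τ : TileType, τ.std ∈ P

/-- The edges of a tiling, each recorded by the pair of its ideal endpoints. -/
def edges (P : Set (Set Ideal3)) : Set (Set Ideal3) :=
  {e | e.ncard = 2 ∧ ∃ V ∈ P, IsIdealFace V e}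

/-! ### Horoball packings -/

/-- The closed horoball centred at `p` with size parameter `r > 0`: the region `t ≥ r` if
`p = ∞`, and otherwise the Euclidean ball of radius `r` tangent to `ℂ` at `p`. -/
def horoball (p : Ideal3) (r : ℝ) : Set H3 :=
  p.elim {x | r ≤ x.t} fun q => {x | dist x.z q ^ 2 + (x.t - r) ^ 2 ≤ r ^ 2}

/-- `B` is a horoball centred at `p`. -/
def IsHoroballAt (p : Ideal3) (B : Set H3) : Prop := ∃ r : ℝ, 0 < r ∧ B = horoball p r

/-- A collection of horoballs centred at points of `Z`, with pairwise disjoint interiors. -/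
def IsPackingOn (Z : Set Ideal3) (H : Set (Set H3)) : Prop :=
  (∀ B ∈ H, ∃ p ∈ Z, IsHoroballAt p B) ∧
    ∀ B ∈ H, ∀ B' ∈ H, B ≠ B' → Disjoint (interior B) (interior B')

/-- `H` is a maximal horoball packing with centres at the ideal vertices of the ideal polyhedron
with vertex set `V`, invariant under all self-isometries of that polyhedron. For a regular
ideal tetrahedron or octahedron there is exactly one. -/
structure IsSymmetricPacking (V : Set Ideal3) (H : Set (Set H3)) : Prop where
  packing : IsPackingOn V H
  invariant : ∀ φ : H3 ≃ᵢ H3, φ '' idealHull V = idealHull V → ∀ B ∈ H, φ '' B ∈ H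
  maximal : ∀ H', IsPackingOn V H' → (∀ B ∈ H, ∃ B' ∈ H', B ⊆ B') → H' = H

/-- `H` is the horoball packing associated with the `Γ`-invariant tiling `P`: it is
`Γ`-invariant, its centres are the ideal vertices of the tiles, and for each tile the horoballs
centred at its ideal vertices form its maximal symmetric packing. -/
structure IsAssociatedPacking (Γ : Subgroup (H3 ≃ᵢ H3)) (P : Set (Set Ideal3))
    (H : Set (Set H3)) : Prop where
  packing : IsPackingOn univ H
  invariant : ∀ γ ∈ Γ, ∀ B ∈ H, γ '' B ∈ H
  centres : {p | ∃ B ∈ H, IsHoroballAt p B} = ⋃ V ∈ P, V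
  symmetric : ∀ V ∈ P, IsSymmetricPacking V {B ∈ H | ∃ p ∈ V, IsHoroballAt p B}

/-- The Voronoi cell of `B` relative to the packing `H`. -/
def voronoiCell (H : Set (Set H3)) (B : Set H3) : Set H3 :=
  {x | ∀ B' ∈ H, infDist x B ≤ infDist x B'}

/-- The part of the Voronoi cell of `B` equidistant from the horoballs centred at the two
endpoints of `e` (one of which is the centre of `B` in the applications). -/
def edgeFace (H : Set (Set H3)) (B : Set H3) (e : Set Ideal3) : Set H3 :=
  {x ∈ voronoiCell H B | ∀ B' ∈ H, (∃ p ∈ e, IsHoroballAt p B') → infDist x B' = infDist x B}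

/-! ### Tilings of the plane -/

/-- The cross-section of the ideal polyhedron with vertex set `V` by the boundary of a horoball
`B` centred at `∞`, as a subset of `ℂ`. -/
def crossSection (B : Set H3) (V : Set Ideal3) : Set ℂ :=
  H3.z '' (idealHull V ∩ frontier B)

/-- The peripheral tiling `P ∩ ∂B`, as a set of subsets of `ℂ`. -/
def peripheralTiling (P : Set (Set Ideal3)) (B : Set H3) : Set (Set ℂ) :=
  {σ | σ.Nonempty ∧ ∃ V ∈ P, σ = crossSection B V}

/-- The vertices of a tiling of the plane by convex polygons. -/
def tilingVertices (T : Set (Set ℂ)) : Set ℂ := {v | ∃ σ ∈ T, v ∈ σ.extremePoints ℝ}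

/-- The edges of a (face-to-face) tiling of the plane by convex polygons: the intersections of
two distinct tiles with more than one point. -/
def tilingEdges (T : Set (Set ℂ)) : Set (Set ℂ) :=
  {e | e.Nontrivial ∧ ∃ σ ∈ T, ∃ τ ∈ T, σ ≠ τ ∧ e = σ ∩ τ}

/-- A locally finite edge-to-edge tiling of the plane by compact convex polygons. -/
structure IsPlaneTiling (T : Set (Set ℂ)) : Prop where
  polygon : ∀ σ ∈ T, (interior σ).Nonempty ∧ ∃ s : Set ℂ, s.Finite ∧ σ = convexHull ℝ s
  covers : ⋃₀ T = univ
  disjoint : ∀ σ ∈ T, ∀ τ ∈ T, σ ≠ τ → Disjoint (interior σ) (interior τ)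
  locallyFinite : LocallyFinite fun σ : T => (σ : Set ℂ)
  edge_to_edge : ∀ σ ∈ T, ∀ τ ∈ T, σ ≠ τ → IsExtreme ℝ σ (σ ∩ τ)

/-- Two tilings of the plane are dual: there are inclusion-reversing bijections from the
vertices, edges and tiles of one to the tiles, edges and vertices of the other. -/
def IsDualTiling (T T' : Set (Set ℂ)) : Prop :=
  ∃ (f : tilingVertices T ≃ T') (k : tilingEdges T ≃ tilingEdges T')
    (g : T ≃ tilingVertices T'),
    (∀ (v : tilingVertices T) (e : tilingEdges T), (v : ℂ) ∈ (e : Set ℂ) ↔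
      (k e : Set ℂ) ⊆ (f v : Set ℂ)) ∧
    (∀ (e : tilingEdges T) (σ : T), (e : Set ℂ) ⊆ (σ : Set ℂ) ↔
      (g σ : ℂ) ∈ (k e : Set ℂ)) ∧
    (∀ (v : tilingVertices T) (σ : T), (v : ℂ) ∈ (σ : Set ℂ) ↔
      (g σ : ℂ) ∈ (f v : Set ℂ))

/-- The Voronoi cell of a point `x` of a set `X` in the plane. -/
def planeVoronoiCell (X : Set ℂ) (x : ℂ) : Set ℂ := {z | ∀ y ∈ X, dist z x ≤ dist z y}

/-- The Voronoi tessellation of a set in the plane. -/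
def planeVoronoi (X : Set ℂ) : Set (Set ℂ) := planeVoronoiCell X '' X

/-! ### The four types of faces -/

/-- The corner angle of the cross-section of a tile: `π/3` for the equilateral triangle,
`π/2` for the square. -/
def TileType.angle : TileType → ℝ
  | .T => Real.pi / 3
  | .O => Real.pi / 2

/-- The circumradius of the triangle or square of side length `1`. -/
def TileType.radius : TileType → ℝ
  | .T => 1 / √3
  | .O => 1 / √2

/-- If unit triangles and squares are placed counterclockwise around `0` in the order given by
the word `w`, starting from the positive real axis, this is the centre of the `i`-th one. -/
def tileCentre (w : List TileType) (i : Fin w.length) : ℂ :=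
  ((w.get i).radius : ℂ) * Complex.exp
    (((((w.take i).map TileType.angle).sum + (w.get i).angle / 2 : ℝ) : ℂ) * Complex.I)

/-- The polygon pictured for the word `w`: its corners are the centres of the tiles around
`0`. -/
def modelFace (w : List TileType) : Set ℂ := convexHull ℝ (range (tileCentre w))

/-- The words `TTTTTT`, `OOTTT`, `OTOTT`, `OOOO`. -/
def faceWords : Set (List TileType) :=
  {[.T, .T, .T, .T, .T, .T], [.O, .O, .T, .T, .T], [.O, .T, .O, .T, .T], [.O, .O, .O, .O]}

/-- The face `F` belonging to the edge of `P` with endpoints `q` and `∞` is of type `w`: the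
tiles of `P` containing the edge can be listed in cyclic order around it (consecutive tiles
sharing a triangular face that contains the edge) so that their types spell `w`, and an isometry
of the plane taking `0` to `q` takes the pictured polygon for `w` to the vertical projection of
`F`, with the corner labelled `i` lying in the cross-section of the `i`-th tile. -/
def IsFaceOfType (P : Set (Set Ideal3)) (B : Set H3) (q : ℂ) (F : Set H3)
    (w : List TileType) : Prop :=
  ∃ (V : Fin w.length → Set Ideal3) (φ : ℂ ≃ᵢ ℂ),
    Function.Injective V ∧
    range V = {W ∈ P | inftyPt ∈ W ∧ finPt q ∈ W} ∧
    (∀ i, IsRegular (w.get i) (V i)) ∧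
    (∀ i, ∃ r : ℂ, r ≠ q ∧ V i ∩ V (finRotate _ i) = {inftyPt, finPt q, finPt r}) ∧
    φ 0 = q ∧
    (∀ i, φ (tileCentre w i) ∈ interior (crossSection B (V i))) ∧
    H3.z '' F = φ '' modelFace w

end MixedPlatonic

end

open MixedPlatonic

noncomputable section

namespace MixedPlatonic

open Set Metric Topology MeasureTheory

/-! ### Power half-planes -/

/-! Everything is decided by plane geometry at the cusp `∞`. Standard position fixes the scale: the
symmetries of a standard tile act transitively on its ideal vertices, and one of them exchanges `0`
and `∞`, so its maximal symmetric packing consists of `t ≥ 1`, balls of Euclidean radius `1/2` at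
the corners of a unit triangle or square, and for the octahedron a smaller ball at the centre
(`TileType.eq_stdPacking`). Each ideal point carries at most one horoball of `H`, so every tile with
vertex `∞` stands over a unit triangle or square. A tile without vertex `∞` never meets `t ≥ 1`
(`TileType.std_disjoint`, `IsRegular.disjoint_horoball`), so these polygons cover the plane;
disjointness of the balls of radius `1/2` keeps distinct corners at distance at least `1`. This is
the structure `UnitTiling`, obtained in `exists_cuspTiling`.

The planar facts follow from covering and separation. The squared circumradius of a tile is at most
`1/2`, so a vertex in the closed circumdisc of a tile is one of its corners
(`UnitTiling.mem_of_dist_centre_le`): the tiling has the Delaunay property. Hence the Voronoi cell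
of a vertex is the convex hull of the centres of the tiles around it
(`UnitTiling.cell_eq_convexHull`), which gives the duality. The recurring tool is that a difference
of two squared distances is an affine function, so that estimates at corners extend to convex hulls.
The corner angles at a vertex are `2` or `3` units of `π/6` and add up to `12` units, which leaves
only the four cyclic words (`exists_walk`, `UnitTiling.exists_cycle`).

In space, the points equidistant from `t = 1` and from the ball of radius `r` at `q` lie on the
hemisphere about `q` of squared radius `2r`. Over the corners these are unit hemispheres, and all
other horoballs of the packing are too small to impose a further condition
(`CuspTiling.horoball_size_le`). So the Voronoi cell is the region above the unit hemispheres
centred at the vertices. As the radii agree, its faces project to planar Voronoi cells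
(`UnitTiling.image_cuspFace`). Faces that share an edge have centres at distance `1`, and unit
spheres with such centres have normals at angle `π/3`, so the dihedral angle is `2π/3`. -/

theorem dist_sq_complex (z w : ℂ) : dist z w ^ 2 = (z.re - w.re) ^ 2 + (z.im - w.im) ^ 2 := by
  rw [Complex.dist_eq_re_im, Real.sq_sqrt (by positivity)]

/-- The quadratic terms of the two squared distances cancel, so the difference is affine in the
point. -/
theorem dist_sq_sub_dist_sq_combo {x y p q : ℂ} {a b : ℝ} (hab : a + b = 1) :
    dist (a • x + b • y) p ^ 2 - dist (a • x + b • y) q ^ 2 =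
      a * (dist x p ^ 2 - dist x q ^ 2) + b * (dist y p ^ 2 - dist y q ^ 2) := by
  obtain rfl : b = 1 - a := by linarith
  simp only [dist_sq_complex, Complex.add_re, Complex.add_im, Complex.real_smul, Complex.mul_re,
    Complex.mul_im, Complex.ofReal_re, Complex.ofReal_im]
  ring

theorem convex_power_lt (p q : ℂ) (k : ℝ) : Convex ℝ {z : ℂ | dist z p ^ 2 - dist z q ^ 2 < k} := by
  intro x hx y hy a b ha hb hab
  simp only [mem_ofPred_eq] at *
  rw [dist_sq_sub_dist_sq_combo hab]
  rcases ha.eq_or_lt with rfl | ha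
  · obtain rfl : b = 1 := by linarith
    simpa using hy
  · have := mul_lt_mul_of_pos_left hx ha
    have := mul_le_mul_of_nonneg_left hy.le hb
    have : k = a * k + b * k := by rw [← add_mul, hab, one_mul]
    linarith

theorem convex_power_le (p q : ℂ) (k : ℝ) : Convex ℝ {z : ℂ | dist z p ^ 2 - dist z q ^ 2 ≤ k} := by
  intro x hx y hy a b ha hb hab
  simp only [mem_ofPred_eq] at *
  rw [dist_sq_sub_dist_sq_combo hab]
  have := mul_le_mul_of_nonneg_left hx ha
  have := mul_le_mul_of_nonneg_left hy hb
  have : k = a * k + b * k := by rw [← add_mul, hab, one_mul]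
  linarith

theorem power_lt_of_mem_convexHull {s : Set ℂ} {z p q : ℂ} {k : ℝ} (hz : z ∈ convexHull ℝ s)
    (h : ∀ x ∈ s, dist x p ^ 2 - dist x q ^ 2 < k) : dist z p ^ 2 - dist z q ^ 2 < k :=
  convexHull_min (t := {z : ℂ | dist z p ^ 2 - dist z q ^ 2 < k}) h (convex_power_lt p q k) hz

theorem power_le_of_mem_convexHull {s : Set ℂ} {z p q : ℂ} {k : ℝ} (hz : z ∈ convexHull ℝ s)
    (h : ∀ x ∈ s, dist x p ^ 2 - dist x q ^ 2 ≤ k) : dist z p ^ 2 - dist z q ^ 2 ≤ k :=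
  convexHull_min (t := {z : ℂ | dist z p ^ 2 - dist z q ^ 2 ≤ k}) h (convex_power_le p q k) hz

/-- Power functions with equal values on `s ∩ {power = k}` cut convex hulls in faces. -/
theorem mem_convexHull_of_power_eq {s : Set ℂ} {z p q : ℂ} {k : ℝ} (hz : z ∈ convexHull ℝ s)
    (h : ∀ x ∈ s, dist x p ^ 2 - dist x q ^ 2 ≤ k) (hk : dist z p ^ 2 - dist z q ^ 2 = k) :
    z ∈ convexHull ℝ {x ∈ s | dist x p ^ 2 - dist x q ^ 2 = k} := by
  set A := {x ∈ s | dist x p ^ 2 - dist x q ^ 2 = k} with hA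
  suffices hsub : convexHull ℝ s ⊆
      {z : ℂ | dist z p ^ 2 - dist z q ^ 2 < k} ∪ convexHull ℝ A by
    rcases hsub hz with h1 | h1
    · exact absurd hk h1.ne
    · exact h1
  have hle : ∀ x ∈ convexHull ℝ A, dist x p ^ 2 - dist x q ^ 2 ≤ k := fun x hx =>
    power_le_of_mem_convexHull hx fun y hy => hy.2.le
  refine convexHull_min ?_ ?_
  · intro x hx
    rcases (h x hx).lt_or_eq with h1 | h1
    · exact Or.inl h1
    · exact Or.inr (subset_convexHull ℝ _ ⟨hx, h1⟩)
  · intro x hx y hy a b ha hb hab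
    rcases ha.eq_or_lt with rfl | ha
    · obtain rfl : b = 1 := by linarith
      simpa using hy
    rcases hb.eq_or_lt with rfl | hb
    · obtain rfl : a = 1 := by linarith
      simpa using hx
    have hk : k = a * k + b * k := by rw [← add_mul, hab, one_mul]
    have hx' : dist x p ^ 2 - dist x q ^ 2 ≤ k := hx.elim (fun h => le_of_lt h) (hle x)
    have hy' : dist y p ^ 2 - dist y q ^ 2 ≤ k := hy.elim (fun h => le_of_lt h) (hle y)
    by_cases hxy : x ∈ convexHull ℝ A ∧ y ∈ convexHull ℝ A
    · exact Or.inr (convex_convexHull ℝ A hxy.1 hxy.2 ha.le hb.le hab)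
    · left
      simp only [mem_ofPred_eq]
      rw [dist_sq_sub_dist_sq_combo hab]
      have h1 := mul_le_mul_of_nonneg_left hx' ha.le
      have h2 := mul_le_mul_of_nonneg_left hy' hb.le
      rcases not_and_or.1 hxy with h3 | h3
      · have := mul_lt_mul_of_pos_left (show dist x p ^ 2 - dist x q ^ 2 < k from
          hx.resolve_right h3) ha
        linarith
      · have := mul_lt_mul_of_pos_left (show dist y p ^ 2 - dist y q ^ 2 < k from
          hy.resolve_right h3) hb
        linarith

/-! ### Unit triangles and squares -/

@[simp] theorem omega_re : omega.re = 1 / 2 := by simp [omega]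
@[simp] theorem omega_im : omega.im = √3 / 2 := by simp [omega]

namespace TileType

/-- The direction of the second edge at the corner `0`. -/
def dir : TileType → ℂ
  | .T => omega
  | .O => Complex.I

/-- The corners of the unit triangle or square with first edge `[0, 1]`. -/
def corners : TileType → Set ℂ
  | .T => {0, 1, omega}
  | .O => {0, 1, 1 + Complex.I, Complex.I}

/-- The centre of the unit triangle or square with first edge `[0, 1]`. -/
def centre : TileType → ℂ
  | .T => (1 + omega) / 3
  | .O => (1 + Complex.I) / 2

theorem radius_pos (τ : TileType) : 0 < τ.radius := by
  cases τ <;> simp [radius]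

/-- The value `1/2` is attained by the square. Twice this bound does not exceed the squared minimal
distance `1` of the vertices, which is what makes the circumdiscs empty. -/
theorem radius_sq_le (τ : TileType) : τ.radius ^ 2 ≤ 1 / 2 := by
  cases τ <;> norm_num [radius, div_pow]

theorem norm_dir (τ : TileType) : ‖τ.dir‖ = 1 := by
  rw [← sq_eq_sq₀ (norm_nonneg _) zero_le_one, Complex.sq_norm, Complex.normSq_apply]
  cases τ
  · have : √3 * √3 = 3 := Real.mul_self_sqrt (by norm_num)
    simp [dir]; linarith
  · simp [dir]

theorem dir_im_pos (τ : TileType) : 0 < τ.dir.im := by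
  cases τ <;> simp [dir]

theorem dist_centre_of_mem_corners (τ : TileType) {p : ℂ} (hp : p ∈ τ.corners) :
    dist p τ.centre = τ.radius := by
  rw [← sq_eq_sq₀ dist_nonneg τ.radius_pos.le, dist_sq_complex]
  have h3 : √3 ^ 2 = 3 := Real.sq_sqrt (by norm_num)
  cases τ <;> simp only [corners, mem_insert_iff, mem_singleton_iff] at hp <;>
    rcases hp with rfl | rfl | rfl | rfl <;> simp [centre, radius] <;> ring_nf <;>
    norm_num

/-- Any point other than the centre has acute angle with some corner. -/
theorem exists_corner_dist_lt (τ : TileType) {z : ℂ} (hz : z ≠ τ.centre) :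
    ∃ p ∈ τ.corners, dist z p ^ 2 < τ.radius ^ 2 + dist z τ.centre ^ 2 := by
  -- The negation says that `z - centre` has nonpositive inner product with every vector from the
  -- centre to a corner. These vectors add up to zero and span the plane, which forces `z = centre`.
  by_contra! h
  have h3 : √3 ^ 2 = 3 := Real.sq_sqrt (by norm_num)
  have h3' : 0 < √3 := by positivity
  apply hz
  cases τ
  · have h0 := h 0 (by simp [corners])
    have h1 := h 1 (by simp [corners])
    have h2 := h omega (by simp [corners])
    simp only [dist_sq_complex, centre, radius, div_pow, h3] at h0 h1 h2
    simp at h0 h1 h2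
    ring_nf at h0 h1 h2
    norm_num at h0 h1 h2
    have hx : z.re = 1 / 2 := by nlinarith
    have hy : z.im * √3 = 1 / 2 := by nlinarith
    apply Complex.ext
    · simp [centre, hx]; norm_num
    · simp [centre]
      nlinarith
  · have h0 := h 0 (by simp [corners])
    have h1 := h 1 (by simp [corners])
    have h2 := h (1 + Complex.I) (by simp [corners])
    have h4 := h Complex.I (by simp [corners])
    simp only [dist_sq_complex, centre, radius, div_pow] at h0 h1 h2 h4
    simp at h0 h1 h2 h4
    ring_nf at h0 h1 h2 h4
    apply Complex.ext
    · simp [centre]; linarith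
    · simp [centre]; linarith

theorem finite_corners (τ : TileType) : τ.corners.Finite := by
  cases τ <;> simp [corners]

theorem zero_mem_corners (τ : TileType) : 0 ∈ τ.corners := by cases τ <;> simp [corners]
theorem one_mem_corners (τ : TileType) : 1 ∈ τ.corners := by cases τ <;> simp [corners]
theorem dir_mem_corners (τ : TileType) : τ.dir ∈ τ.corners := by cases τ <;> simp [corners, dir]

theorem mem_corners (τ : TileType) {p : ℂ} (hp : p ∈ τ.corners) :
    p = 0 ∨ p = 1 ∨ p = τ.dir ∨ (τ = .O ∧ p = 1 + Complex.I) := by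
  cases τ <;> simp [corners, dir] at * <;> tauto

/-- The part of the tile nearest to the corner `0` is spanned by the corner, the midpoints of its
edges and the centre. -/
theorem kite (τ : TileType) {z : ℂ} (hz : z ∈ convexHull ℝ τ.corners)
    (h1 : dist z 0 ≤ dist z 1) (h2 : dist z 0 ≤ dist z τ.dir) :
    z ∈ convexHull ℝ {0, 1 / 2, τ.dir / 2, τ.centre} := by
  set K : Set ℂ := {0, 1 / 2, τ.dir / 2, τ.centre} with hK
  have key : ∃ (x y : ℝ), z = x + y * τ.dir ∧ 0 ≤ x ∧ 0 ≤ y := by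
    have hc : Convex ℝ {z : ℂ | ∃ (x y : ℝ), z = x + y * τ.dir ∧ 0 ≤ x ∧ 0 ≤ y} := by
      rintro _ ⟨x, y, rfl, hx, hy⟩ _ ⟨x', y', rfl, hx', hy'⟩ a b ha hb hab
      refine ⟨a * x + b * x', a * y + b * y', ?_, by positivity, by positivity⟩
      simp only [Complex.real_smul]; push_cast; ring
    refine convexHull_min ?_ hc hz
    intro p hp
    rcases τ.mem_corners hp with rfl | rfl | rfl | ⟨rfl, rfl⟩
    · exact ⟨0, 0, by simp, le_rfl, le_rfl⟩
    · exact ⟨1, 0, by simp, zero_le_one, le_rfl⟩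
    · exact ⟨0, 1, by simp, le_rfl, zero_le_one⟩
    · exact ⟨1, 1, by simp [dir], zero_le_one, zero_le_one⟩
  obtain ⟨x, y, rfl, hx, hy⟩ := key
  have h1' := pow_le_pow_left₀ dist_nonneg h1 2
  have h2' := pow_le_pow_left₀ dist_nonneg h2 2
  have hn : τ.dir.re ^ 2 + τ.dir.im ^ 2 = 1 := by
    have := τ.norm_dir
    rw [← sq_eq_sq₀ (norm_nonneg _) zero_le_one, Complex.sq_norm, Complex.normSq_apply] at this
    linarith
  simp only [dist_sq_complex] at h1' h2'
  simp at h1' h2'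
  have e1 : x + y * τ.dir.re ≤ 1 / 2 := by nlinarith
  have e2 : x * τ.dir.re + y ≤ 1 / 2 := by nlinarith
  obtain ⟨α, hα0, hα, hc⟩ : ∃ α : ℝ, 0 < α ∧ α * (1 + τ.dir.re) = 1 / 2 ∧
      τ.centre = α * (1 + τ.dir) := by
    cases τ
    · exact ⟨1 / 3, by norm_num, by simp [dir]; norm_num, by simp [dir, centre]; ring⟩
    · exact ⟨1 / 2, by norm_num, by simp [dir], by simp [dir, centre]; ring⟩
  have mem : ∀ {s a b : ℝ} {p q : ℂ}, p ∈ K → q ∈ K → 0 ≤ a → 0 ≤ b → a + b = s → s ≤ 1 →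
      (a : ℂ) * p + b * q ∈ convexHull ℝ K := by
    intro s a b p q hp hq ha hb hab hs
    have := (convex_convexHull ℝ K).sum_mem (t := Finset.univ) (w := ![a, b, 1 - s])
      (z := ![p, q, 0]) (by simp [Fin.forall_fin_succ]; exact ⟨ha, hb, hs⟩)
      (by simp [Fin.sum_univ_succ]; linarith)
      (by
        simp only [Finset.mem_univ, forall_const, Fin.forall_fin_succ]
        exact ⟨subset_convexHull ℝ _ hp, subset_convexHull ℝ _ hq,
          subset_convexHull ℝ _ (by simp [hK]), by simp⟩)
    simpa [Fin.sum_univ_succ] using this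
  have hαC : (α : ℂ) ≠ 0 := by exact_mod_cast hα0.ne'
  -- The diagonal `x = y` cuts the kite into two triangles. In each of them the point is an explicit
  -- combination of the centre and one edge midpoint, and the corner `0` takes the remaining weight.
  rcases le_total y x with hxy | hxy
  · have e : (x : ℂ) + y * τ.dir = ((y / α : ℝ) : ℂ) * τ.centre + ((2 * (x - y) : ℝ) : ℂ) * (1 / 2) := by
      rw [hc]; push_cast; field_simp; ring
    rw [e]
    refine mem (s := 2 * (x + y * τ.dir.re)) (by simp [hK]) (by simp [hK]) (by positivity)
      (by linarith) ?_ (by linarith)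
    have : y / α = y * (2 * (1 + τ.dir.re)) := by
      rw [div_eq_iff hα0.ne']; linear_combination -2 * y * hα
    rw [this]; ring
  · have e : (x : ℂ) + y * τ.dir = ((x / α : ℝ) : ℂ) * τ.centre +
        ((2 * (y - x) : ℝ) : ℂ) * (τ.dir / 2) := by
      rw [hc]; push_cast; field_simp; ring
    rw [e]
    refine mem (s := 2 * (x * τ.dir.re + y)) (by simp [hK]) (by simp [hK]) (by positivity)
      (by linarith) ?_ (by linarith)
    have : x / α = x * (2 * (1 + τ.dir.re)) := by
      rw [div_eq_iff hα0.ne']; linear_combination -2 * x * hα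
    rw [this]; ring

end TileType

/-- `v` is the set of corners and `c` the centre of a unit triangle or square. -/
def IsUnitTile (τ : TileType) (v : Set ℂ) (c : ℂ) : Prop :=
  ∃ a u : ℂ, ‖u‖ = 1 ∧ v = (fun ζ => a + u * ζ) '' τ.corners ∧ c = a + u * τ.centre

theorem omega_sq : omega ^ 2 = omega - 1 := by
  have h3 : √3 * √3 = 3 := Real.mul_self_sqrt (by norm_num)
  apply Complex.ext <;> simp [sq] <;> linarith

theorem dist_unit_affine {u : ℂ} (hu : ‖u‖ = 1) (a x y : ℂ) :
    dist (a + u * x) (a + u * y) = dist x y := by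
  rw [dist_add_left, dist_eq_norm, ← mul_sub, norm_mul, hu, one_mul, dist_eq_norm]

namespace IsUnitTile

variable {τ : TileType} {v : Set ℂ} {c : ℂ}

/-- The rotations of the polygon about its centre permute the corners transitively. Moving the base
point to another corner multiplies `u` by a power of `omega ^ 2` for the triangle and of `I` for the
square. -/
theorem exists_of_mem (h : IsUnitTile τ v c) {q : ℂ} (hq : q ∈ v) :
    ∃ u : ℂ, ‖u‖ = 1 ∧ v = (fun ζ => q + u * ζ) '' τ.corners ∧ c = q + u * τ.centre := by
  obtain ⟨a, u, hu, rfl, rfl⟩ := h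
  obtain ⟨p, hp, rfl⟩ := hq
  have hI := Complex.I_sq
  have hw := omega_sq
  have hnw : ‖omega‖ = 1 := TileType.T.norm_dir
  cases τ
  · simp only [TileType.corners, mem_insert_iff, mem_singleton_iff] at hp
    rcases hp with rfl | rfl | rfl
    · exact ⟨u, hu, by simp, by simp⟩
    · refine ⟨u * omega ^ 2, by simp [hu, hnw], ?_, ?_⟩
      · simp only [TileType.corners, image_insert_eq, image_singleton]
        rw [show a + u * 1 + u * omega ^ 2 * 0 = a + u * 1 by ring,
          show a + u * 1 + u * omega ^ 2 * 1 = a + u * omega by rw [hw]; ring,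
          show a + u * 1 + u * omega ^ 2 * omega = a + u * 0 by
            linear_combination u * (omega + 1) * hw]
        ext; simp; tauto
      · simp only [TileType.centre]
        linear_combination (-u * (omega + 2) / 3) * hw
    · refine ⟨-u * omega, by simp [hu, hnw], ?_, ?_⟩
      · simp only [TileType.corners, image_insert_eq, image_singleton]
        rw [show a + u * omega + -u * omega * 0 = a + u * omega by ring,
          show a + u * omega + -u * omega * 1 = a + u * 0 by ring,
          show a + u * omega + -u * omega * omega = a + u * 1 by
            linear_combination -u * hw]
        ext; simp; tauto
      · simp only [TileType.centre]
        linear_combination (u / 3) * hw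
  · simp only [TileType.corners, mem_insert_iff, mem_singleton_iff] at hp
    rcases hp with rfl | rfl | rfl | rfl
    · exact ⟨u, hu, by simp, by simp⟩
    · refine ⟨u * Complex.I, by simp [hu], ?_, ?_⟩
      · simp only [TileType.corners, image_insert_eq, image_singleton]
        rw [show a + u * 1 + u * Complex.I * 0 = a + u * 1 by ring,
          show a + u * 1 + u * Complex.I * 1 = a + u * (1 + Complex.I) by ring,
          show a + u * 1 + u * Complex.I * (1 + Complex.I) = a + u * Complex.I by
            linear_combination u * hI,
          show a + u * 1 + u * Complex.I * Complex.I = a + u * 0 by linear_combination u * hI]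
        ext; simp; tauto
      · simp only [TileType.centre]
        linear_combination (-u / 2) * hI
    · refine ⟨-u, by simp [hu], ?_, ?_⟩
      · simp only [TileType.corners, image_insert_eq, image_singleton]
        rw [show a + u * (1 + Complex.I) + -u * 0 = a + u * (1 + Complex.I) by ring,
          show a + u * (1 + Complex.I) + -u * 1 = a + u * Complex.I by ring,
          show a + u * (1 + Complex.I) + -u * (1 + Complex.I) = a + u * 0 by ring,
          show a + u * (1 + Complex.I) + -u * Complex.I = a + u * 1 by ring]
        ext; simp; tauto
      · simp only [TileType.centre]
        ring
    · refine ⟨-u * Complex.I, by simp [hu], ?_, ?_⟩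
      · simp only [TileType.corners, image_insert_eq, image_singleton]
        rw [show a + u * Complex.I + -u * Complex.I * 0 = a + u * Complex.I by ring,
          show a + u * Complex.I + -u * Complex.I * 1 = a + u * 0 by ring,
          show a + u * Complex.I + -u * Complex.I * (1 + Complex.I) = a + u * 1 by
            linear_combination -u * hI,
          show a + u * Complex.I + -u * Complex.I * Complex.I = a + u * (1 + Complex.I) by
            linear_combination -u * hI]
        ext; simp; tauto
      · simp only [TileType.centre]
        linear_combination (u / 2) * hI

theorem dist_centre (h : IsUnitTile τ v c) {p : ℂ} (hp : p ∈ v) : dist p c = τ.radius := by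
  obtain ⟨a, u, hu, rfl, rfl⟩ := h
  obtain ⟨p, hp, rfl⟩ := hp
  simp only [dist_unit_affine hu]
  exact τ.dist_centre_of_mem_corners hp

theorem exists_dist_lt (h : IsUnitTile τ v c) {z : ℂ} (hz : z ≠ c) :
    ∃ p ∈ v, dist z p ^ 2 < τ.radius ^ 2 + dist z c ^ 2 := by
  obtain ⟨a, u, hu, rfl, rfl⟩ := h
  have hu0 : u ≠ 0 := by rintro rfl; simp at hu
  obtain ⟨ζ, rfl⟩ : ∃ ζ, z = a + u * ζ := ⟨(z - a) / u, by field_simp; ring⟩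
  obtain ⟨p, hp, hlt⟩ := τ.exists_corner_dist_lt (z := ζ) (by rintro rfl; exact hz rfl)
  exact ⟨_, mem_image_of_mem _ hp, by simpa only [dist_unit_affine hu] using hlt⟩

theorem finite (h : IsUnitTile τ v c) : v.Finite := by
  obtain ⟨a, u, hu, rfl, rfl⟩ := h
  exact τ.finite_corners.image _

theorem nonempty (h : IsUnitTile τ v c) : v.Nonempty := by
  obtain ⟨a, u, hu, rfl, rfl⟩ := h
  exact ⟨_, mem_image_of_mem _ τ.zero_mem_corners⟩

/-- The difference of the squared distances to `x` and to `c` is affine, so at some corner it is at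
most its value at `z`; at the corners the second term is the squared circumradius. -/
theorem exists_dist_sq_le (h : IsUnitTile τ v c) {z : ℂ} (hz : z ∈ convexHull ℝ v) (x : ℂ) :
    ∃ p ∈ v, dist p x ^ 2 ≤ dist z x ^ 2 - dist z c ^ 2 + τ.radius ^ 2 := by
  by_contra! hcon
  have := power_lt_of_mem_convexHull (p := c) (q := x)
    (k := dist z c ^ 2 - dist z x ^ 2) hz fun p hp => by
      have := hcon p hp
      rw [h.dist_centre hp]; linarith
  linarith

theorem kite (h : IsUnitTile τ v c) {q z : ℂ} (hq : q ∈ v) (hz : z ∈ convexHull ℝ v)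
    (hn : ∀ p ∈ v, dist z q ≤ dist z p) :
    ∃ u : ℂ, ‖u‖ = 1 ∧ q + u ∈ v ∧ q + u * τ.dir ∈ v ∧
      z ∈ convexHull ℝ {q, q + u / 2, q + u * τ.dir / 2, c} := by
  obtain ⟨u, hu, hv, hc⟩ := h.exists_of_mem hq
  have hu0 : u ≠ 0 := by rintro rfl; simp at hu
  have m1 : q + u ∈ v := hv ▸ ⟨1, τ.one_mem_corners, by simp⟩
  have m2 : q + u * τ.dir ∈ v := hv ▸ ⟨_, τ.dir_mem_corners, rfl⟩
  refine ⟨u, hu, m1, m2, ?_⟩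
  let f : ℂ →ᵃ[ℝ] ℂ := (LinearMap.mulLeft ℝ u).toAffineMap + AffineMap.const ℝ ℂ q
  have hf : ∀ ζ, f ζ = q + u * ζ := fun ζ => by simp [f, add_comm]
  have hfe : (f : ℂ → ℂ) = fun ζ => q + u * ζ := funext hf
  rw [hv, ← hfe, ← f.image_convexHull] at hz
  obtain ⟨ζ, hζ, rfl⟩ := hz
  have e1 := hn _ m1
  have e2 := hn _ m2
  rw [hf] at e1 e2
  have hk := τ.kite hζ
    (by rw [← dist_unit_affine hu q ζ 0, ← dist_unit_affine hu q ζ 1]; simpa using e1)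
    (by rw [← dist_unit_affine hu q ζ 0, ← dist_unit_affine hu q ζ τ.dir]; simpa using e2)
  have := mem_image_of_mem f hk
  rw [f.image_convexHull, hfe] at this
  convert this using 2
  · simp only [image_insert_eq, image_singleton, hc]
    congr 1
    · ring
    congr 1
    · ring
    congr 1
    · ring
  · exact hf ζ

end IsUnitTile

/-- A covering of the plane by unit triangles and squares `v i` with centres `c i` whose corners
form the set `X`, any two points of which have distance at least `1`. -/
structure UnitTiling {ι : Type*} (X : Set ℂ) (τ : ι → TileType) (v : ι → Set ℂ) (c : ι → ℂ) :
    Prop where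
  tile : ∀ i, IsUnitTile (τ i) (v i) (c i)
  cover : ∀ z, ∃ i, z ∈ convexHull ℝ (v i)
  vertices : X = ⋃ i, v i
  separated : ∀ x ∈ X, ∀ y ∈ X, x ≠ y → 1 ≤ dist x y
  injective : Function.Injective v

/-! ### Delaunay property and Voronoi cells of a unit tiling. -/

namespace UnitTiling

variable {ι : Type*} {X : Set ℂ} {τ : ι → TileType} {v : ι → Set ℂ} {c : ι → ℂ}

theorem subset (h : UnitTiling X τ v c) (i : ι) : v i ⊆ X :=
  h.vertices ▸ subset_iUnion v i

/-- The Delaunay property. If `x` lies in the closed circumdisc and is not the centre, some corner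
`p` is seen from the centre at an acute angle to `x`, so `dist x p ^ 2` is less than twice the
squared radius, hence less than `1`. Separation then leaves only corners of the tile; the centre
itself is too close to every corner to be a vertex. -/
theorem mem_of_dist_centre_le (h : UnitTiling X τ v c) {i : ι} {x : ℂ} (hx : x ∈ X)
    (hd : dist x (c i) ≤ (τ i).radius) : x ∈ v i := by
  by_contra hxv
  have hr := (τ i).radius_sq_le
  have hd2 := pow_le_pow_left₀ dist_nonneg hd 2
  have key : ∀ p ∈ v i, 1 ≤ dist x p ^ 2 := fun p hp =>
    one_le_pow₀ (h.separated x hx p (h.subset i hp) (by rintro rfl; exact hxv hp))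
  by_cases hxc : x = c i
  · obtain ⟨p, hp⟩ := (h.tile i).nonempty
    have h1 := key p hp
    rw [hxc, dist_comm, (h.tile i).dist_centre hp] at h1
    linarith
  · obtain ⟨p, hp, hlt⟩ := (h.tile i).exists_dist_lt hxc
    have := key p hp
    linarith

theorem centre_mem_cell (h : UnitTiling X τ v c) {i : ι} {x : ℂ} (hx : x ∈ X) :
    c i ∈ planeVoronoiCell X x ↔ x ∈ v i := by
  constructor
  · intro hc
    obtain ⟨p, hp⟩ := (h.tile i).nonempty
    have := hc p (h.subset i hp)
    rw [dist_comm, dist_comm _ p, (h.tile i).dist_centre hp] at this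
    exact h.mem_of_dist_centre_le hx this
  · intro hxv y hy
    rw [dist_comm, (h.tile i).dist_centre hxv, dist_comm]
    by_contra! hlt
    have := (h.tile i).dist_centre (h.mem_of_dist_centre_le hy hlt.le)
    linarith

theorem mem_of_mem_convexHull (h : UnitTiling X τ v c) {i : ι} {x : ℂ} (hx : x ∈ X)
    (hxi : x ∈ convexHull ℝ (v i)) : x ∈ v i := by
  refine h.mem_of_dist_centre_le hx ?_
  have := convexHull_min (fun p hp => mem_closedBall.2 ((h.tile i).dist_centre hp).le)
    (convex_closedBall (c i) (τ i).radius) hxi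
  exact mem_closedBall.1 this

/-- For concentric tiles, the corners of the one with the smaller circumradius lie in the circumdisc
of the other, so they are corners of it as well. Then the radii agree and the argument can be
reversed. -/
theorem centre_injective (h : UnitTiling X τ v c) : Function.Injective c := by
  have key : ∀ i j, c i = c j → (τ i).radius ≤ (τ j).radius → i = j := by
    intro i j hc hr
    have hsub : v i ⊆ v j := fun p hp => h.mem_of_dist_centre_le (h.subset i hp) (by
      rw [← hc, (h.tile i).dist_centre hp]; exact hr)
    refine h.injective (hsub.antisymm fun p hp => h.mem_of_dist_centre_le (h.subset j hp) ?_)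
    obtain ⟨q, hq⟩ := (h.tile i).nonempty
    have h1 := (h.tile i).dist_centre hq
    have h2 := (h.tile j).dist_centre (hsub hq)
    rw [hc, (h.tile j).dist_centre hp, ← h2, ← h1, hc]
  intro i j hc
  rcases le_total (τ i).radius (τ j).radius with hr | hr
  · exact key i j hc hr
  · exact (key j i hc.symm hr).symm

/-- The formula for the length of a median. -/
theorem dist_midpoint_sq (a b x : ℂ) :
    dist x ((a + b) / 2) ^ 2 = (dist x a ^ 2 + dist x b ^ 2) / 2 - dist a b ^ 2 / 4 := by
  simp only [dist_sq_complex]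
  simp
  ring

/-- Points near the midpoint of a unit edge, on its perpendicular bisector, belong to the Voronoi
cells of both ends. -/
theorem bisector_mem_cell (h : UnitTiling X τ v c) {q u : ℂ} (hq : q ∈ X) (hu : ‖u‖ = 1)
    (hq' : q + u ∈ X) {ε : ℝ} (hε : |ε| ≤ 1 / 10) :
    q + u / 2 + ε * (Complex.I * u) ∈ planeVoronoiCell X q ∧
      q + u / 2 + ε * (Complex.I * u) ∈ planeVoronoiCell X (q + u) := by
  set z := q + u / 2 + ε * (Complex.I * u) with hz
  have hn : u.re ^ 2 + u.im ^ 2 = 1 := by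
    have := Complex.sq_norm u
    rw [hu, Complex.normSq_apply] at this; linarith
  have hε2 : ε ^ 2 ≤ 1 / 100 := by rw [← sq_abs]; nlinarith [abs_nonneg ε]
  have h1 : dist z q ^ 2 = 1 / 4 + ε ^ 2 := by
    rw [dist_sq_complex, hz]; simp; linear_combination (1 / 4 + ε ^ 2) * hn
  have h2 : dist z (q + u) ^ 2 = 1 / 4 + ε ^ 2 := by
    rw [dist_sq_complex, hz]; simp; linear_combination (1 / 4 + ε ^ 2) * hn
  have heq : dist z q = dist z (q + u) := by
    rw [← sq_eq_sq₀ dist_nonneg dist_nonneg, h1, h2]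
  have hm : dist z ((q + (q + u)) / 2) = |ε| := by
    rw [dist_eq_norm, hz, show q + u / 2 + ε * (Complex.I * u) - (q + (q + u)) / 2 =
      ε * (Complex.I * u) by ring]
    simp [hu]
  have key : ∀ y ∈ X, dist z q ≤ dist z y := by
    intro y hy
    by_cases hy1 : y = q
    · rw [hy1]
    by_cases hy2 : y = q + u
    · rw [hy2, heq]
    have d1 := one_le_pow₀ (n := 2) (h.separated y hy q hq hy1)
    have d2 := one_le_pow₀ (n := 2) (h.separated y hy _ hq' hy2)
    have d3 := dist_midpoint_sq q (q + u) y
    have d4 : dist q (q + u) = 1 := by simp [hu]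
    rw [d4] at d3
    -- A vertex at distance at least `1` from both ends is at squared distance at least `3/4` from
    -- the midpoint. A displacement of at most `1/10` leaves distance at least `7/10`, whereas the
    -- squared distance to the ends is at most `1/4 + 1/100`.
    have d5 : 4 / 5 ≤ dist y ((q + (q + u)) / 2) := by
      rw [← pow_le_pow_iff_left₀ (by norm_num) dist_nonneg two_ne_zero]
      linarith
    have d6 := dist_triangle y z ((q + (q + u)) / 2)
    rw [hm, dist_comm y z] at d6
    rw [← pow_le_pow_iff_left₀ dist_nonneg dist_nonneg two_ne_zero, h1]
    nlinarith
  exact ⟨key, fun y hy => heq ▸ key y hy⟩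

/-- A point is nearest to corners of the tiles to which it belongs only. -/
theorem mem_of_mem_cell (h : UnitTiling X τ v c) {i : ι} {q z : ℂ} (hq : q ∈ X)
    (hz : z ∈ planeVoronoiCell X q) (hzi : z ∈ convexHull ℝ (v i)) : q ∈ v i := by
  by_contra hqv
  obtain ⟨p, hp, hmin⟩ := (h.tile i).finite.exists_minimalFor (fun p => dist z p) _
    (h.tile i).nonempty
  have hmin' : ∀ p' ∈ v i, dist z p ≤ dist z p' := fun p' hp' =>
    (le_total (dist z p) (dist z p')).elim id fun hle => hmin hp' hle
  obtain ⟨u, hu, m1, m2, hk⟩ := (h.tile i).kite hp hzi hmin'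
  have hpX := h.subset i hp
  have hqp : q ≠ p := by rintro rfl; exact hqv hp
  have mid : ∀ w : ℂ, ‖w‖ = 1 → p + w ∈ v i → dist (p + w / 2) p ^ 2 -
      dist (p + w / 2) q ^ 2 < 0 := by
    intro w hw hpw
    have hqw : q ≠ p + w := by rintro rfl; exact hqv hpw
    have d1 := one_le_pow₀ (n := 2) (h.separated q hq p hpX hqp)
    have d2 := one_le_pow₀ (n := 2) (h.separated q hq _ (h.subset i hpw) hqw)
    have d3 := dist_midpoint_sq p (p + w) q
    have d4 : dist p (p + w) = 1 := by simp [hw]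
    have d5 : dist (p + w / 2) p = 1 / 2 := by simp [dist_eq_norm, hw]
    rw [d4, show (p + (p + w)) / 2 = p + w / 2 by ring, dist_comm] at d3
    rw [d5]; linarith
  -- With `p` the corner nearest to `z`, the point lies in the kite at `p`, and every corner of the
  -- kite is strictly nearer to `p` than to `q`: the edge midpoints by the median formula, the
  -- centre because `q` is outside the circumdisc. Hence `z` is strictly nearer to `p` too.
  have hlt := power_lt_of_mem_convexHull (p := p) (q := q) (k := 0) hk (by
    intro y hy
    simp only [mem_insert_iff, mem_singleton_iff] at hy
    rcases hy with rfl | rfl | rfl | rfl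
    · have := one_le_pow₀ (n := 2) (h.separated q hq _ hpX hqp)
      rw [dist_self, dist_comm]; linarith
    · exact mid u hu m1
    · exact mid _ (by rw [norm_mul, hu, (τ i).norm_dir, one_mul]) m2
    · rw [dist_comm, (h.tile i).dist_centre hp, sub_neg]
      have : (τ i).radius < dist q (c i) := by
        by_contra! hle
        exact hqv (h.mem_of_dist_centre_le hq hle)
      rw [dist_comm]
      exact pow_lt_pow_left₀ this (τ i).radius_pos.le two_ne_zero)
  have := pow_le_pow_left₀ dist_nonneg (hz p hpX) 2
  linarith

theorem convex_cell (X : Set ℂ) (q : ℂ) : Convex ℝ (planeVoronoiCell X q) := by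
  have : planeVoronoiCell X q = ⋂ y ∈ X, {z | dist z q ^ 2 - dist z y ^ 2 ≤ 0} := by
    ext z
    simp only [planeVoronoiCell, mem_iInter, mem_ofPred_eq, sub_nonpos]
    exact forall₂_congr fun y _ => (pow_le_pow_iff_left₀ dist_nonneg dist_nonneg two_ne_zero).symm
  rw [this]
  exact convex_iInter₂ fun y _ => convex_power_le q y 0

theorem isClosed_cell (X : Set ℂ) (q : ℂ) : IsClosed (planeVoronoiCell X q) := by
  simp only [planeVoronoiCell, ofPred_forall]
  exact isClosed_biInter fun y _ => isClosed_le (by fun_prop) (by fun_prop)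

/-- The covering radius of the vertex set is at most the largest circumradius. That its square is
below `1` later keeps the points of the unit hemispheres over the Voronoi cells at positive height.
-/
theorem exists_mem_dist_sq_le (h : UnitTiling X τ v c) (z : ℂ) :
    ∃ p ∈ X, dist z p ^ 2 ≤ 1 / 2 := by
  obtain ⟨i, hi⟩ := h.cover z
  obtain ⟨p, hp, hle⟩ := (h.tile i).exists_dist_sq_le hi z
  refine ⟨p, h.subset i hp, ?_⟩
  rw [dist_comm z p]
  have := (τ i).radius_sq_le
  rw [dist_self] at hle
  nlinarith [sq_nonneg (dist z (c i))]

theorem dist_sq_le_of_mem_cell (h : UnitTiling X τ v c) {q z : ℂ}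
    (hz : z ∈ planeVoronoiCell X q) : dist z q ^ 2 ≤ 1 / 2 := by
  obtain ⟨p, hp, hle⟩ := h.exists_mem_dist_sq_le z
  exact (pow_le_pow_left₀ dist_nonneg (hz p hp) 2).trans hle

theorem cell_subset_ball (h : UnitTiling X τ v c) (q : ℂ) : planeVoronoiCell X q ⊆ ball q 1 := by
  intro z hz
  have := h.dist_sq_le_of_mem_cell hz
  rw [mem_ball, ← pow_lt_pow_iff_left₀ dist_nonneg zero_le_one two_ne_zero]
  linarith

theorem isCompact_cell (h : UnitTiling X τ v c) (q : ℂ) : IsCompact (planeVoronoiCell X q) :=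
  Metric.isCompact_of_isClosed_isBounded (isClosed_cell X q)
    (isBounded_ball.subset (h.cell_subset_ball q))

theorem ball_subset_cell (h : UnitTiling X τ v c) {q : ℂ} (hq : q ∈ X) :
    ball q (1 / 2) ⊆ planeVoronoiCell X q := by
  intro z hz y hy
  by_cases hyq : y = q
  · rw [hyq]
  have h1 := h.separated y hy q hq hyq
  have h2 := dist_triangle y z q
  rw [mem_ball] at hz
  rw [dist_comm z y]
  linarith

theorem finite_inter_ball (h : UnitTiling X τ v c) (z : ℂ) (r : ℝ) : (X ∩ ball z r).Finite := by
  have hs : X.Pairwise fun x y => 1 ≤ dist x y := fun x hx y hy hxy => h.separated x hx y hy hxy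
  have hd : DiscreteTopology X := DiscreteTopology.of_forall_le_dist zero_lt_one
    fun x y hxy => hs x.2 y.2 (Subtype.coe_injective.ne hxy)
  rw [inter_comm]
  exact Metric.finite_isBounded_inter_isClosed hd.isDiscrete isBounded_ball
    (Metric.isClosed_of_pairwise_le_dist zero_lt_one hs)

theorem finite_tiles (h : UnitTiling X τ v c) (q : ℂ) : {i | q ∈ v i}.Finite := by
  refine Set.Finite.of_finite_image (f := v) ?_ h.injective.injOn
  refine (h.finite_inter_ball q 2).finite_subsets.subset ?_
  rintro _ ⟨i, hi, rfl⟩ p hp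
  refine ⟨h.subset i hp, mem_ball.2 ?_⟩
  have h1 := (h.tile i).dist_centre hp
  have h2 := (h.tile i).dist_centre hi
  have h3 := dist_triangle_right p q (c i)
  have h4 := (τ i).radius_sq_le
  nlinarith [(τ i).radius_pos]

theorem not_extreme_midpoint {S : Set ℂ} {a b : ℂ} (hab : b ≠ 0) (h1 : a + b ∈ S)
    (h2 : a - b ∈ S) : a ∉ S.extremePoints ℝ := by
  intro ha
  have := (mem_extremePoints_iff_left.1 ha).2 _ h1 _ h2 ⟨1 / 2, 1 / 2, by norm_num, by norm_num,
    by norm_num, by simp only [Complex.real_smul]; push_cast; ring⟩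
  exact hab (by simpa using this)

/-- On the cell of `q` the affine function comparing the squared distances to `q` and `q'` is
nonpositive, and the intersection is its zero set. -/
theorem isExtreme_cell_inter (X : Set ℂ) {q q' : ℂ} (hq : q ∈ X) (hq' : q' ∈ X) :
    IsExtreme ℝ (planeVoronoiCell X q) (planeVoronoiCell X q ∩ planeVoronoiCell X q') := by
  refine ⟨inter_subset_left, ?_⟩
  rintro x hx y hy z ⟨hz, hz'⟩ ⟨a, b, ha, hb, hab, rfl⟩
  refine ⟨hx, fun w hw => le_trans ?_ (hx w hw)⟩
  have e0 := le_antisymm (hz q' hq') (hz' q hq)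
  have e1 := dist_sq_sub_dist_sq_combo (x := x) (y := y) (p := q) (q := q') hab
  rw [e0, sub_self] at e1
  have e2 := pow_le_pow_left₀ dist_nonneg (hy q' hq') 2
  rw [← pow_le_pow_iff_left₀ dist_nonneg dist_nonneg two_ne_zero]
  by_contra! hlt
  nlinarith

/-- Such a point is equidistant from all corners. If it were not the centre, it and its mirror image
in the centre would both have an acute angle with some corner, and equality of the distances makes
these two inequalities contradict each other. -/
theorem eq_of_mem_cells (h : UnitTiling X τ v c) {i : ι} {z : ℂ}
    (hz : ∀ p ∈ v i, z ∈ planeVoronoiCell X p) : z = c i := by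
  by_contra hne
  obtain ⟨p, hp, hlt⟩ := (h.tile i).exists_dist_lt hne
  have heq : ∀ p' ∈ v i, dist z p' = dist z p := fun p' hp' =>
    le_antisymm (hz p' hp' p (h.subset i hp)) (hz p hp p' (h.subset i hp'))
  -- reflect in the centre
  obtain ⟨p', hp', hlt'⟩ := (h.tile i).exists_dist_lt (z := 2 * c i - z) (by
    intro h2; apply hne; linear_combination -h2)
  have e1 : dist (2 * c i - z) p' ^ 2 = 2 * dist z (c i) ^ 2 + 2 * (τ i).radius ^ 2 -
      dist z p' ^ 2 := by
    rw [← (h.tile i).dist_centre hp']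
    simp only [dist_sq_complex]; simp; ring
  have e2 : dist (2 * c i - z) (c i) ^ 2 = dist z (c i) ^ 2 := by
    simp only [dist_sq_complex]; simp; ring
  rw [e1, e2, heq p' hp'] at hlt'
  linarith

/-- An extreme point of the cell lies in the kite at `q` of some tile, and the kite is contained in
the cell, so the point is a corner of the kite. The corner `q` is interior to the cell, and an edge
midpoint is interior to a segment of the bisector inside the cell; only the centre is left.
Conversely a centre is the intersection of faces of the cell. -/
theorem extremePoints_cell (h : UnitTiling X τ v c) {q : ℂ} (hq : q ∈ X) :
    (planeVoronoiCell X q).extremePoints ℝ = c '' {i | q ∈ v i} := by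
  ext z
  constructor
  · intro hz
    have hzq := extremePoints_subset hz
    obtain ⟨i, hi⟩ := h.cover z
    have hqi := h.mem_of_mem_cell hq hzq hi
    obtain ⟨u, hu, m1, m2, hk⟩ := (h.tile i).kite hqi hi fun p hp => hzq p (h.subset i hp)
    have hu0 : u ≠ 0 := by rintro rfl; simp at hu
    have mid : ∀ w : ℂ, ‖w‖ = 1 → q + w ∈ v i →
        q + w / 2 ∈ planeVoronoiCell X q \ (planeVoronoiCell X q).extremePoints ℝ := by
      intro w hw hqw
      have hw0 : w ≠ 0 := by rintro rfl; simp at hw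
      have b := fun ε hε => (h.bisector_mem_cell hq hw (h.subset i hqw) (ε := ε) hε).1
      refine ⟨by simpa using b 0 (by norm_num), ?_⟩
      refine not_extreme_midpoint (b := ((1 / 10 : ℝ) : ℂ) * (Complex.I * w)) ?_ (b _ ?_) ?_
      · simp [hw0]
      · rw [abs_of_pos (by norm_num)]
      · have := b (-(1 / 10)) (by rw [abs_neg, abs_of_pos (by norm_num)])
        convert this using 1
        push_cast; ring
    have m1' := mid u hu m1
    have m2' := mid (u * (τ i).dir) (by rw [norm_mul, hu, (τ i).norm_dir, one_mul]) m2
    have hq0 : q ∈ planeVoronoiCell X q \ (planeVoronoiCell X q).extremePoints ℝ := by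
      refine ⟨fun y _ => by simp, ?_⟩
      have := h.ball_subset_cell hq
      refine not_extreme_midpoint (b := 1 / 4) (by norm_num) (this ?_) (this ?_) <;>
      · simp [dist_eq_norm]; norm_num
    have hcq := (h.centre_mem_cell hq).2 hqi
    have hsub : convexHull ℝ {q, q + u / 2, q + u * (τ i).dir / 2, c i} ⊆
        planeVoronoiCell X q := by
      refine convexHull_min ?_ (convex_cell X q)
      rintro y (rfl | rfl | rfl | rfl)
      exacts [hq0.1, m1'.1, m2'.1, hcq]
    have := extremePoints_convexHull_subset
      (inter_extremePoints_subset_extremePoints_of_subset hsub ⟨hk, hz⟩)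
    rcases this with rfl | rfl | rfl | rfl
    exacts [absurd hz hq0.2, absurd hz m1'.2, absurd hz m2'.2, ⟨i, hqi, rfl⟩]
  · rintro ⟨i, hi, rfl⟩
    rw [← isExtreme_singleton]
    have : ({c i} : Set ℂ) = ⋂ p : v i, planeVoronoiCell X q ∩ planeVoronoiCell X p := by
      ext z
      simp only [mem_singleton_iff, mem_iInter, mem_inter_iff]
      constructor
      · rintro rfl p
        exact ⟨(h.centre_mem_cell hq).2 hi, (h.centre_mem_cell (h.subset i p.2)).2 p.2⟩
      · intro hz
        exact h.eq_of_mem_cells fun p hp => (hz ⟨p, hp⟩).2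
    rw [this]
    have : Nonempty (v i) := ⟨⟨q, hi⟩⟩
    exact isExtreme_iInter fun p => isExtreme_cell_inter X hq (h.subset i p.2)

/-- Krein–Milman; the closure is superfluous since there are finitely many extreme points. -/
theorem cell_eq_convexHull (h : UnitTiling X τ v c) {q : ℂ} (hq : q ∈ X) :
    planeVoronoiCell X q = convexHull ℝ (c '' {i | q ∈ v i}) := by
  rw [← h.extremePoints_cell hq]
  have hf : ((planeVoronoiCell X q).extremePoints ℝ).Finite := by
    rw [h.extremePoints_cell hq]
    exact (h.finite_tiles q).image c
  rw [← (hf.isClosed_convexHull ℝ).closure_eq]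
  exact (closure_convexHull_extremePoints (h.isCompact_cell q) (convex_cell X q)).symm

end UnitTiling

/-! ### Edges of the tiling and duality with the Voronoi tessellation. -/

namespace IsUnitTile
variable {τ : TileType} {v : Set ℂ} {c : ℂ}

/-- The corners lie on the circumscribed circle, and a disc is strictly convex. -/
theorem extremePoints (h : IsUnitTile τ v c) : (convexHull ℝ v).extremePoints ℝ = v := by
  refine extremePoints_convexHull_subset.antisymm fun p hp => ?_
  refine inter_extremePoints_subset_extremePoints_of_subset (B := convexHull ℝ v)
    (A := closedBall c τ.radius) (convexHull_min (fun p hp => mem_closedBall.2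
      (h.dist_centre hp).le) (convex_closedBall _ _)) ⟨subset_convexHull ℝ _ hp, ?_⟩
  exact StrictConvexSpace.sphere_subset_extremePoints_closedBall
    _ τ.radius_pos.ne' (mem_sphere.2 (h.dist_centre hp))

/-- Two corners of a unit tile have distance `1`, or are opposite corners of a square. -/
theorem dist_eq_one_or (h : IsUnitTile τ v c) {p q : ℂ} (hp : p ∈ v) (hq : q ∈ v) (hpq : p ≠ q) :
    dist p q = 1 ∨ (dist p q ^ 2 = 2 ∧ c = (p + q) / 2) := by
  obtain ⟨u, hu, rfl, rfl⟩ := h.exists_of_mem hp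
  obtain ⟨ζ, hζ, rfl⟩ := hq
  have hd : dist p (p + u * ζ) = ‖ζ‖ := by simp [hu]
  rw [hd]
  rcases τ.mem_corners hζ with rfl | rfl | rfl | ⟨rfl, rfl⟩
  · simp at hpq
  · simp
  · simp [τ.norm_dir]
  · right
    constructor
    · rw [Complex.sq_norm, Complex.normSq_apply]; norm_num
    · simp [TileType.centre]; ring

end IsUnitTile

namespace UnitTiling

variable {ι : Type*} {X : Set ℂ} {τ : ι → TileType} {v : ι → Set ℂ} {c : ι → ℂ}

/-- Otherwise the two points are opposite corners of a square in both tiles. Both centres would then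
be their midpoint, contrary to `centre_injective`. -/
theorem dist_eq_one_of_mem_inter (h : UnitTiling X τ v c) {i j : ι} (hij : i ≠ j) {p q : ℂ}
    (hp : p ∈ v i ∩ v j) (hq : q ∈ v i ∩ v j) (hpq : p ≠ q) : dist p q = 1 := by
  rcases (h.tile i).dist_eq_one_or hp.1 hq.1 hpq with h1 | ⟨h1, h2⟩
  · exact h1
  rcases (h.tile j).dist_eq_one_or hp.2 hq.2 hpq with h3 | ⟨h3, h4⟩
  · exact h3
  exact absurd (h.centre_injective (h2.trans h4.symm)) hij

/-- The circumcircles have different centres, so they share at most two points. -/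
theorem inter_eq_pair (h : UnitTiling X τ v c) {i j : ι} (hij : i ≠ j) {p q : ℂ}
    (hp : p ∈ v i ∩ v j) (hq : q ∈ v i ∩ v j) (hpq : p ≠ q) : v i ∩ v j = {p, q} := by
  ext x
  constructor
  · intro hx
    exact EuclideanGeometry.eq_of_dist_eq_of_dist_eq_of_finrank_eq_two (V := ℂ)
      Complex.finrank_real_complex (h.centre_injective.ne hij) hpq
      ((h.tile i).dist_centre hp.1) ((h.tile i).dist_centre hq.1) ((h.tile i).dist_centre hx.1)
      ((h.tile j).dist_centre hp.2) ((h.tile j).dist_centre hq.2) ((h.tile j).dist_centre hx.2)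
  · rintro (rfl | rfl)
    exacts [hp, hq]

/-- By the Delaunay property each tile lies on its own side of the radical axis of the two
circumcircles. A common point therefore lies on the axis, hence in the hull of the corners of the
first tile on the axis, and these lie on both circles. -/
theorem convexHull_inter (h : UnitTiling X τ v c) (i j : ι) :
    convexHull ℝ (v i) ∩ convexHull ℝ (v j) = convexHull ℝ (v i ∩ v j) := by
  refine Subset.antisymm ?_ (subset_inter (convexHull_mono inter_subset_left)
    (convexHull_mono inter_subset_right))
  rintro z ⟨hi, hj⟩
  have le : ∀ i j, ∀ x ∈ v i, dist x (c i) ^ 2 - dist x (c j) ^ 2 ≤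
      (τ i).radius ^ 2 - (τ j).radius ^ 2 := by
    intro i j x hx
    rw [(h.tile i).dist_centre hx]
    refine sub_le_sub_left (pow_le_pow_left₀ (τ j).radius_pos.le ?_ 2) _
    by_contra! hlt
    have := (h.tile j).dist_centre (h.mem_of_dist_centre_le (h.subset i hx) hlt.le)
    linarith
  have h1 := power_le_of_mem_convexHull hi (le i j)
  have h2 := power_le_of_mem_convexHull hj (le j i)
  refine convexHull_mono ?_ (mem_convexHull_of_power_eq hi (le i j) (by linarith))
  rintro x ⟨hx, he⟩
  refine ⟨hx, h.mem_of_dist_centre_le (h.subset i hx) ?_⟩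
  rw [(h.tile i).dist_centre hx] at he
  exact (pow_le_pow_iff_left₀ dist_nonneg (τ j).radius_pos.le two_ne_zero).1 (by linarith)

/-- By Krein–Milman a nontrivial compact convex set has two extreme points. Since the intersection
is a face of the cell, they are extreme in the cell and thus centres of tiles; each of these tiles
has both `q` and `q'` as corners. -/
theorem exists_ne_of_nontrivial (h : UnitTiling X τ v c) {q q' : ℂ} (hq : q ∈ X) (hq' : q' ∈ X)
    (hn : (planeVoronoiCell X q ∩ planeVoronoiCell X q').Nontrivial) :
    ∃ i j, i ≠ j ∧ q ∈ v i ∩ v j ∧ q' ∈ v i ∩ v j := by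
  set S := planeVoronoiCell X q ∩ planeVoronoiCell X q' with hS
  have hSc : IsCompact S := (h.isCompact_cell q).inter_right (isClosed_cell X q')
  have hconv : Convex ℝ S := (convex_cell X q).inter (convex_cell X q')
  have hext : ∀ z ∈ S.extremePoints ℝ, ∃ i, z = c i ∧ q ∈ v i ∧ q' ∈ v i := by
    intro z hz
    have h1 := (isExtreme_cell_inter X hq hq').extremePoints_subset_extremePoints hz
    rw [h.extremePoints_cell hq] at h1
    obtain ⟨i, hi, rfl⟩ := h1
    exact ⟨i, rfl, hi, (h.centre_mem_cell hq').1 (extremePoints_subset hz).2⟩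
  have hnt : (S.extremePoints ℝ).Nontrivial := by
    by_contra hcon
    rw [not_nontrivial_iff] at hcon
    have hKM := closure_convexHull_extremePoints hSc hconv
    rcases hcon.eq_empty_or_singleton with h0 | ⟨x, h0⟩
    · rw [h0] at hKM
      simp at hKM
      rw [← hKM] at hn
      exact absurd hn.nonempty (by simp)
    · rw [h0] at hKM
      simp at hKM
      rw [← hKM] at hn
      exact not_nontrivial_singleton hn
  obtain ⟨z, hz, z', hz', hne⟩ := hnt
  obtain ⟨i, rfl, hi⟩ := hext z hz
  obtain ⟨j, rfl, hj⟩ := hext z' hz'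
  exact ⟨i, j, fun hij => hne (by rw [hij]), ⟨hi.1, hj.1⟩, hi.2, hj.2⟩

theorem isPlaneTiling_voronoi (h : UnitTiling X τ v c) : IsPlaneTiling (planeVoronoi X) where
  polygon := by
    rintro _ ⟨q, hq, rfl⟩
    refine ⟨⟨q, interior_mono (h.ball_subset_cell hq) ?_⟩, _, (h.finite_tiles q).image c,
      h.cell_eq_convexHull hq⟩
    rw [isOpen_ball.interior_eq]
    exact mem_ball_self (by norm_num)
  covers := by
    refine eq_univ_of_forall fun z => ?_
    obtain ⟨p, hp, hle⟩ := h.exists_mem_dist_sq_le z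
    have hp1 : p ∈ X ∩ ball z 1 := ⟨hp, by
      rw [mem_ball, dist_comm, ← pow_lt_pow_iff_left₀ dist_nonneg zero_le_one two_ne_zero]
      linarith⟩
    obtain ⟨q, hq, hmin⟩ := (h.finite_inter_ball z 1).exists_minimalFor (fun p => dist z p) _
      ⟨p, hp1⟩
    refine ⟨_, ⟨q, hq.1, rfl⟩, fun y hy => ?_⟩
    by_cases hy1 : y ∈ ball z 1
    · exact (le_total (dist z q) (dist z y)).elim id fun hle => hmin ⟨hy, hy1⟩ hle
    · have := hq.2
      rw [mem_ball, dist_comm] at this hy1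
      linarith
  disjoint := by
    rintro _ ⟨q, hq, rfl⟩ _ ⟨q', hq', rfl⟩ hne
    have hqq : q ≠ q' := by rintro rfl; exact hne rfl
    rw [Set.disjoint_left]
    intro z hz hz'
    have hmem : interior (planeVoronoiCell X q) ∩ interior (planeVoronoiCell X q') ∈ 𝓝 z :=
      (isOpen_interior.inter isOpen_interior).mem_nhds ⟨hz, hz'⟩
    obtain ⟨ε, hε, hball⟩ := Metric.mem_nhds_iff.1 hmem
    have hd : 0 < dist q q' := dist_pos.2 hqq
    have heq : ∀ w ∈ ball z ε, dist w q ^ 2 = dist w q' ^ 2 := fun w hw => by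
      have := hball hw
      rw [le_antisymm (interior_subset this.1 q' hq') (interior_subset this.2 q hq)]
    -- The translation by `s * (q - q')` has length `ε / 2`, so it stays in the ball where both
    -- distances agree, but it changes their difference.
    set s : ℝ := ε / (2 * dist q q') with hs
    have hs0 : 0 < s := by positivity
    have e1 := heq z (mem_ball_self hε)
    have e2 := heq (z + s * (q - q')) (by
      rw [mem_ball, dist_eq_norm, add_sub_cancel_left, norm_mul, ← dist_eq_norm,
        Complex.norm_real, Real.norm_of_nonneg hs0.le, hs]
      field_simp
      linarith)
    simp only [dist_sq_complex] at e1 e2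
    simp at e1 e2
    have e3 : s * dist q q' ^ 2 = 0 := by
      rw [dist_sq_complex]
      linarith
    exact (mul_pos hs0 (pow_pos hd 2)).ne' e3
  locallyFinite := by
    intro z
    refine ⟨ball z 1, ball_mem_nhds z one_pos, ?_⟩
    refine Set.Finite.of_finite_image (f := Subtype.val) ?_ Subtype.val_injective.injOn
    refine ((h.finite_inter_ball z 2).image (planeVoronoiCell X)).subset ?_
    rintro _ ⟨⟨_, q, hq, rfl⟩, ⟨w, hw, hwz⟩, rfl⟩
    refine ⟨q, ⟨hq, ?_⟩, rfl⟩
    have h1 := h.cell_subset_ball q hw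
    rw [mem_ball] at *
    have := dist_triangle_left q z w
    linarith
  edge_to_edge := by
    rintro _ ⟨q, hq, rfl⟩ _ ⟨q', hq', rfl⟩ _
    exact isExtreme_cell_inter X hq hq'

theorem cell_injOn (X : Set ℂ) : InjOn (planeVoronoiCell X) X := by
  intro q hq q' hq' he
  have : q' ∈ planeVoronoiCell X q := he ▸ fun y _ => by simp
  have := this q' hq'
  rw [dist_self] at this
  exact (dist_le_zero.1 this).symm

theorem tilingVertices_range (h : UnitTiling X τ v c) :
    tilingVertices (range fun i => convexHull ℝ (v i)) = X := by
  ext x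
  simp only [tilingVertices, mem_ofPred_eq, exists_range_iff, (h.tile _).extremePoints,
    h.vertices, mem_iUnion]

theorem tilingVertices_voronoi (h : UnitTiling X τ v c) :
    tilingVertices (planeVoronoi X) = range c := by
  ext x
  constructor
  · rintro ⟨_, ⟨q, hq, rfl⟩, hx⟩
    rw [h.extremePoints_cell hq] at hx
    obtain ⟨i, -, rfl⟩ := hx
    exact ⟨i, rfl⟩
  · rintro ⟨i, rfl⟩
    obtain ⟨q, hq⟩ := (h.tile i).nonempty
    exact ⟨_, ⟨q, h.subset i hq, rfl⟩, by
      rw [h.extremePoints_cell (h.subset i hq)]; exact ⟨i, hq, rfl⟩⟩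

theorem convexHull_injective (h : UnitTiling X τ v c) :
    Function.Injective fun i => convexHull ℝ (v i) := by
  intro i j hij
  apply h.injective
  rw [← (h.tile i).extremePoints, ← (h.tile j).extremePoints]
  exact congrArg _ hij

/-- Two corners shared by two tiles. -/
def IsEdgePair (v : ι → Set ℂ) (s : Set ℂ) : Prop :=
  ∃ i j, i ≠ j ∧ ∃ p q, p ≠ q ∧ s = {p, q} ∧ s = v i ∩ v j

theorem mem_tilingEdges_iff (h : UnitTiling X τ v c) (e : Set ℂ) :
    e ∈ tilingEdges (range fun i => convexHull ℝ (v i)) ↔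
      ∃ s, IsEdgePair v s ∧ e = convexHull ℝ s := by
  constructor
  · rintro ⟨hn, _, ⟨i, rfl⟩, _, ⟨j, rfl⟩, hne, rfl⟩
    have hij : i ≠ j := by rintro rfl; exact hne rfl
    simp only [h.convexHull_inter] at hn
    have hnt : (v i ∩ v j).Nontrivial := by
      by_contra hcon
      rw [not_nontrivial_iff] at hcon
      rcases hcon.eq_empty_or_singleton with h0 | ⟨x, h0⟩
      · rw [h0, convexHull_empty] at hn
        exact absurd hn.nonempty (by simp)
      · rw [h0, convexHull_singleton] at hn
        exact not_nontrivial_singleton hn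
    obtain ⟨p, hp, q, hq, hpq⟩ := hnt
    exact ⟨v i ∩ v j, ⟨i, j, hij, p, q, hpq, h.inter_eq_pair hij hp hq hpq, rfl⟩,
      h.convexHull_inter i j⟩
  · rintro ⟨s, ⟨i, j, hij, p, q, hpq, hs, hs'⟩, rfl⟩
    refine ⟨?_, _, ⟨i, rfl⟩, _, ⟨j, rfl⟩, h.convexHull_injective.ne hij, ?_⟩
    · exact (show s.Nontrivial from hs ▸ nontrivial_pair hpq).mono (subset_convexHull ℝ s)
    · rw [hs', h.convexHull_inter]

/-- Both tilings have their edges indexed by the same pairs of corners. The intersection of the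
cells of such a pair is nontrivial because it contains the centres of the two tiles sharing the
pair. -/
theorem mem_tilingEdges_voronoi_iff (h : UnitTiling X τ v c) (e : Set ℂ) :
    e ∈ tilingEdges (planeVoronoi X) ↔
      ∃ s, IsEdgePair v s ∧ e = ⋂ p ∈ s, planeVoronoiCell X p := by
  constructor
  · rintro ⟨hn, _, ⟨q, hq, rfl⟩, _, ⟨q', hq', rfl⟩, hne, rfl⟩
    have hqq : q ≠ q' := by rintro rfl; exact hne rfl
    obtain ⟨i, j, hij, h1, h2⟩ := h.exists_ne_of_nontrivial hq hq' hn
    exact ⟨{q, q'}, ⟨i, j, hij, q, q', hqq, rfl, (h.inter_eq_pair hij h1 h2 hqq).symm⟩, by simp⟩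
  · rintro ⟨s, ⟨i, j, hij, p, q, hpq, hs, hs'⟩, rfl⟩
    have hp : p ∈ v i ∩ v j := by rw [← hs', hs]; simp
    have hq : q ∈ v i ∩ v j := by rw [← hs', hs]; simp
    have hpX := h.subset i hp.1
    have hqX := h.subset i hq.1
    refine ⟨⟨c i, ?_, c j, ?_, h.centre_injective.ne hij⟩, _, ⟨p, hpX, rfl⟩, _, ⟨q, hqX, rfl⟩,
      (cell_injOn X).ne hpX hqX hpq, by rw [hs]; simp⟩
    · rw [hs]
      simp [h.centre_mem_cell hpX, h.centre_mem_cell hqX, hp.1, hq.1]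
    · rw [hs]
      simp [h.centre_mem_cell hpX, h.centre_mem_cell hqX, hp.2, hq.2]

end UnitTiling

namespace UnitTiling

variable {ι : Type*} {X : Set ℂ} {τ : ι → TileType} {v : ι → Set ℂ} {c : ι → ℂ}

theorem IsEdgePair.subset (h : UnitTiling X τ v c) {s : Set ℂ} (hs : IsEdgePair v s) : s ⊆ X := by
  obtain ⟨i, j, -, p, q, -, -, rfl⟩ := hs
  exact inter_subset_left.trans (h.subset i)

theorem IsEdgePair.mem_convexHull_iff (h : UnitTiling X τ v c) {s : Set ℂ} (hs : IsEdgePair v s)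
    {x : ℂ} (hx : x ∈ X) : x ∈ convexHull ℝ s ↔ x ∈ s := by
  refine ⟨fun hxs => ?_, fun hxs => subset_convexHull ℝ s hxs⟩
  obtain ⟨i, j, -, p, q, -, -, rfl⟩ := hs
  rw [← h.convexHull_inter] at hxs
  exact ⟨h.mem_of_mem_convexHull hx hxs.1, h.mem_of_mem_convexHull hx hxs.2⟩

theorem centre_mem_iInter_cell (h : UnitTiling X τ v c) {s : Set ℂ} (hs : s ⊆ X) (i : ι) :
    c i ∈ ⋂ p ∈ s, planeVoronoiCell X p ↔ s ⊆ v i := by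
  simp only [mem_iInter]
  exact forall₂_congr fun p hp => h.centre_mem_cell (hs hp)

theorem IsEdgePair.iInter_cell_subset_iff (h : UnitTiling X τ v c) {s : Set ℂ}
    (hs : IsEdgePair v s) {x : ℂ} (hx : x ∈ X) :
    ⋂ p ∈ s, planeVoronoiCell X p ⊆ planeVoronoiCell X x ↔ x ∈ s := by
  refine ⟨fun hsub => ?_, fun hxs => biInter_subset_of_mem hxs⟩
  have hsX := hs.subset h
  obtain ⟨i, j, -, p, q, -, -, rfl⟩ := hs
  have key := fun k hk => (h.centre_mem_cell (i := k) hx).1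
    (hsub ((h.centre_mem_iInter_cell hsX k).2 hk))
  exact ⟨key i inter_subset_left, key j inter_subset_right⟩

theorem convexHull_subset_iff (h : UnitTiling X τ v c) {s : Set ℂ} (hs : s ⊆ X) (i : ι) :
    convexHull ℝ s ⊆ convexHull ℝ (v i) ↔ s ⊆ v i :=
  ⟨fun hsub _ hp => h.mem_of_mem_convexHull (hs hp) (hsub (subset_convexHull ℝ s hp)),
    fun hsub => convexHull_mono hsub⟩

/-- With vertices indexed by `X`, tiles by `ι` and edges by edge pairs on both sides, every
incidence in either tiling reduces to the same relation: `x ∈ s`, `s ⊆ v i` or `x ∈ v i`. -/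
theorem isDualTiling_voronoi (h : UnitTiling X τ v c) :
    IsDualTiling (range fun i => convexHull ℝ (v i)) (planeVoronoi X) := by
  have hE1 : tilingEdges (range fun i => convexHull ℝ (v i)) =
      (fun s => convexHull ℝ s) '' {s | IsEdgePair v s} := by
    ext e
    simp only [h.mem_tilingEdges_iff, mem_image, mem_ofPred_eq, eq_comm]
  have hE2 : (fun s => ⋂ p ∈ s, planeVoronoiCell X p) '' {s | IsEdgePair v s} =
      tilingEdges (planeVoronoi X) := by
    ext e
    simp only [h.mem_tilingEdges_voronoi_iff, mem_image, mem_ofPred_eq, eq_comm]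
  have hi1 : InjOn (fun s => convexHull ℝ s) {s | IsEdgePair v s} := by
    intro s hs s' hs' he
    ext x
    by_cases hx : x ∈ X
    · rw [← hs.mem_convexHull_iff h hx, ← hs'.mem_convexHull_iff h hx]
      dsimp only at he
      rw [he]
    · exact iff_of_false (fun hxs => hx (hs.subset h hxs)) fun hxs => hx (hs'.subset h hxs)
  have hi2 : InjOn (fun s => ⋂ p ∈ s, planeVoronoiCell X p) {s | IsEdgePair v s} := by
    intro s hs s' hs' he
    ext x
    by_cases hx : x ∈ X
    · rw [← hs.iInter_cell_subset_iff h hx, ← hs'.iInter_cell_subset_iff h hx]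
      dsimp only at he
      rw [he]
    · exact iff_of_false (fun hxs => hx (hs.subset h hxs)) fun hxs => hx (hs'.subset h hxs)
  let f : tilingVertices (range fun i => convexHull ℝ (v i)) ≃ planeVoronoi X :=
    (Equiv.setCongr h.tilingVertices_range).trans (Equiv.Set.imageOfInjOn _ X (cell_injOn X))
  let k : tilingEdges (range fun i => convexHull ℝ (v i)) ≃ tilingEdges (planeVoronoi X) :=
    (Equiv.setCongr hE1).trans ((Equiv.Set.imageOfInjOn _ _ hi1).symm.trans
      ((Equiv.Set.imageOfInjOn _ _ hi2).trans (Equiv.setCongr hE2)))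
  let g : (range fun i => convexHull ℝ (v i)) ≃ tilingVertices (planeVoronoi X) :=
    (Equiv.ofInjective _ h.convexHull_injective).symm.trans
      ((Equiv.ofInjective _ h.centre_injective).trans (Equiv.setCongr h.tilingVertices_voronoi.symm))
  have hf : ∀ x, (f x : Set ℂ) = planeVoronoiCell X x := fun x => rfl
  have hx : ∀ x : tilingVertices (range fun i => convexHull ℝ (v i)), (x : ℂ) ∈ X := fun x =>
    h.tilingVertices_range ▸ x.2
  have hk : ∀ e : tilingEdges (range fun i => convexHull ℝ (v i)), ∃ s, IsEdgePair v s ∧ (e : Set ℂ) = convexHull ℝ s ∧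
      (k e : Set ℂ) = ⋂ p ∈ s, planeVoronoiCell X p := by
    intro e
    obtain ⟨s, hs⟩ := (Equiv.Set.imageOfInjOn _ _ hi1).surjective (Equiv.setCongr hE1 e)
    refine ⟨s, s.2, (congrArg Subtype.val hs).symm, ?_⟩
    simp only [k, Equiv.trans_apply, ← hs, Equiv.symm_apply_apply]
    rfl
  have hg : ∀ σ : range fun i => convexHull ℝ (v i), ∃ i, (σ : Set ℂ) = convexHull ℝ (v i) ∧ (g σ : ℂ) = c i := by
    intro σ
    obtain ⟨i, rfl⟩ := (Equiv.ofInjective _ h.convexHull_injective).surjective σ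
    refine ⟨i, rfl, ?_⟩
    simp only [g, Equiv.trans_apply, Equiv.symm_apply_apply]
    rfl
  refine ⟨f, k, g, fun x e => ?_, fun e σ => ?_, fun x σ => ?_⟩
  · obtain ⟨s, hs, h1, h2⟩ := hk e
    rw [h1, h2, hf, hs.mem_convexHull_iff h (hx x), hs.iInter_cell_subset_iff h (hx x)]
  · obtain ⟨s, hs, h1, h2⟩ := hk e
    obtain ⟨i, h3, h4⟩ := hg σ
    rw [h1, h2, h3, h4, h.centre_mem_iInter_cell (hs.subset h),
      h.convexHull_subset_iff (hs.subset h)]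
  · obtain ⟨i, h3, h4⟩ := hg σ
    rw [h3, h4, hf, h.centre_mem_cell (hx x)]
    exact ⟨h.mem_of_mem_convexHull (hx x), fun hm => subset_convexHull ℝ _ hm⟩

/-! ### The tiles around a vertex -/

/-- The tile to the left of a unit edge. -/
theorem exists_left_tile (h : UnitTiling X τ v c) {q u : ℂ} (hq : q ∈ X) (hu : ‖u‖ = 1)
    (hq' : q + u ∈ X) :
    ∃ i, v i = (fun ζ => q + u * ζ) '' (τ i).corners ∧ c i = q + u * (τ i).centre := by
  have hu0 : u ≠ 0 := by rintro rfl; simp at hu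
  -- A point slightly to the left of the edge midpoint is in the Voronoi cells of both ends, so a
  -- tile containing it has both ends as corners.
  have hb := h.bisector_mem_cell hq hu hq' (ε := 1 / 10) (by rw [abs_of_pos (by norm_num)])
  set z := q + u / 2 + ((1 / 10 : ℝ) : ℂ) * (Complex.I * u) with hz
  obtain ⟨i, hi⟩ := h.cover z
  have m1 := h.mem_of_mem_cell hq hb.1 hi
  have m2 := h.mem_of_mem_cell hq' hb.2 hi
  obtain ⟨w, hw, hv, hc⟩ := (h.tile i).exists_of_mem m1
  have hw0 : w ≠ 0 := by rintro rfl; simp at hw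
  suffices u = w by exact ⟨i, this ▸ hv, this ▸ hc⟩
  have m2' := m2
  rw [hv] at m2
  obtain ⟨ζ, hζ, he⟩ := m2
  have hue : u = w * ζ := (add_left_cancel he).symm
  rcases (τ i).mem_corners hζ with rfl | rfl | rfl | ⟨hO, rfl⟩
  · simp at hue; exact absurd hue hu0
  · simpa using hue
  · exfalso
    -- the tile lies to the right of the edge
    let f : ℂ →ᵃ[ℝ] ℂ := (LinearMap.mulLeft ℝ w).toAffineMap + AffineMap.const ℝ ℂ q
    have hf : (f : ℂ → ℂ) = fun ζ => q + w * ζ := funext fun ζ => by simp [f, add_comm]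
    rw [hv, ← hf, ← f.image_convexHull] at hi
    obtain ⟨ξ, hξ, hξz⟩ := hi
    rw [hf] at hξz
    set d := (τ i).dir with hd
    -- In the coordinates of the tile the edge points along `d`. The chosen point is strictly to the
    -- left of that line, while the whole tile is on its right.
    have hξe : ξ = d * (1 / 2 + ((1 / 10 : ℝ) : ℂ) * Complex.I) := by
      apply mul_left_cancel₀ hw0
      dsimp only at hξz
      linear_combination hξz + hz + (1 / 2 + ((1 / 10 : ℝ) : ℂ) * Complex.I) * hue
    have hdn : d.re ^ 2 + d.im ^ 2 = 1 := by
      have := Complex.sq_norm d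
      rw [hd, (τ i).norm_dir, Complex.normSq_apply] at this
      linarith
    have hdim := (τ i).dir_im_pos
    have hlin : IsLinearMap ℝ fun x : ℂ => d.re * x.im - d.im * x.re := by
      constructor
      · intro x y; simp; ring
      · intro a x; simp; ring
    have := convexHull_min (t := {x : ℂ | d.re * x.im - d.im * x.re ≤ 0}) ?_
      (convex_halfSpace_le hlin 0) hξ
    · rw [hξe] at this
      simp at this
      nlinarith
    · intro p hp
      simp only [mem_ofPred_eq]
      rcases (τ i).mem_corners hp with rfl | rfl | rfl | ⟨hO, rfl⟩
      · simp
      · simpa using hdim.le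
      · rw [← hd]; linarith
      · have : d = Complex.I := by rw [hd, hO]; rfl
        rw [this]; simp
  · have := congrArg norm hue
    rw [norm_mul, hu, hw, one_mul] at this
    have h2 := Complex.sq_norm (1 + Complex.I)
    rw [← this, Complex.normSq_apply] at h2
    norm_num at h2

end UnitTiling

/-- The corner angle of a tile in units of `π / 6`. -/
def TileType.units : TileType → ℕ
  | .T => 2
  | .O => 3

theorem TileType.angle_eq (t : TileType) : t.angle = t.units * (Real.pi / 6) := by
  cases t <;> simp [angle, units] <;> ring

/-- The directions from `n` on, in units of `π / 6`, along the word `w` all satisfy `N`. -/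
def Walk (N : ℕ → Prop) : ℕ → List TileType → Prop
  | n, [] => N n
  | n, t :: w => N n ∧ Walk N (n + t.units) w

theorem Walk.apply_sum {N : ℕ → Prop} {w : List TileType} : ∀ {n : ℕ}, Walk N n w →
    ∀ k, N (n + ((w.take k).map TileType.units).sum) := by
  induction w with
  | nil => intro n h k; simpa [Walk] using h
  | cons t w ih =>
    intro n h k
    cases k with
    | zero => simpa using h.1
    | succ k => simpa [add_assoc] using ih h.2 k

/-- The four cyclic words, from the arithmetic of the angles. -/
theorem exists_walk {N : ℕ → Prop} (h1 : ∀ n, N n → ¬ N (n + 1))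
    (h23 : ∀ n, N n → N (n + 2) ∨ N (n + 3)) (h12 : ∀ n, N (n + 12) ↔ N n) {n₀ : ℕ} (h0 : N n₀) :
    ∃ n, ∃ w ∈ faceWords, Walk N n w := by
  simp only [faceWords, mem_insert_iff, mem_singleton_iff, exists_eq_or_imp, exists_eq_left, Walk,
    TileType.units, add_assoc, Nat.reduceAdd]
  -- Two consecutive gaps of `3` leave `6` of the `12` units, which split as `2 + 2 + 2` or `3 + 3`;
  -- `h1` excludes a remaining gap of `1`. If gaps of `3` are never adjacent, there are two of them,
  -- separated by `2` on one side and by `2 + 2` on the other, or none at all.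
  by_cases hOO : ∃ n, N n ∧ N (n + 3) ∧ N (n + 6)
  · obtain ⟨n, a, b, d⟩ := hOO
    have e := (h12 n).2 a
    refine ⟨n, ?_⟩
    rcases h23 _ d with f | f
    · rcases h23 _ f with g | g
      · tauto
      · exact absurd e (h1 _ g)
    · tauto
  push Not at hOO
  by_cases hO : ∃ n, N n ∧ N (n + 3)
  · obtain ⟨n, a, b⟩ := hO
    have e := (h12 n).2 a
    have e3 := (h12 (n + 3)).2 b
    have d := (h23 _ b).resolve_right (hOO n a b)
    rcases h23 _ d with f | f
    · rcases h23 _ f with g | g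
      · exact absurd e3 (hOO (n + 9) g e)
      -- Here the gaps from `n` on are `3, 2, 2, 3, 2`. Starting at `n + 7` instead turns them into
      -- `3, 2, 3, 2, 2`, the word `OTOTT`.
      · refine ⟨n + 7, ?_⟩
        have e5 := (h12 (n + 5)).2 d
        have e7 := (h12 (n + 7)).2 f
        simp only [add_assoc, Nat.reduceAdd] at *
        tauto
    · refine ⟨n, ?_⟩
      rcases h23 _ f with g | g
      · tauto
      · exact absurd e (h1 _ g)
  push Not at hO
  have h2 : ∀ n, N n → N (n + 2) := fun n hn => (h23 n hn).resolve_right (hO n hn)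
  have a2 := h2 _ h0
  have a4 := h2 _ a2
  have a6 := h2 _ a4
  have a8 := h2 _ a6
  have a10 := h2 _ a8
  have a12 := h2 _ a10
  exact ⟨n₀, Or.inl ⟨h0, a2, a4, a6, a8, a10, a12⟩⟩

theorem faceWords_units {w : List TileType} (hw : w ∈ faceWords) :
    (w.map TileType.units).sum = 12 ∧ 2 ≤ w.length := by
  rcases hw with rfl | rfl | rfl | rfl <;> simp [TileType.units]

theorem TileType.dir_eq_exp (t : TileType) :
    t.dir = Complex.exp (((t.units * (Real.pi / 6) : ℝ) : ℂ) * Complex.I) := by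
  rw [Complex.exp_mul_I, ← Complex.ofReal_cos, ← Complex.ofReal_sin]
  cases t
  · simp only [units, dir, Nat.cast_ofNat, show 2 * (Real.pi / 6) = Real.pi / 3 by ring,
      Real.cos_pi_div_three, Real.sin_pi_div_three]
    apply Complex.ext <;> simp
  · simp only [units, dir, Nat.cast_ofNat, show 3 * (Real.pi / 6) = Real.pi / 2 by ring,
      Real.cos_pi_div_two, Real.sin_pi_div_two]
    simp

theorem TileType.centre_eq_exp (t : TileType) :
    t.centre = (t.radius : ℂ) * Complex.exp (((t.angle / 2 : ℝ) : ℂ) * Complex.I) := by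
  rw [Complex.exp_mul_I, ← Complex.ofReal_cos, ← Complex.ofReal_sin]
  cases t
  · have h3 : √3 ^ 2 = 3 := Real.sq_sqrt (by norm_num)
    have h3' : √3 ≠ 0 := by positivity
    simp only [angle, radius, centre, show Real.pi / 3 / 2 = Real.pi / 6 by ring,
      Real.cos_pi_div_six, Real.sin_pi_div_six]
    apply Complex.ext
    · simp; field_simp; linarith
    · simp; field_simp
  · have h3 : √2 ^ 2 = 2 := Real.sq_sqrt (by norm_num)
    have h3' : √2 ≠ 0 := by positivity
    simp only [angle, radius, centre, show Real.pi / 2 / 2 = Real.pi / 4 by ring,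
      Real.cos_pi_div_four, Real.sin_pi_div_four]
    apply Complex.ext
    · simp; field_simp; exact h3.symm
    · simp; field_simp; exact h3.symm

/-- The direction with index `n`, in units of `π / 6`. -/
def direction (u : ℂ) (n : ℕ) : ℂ := u * Complex.exp (((n * (Real.pi / 6) : ℝ) : ℂ) * Complex.I)

theorem direction_zero (u : ℂ) : direction u 0 = u := by simp [direction]

theorem direction_add (u : ℂ) (m n : ℕ) :
    direction u (m + n) = direction (direction u m) n := by
  simp only [direction, mul_assoc, ← Complex.exp_add]
  push_cast
  ring_nf

theorem direction_units (u : ℂ) (n : ℕ) (t : TileType) :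
    direction u (n + t.units) = direction u n * t.dir := by
  rw [direction_add, t.dir_eq_exp]; rfl

theorem direction_twelve (u : ℂ) (n : ℕ) : direction u (n + 12) = direction u n := by
  rw [direction_add]
  have : ((((12 : ℕ) : ℝ) * (Real.pi / 6) : ℝ) : ℂ) * Complex.I = 2 * Real.pi * Complex.I := by
    push_cast; ring
  rw [direction, this, Complex.exp_two_pi_mul_I, mul_one]

theorem norm_direction {u : ℂ} (hu : ‖u‖ = 1) (n : ℕ) : ‖direction u n‖ = 1 := by
  rw [direction, norm_mul, hu, Complex.norm_exp_ofReal_mul_I, mul_one]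

theorem dist_exp_sq {u : ℂ} (hu : ‖u‖ = 1) (q : ℂ) (α β : ℝ) :
    dist (q + u * Complex.exp (α * Complex.I)) (q + u * Complex.exp (β * Complex.I)) ^ 2 =
      2 - 2 * Real.cos (α - β) := by
  rw [dist_unit_affine hu, dist_sq_complex, Complex.exp_ofReal_mul_I_re,
    Complex.exp_ofReal_mul_I_im, Complex.exp_ofReal_mul_I_re, Complex.exp_ofReal_mul_I_im,
    Real.cos_sub]
  nlinarith [Real.sin_sq_add_cos_sq α, Real.sin_sq_add_cos_sq β]

theorem lt_pi_div_three_of_cos {β : ℝ} (h0 : 0 ≤ β) (h : β < Real.pi / 3) : 1 / 2 < Real.cos β := by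
  rw [← Real.cos_pi_div_three]
  exact Real.cos_lt_cos_of_nonneg_of_le_pi h0 (by linarith [Real.pi_pos]) h

theorem exists_step {s : ℕ → ℕ} {x : ℝ} (h0 : (s 0 : ℝ) ≤ x) : ∀ n, x < s n →
    ∃ k < n, (s k : ℝ) ≤ x ∧ x < s (k + 1) := by
  intro n
  induction n with
  | zero => intro h; linarith
  | succ n ih =>
    intro h
    by_cases hn : x < s n
    · obtain ⟨k, hk, hk'⟩ := ih hn
      exact ⟨k, by omega, hk'⟩
    · exact ⟨n, by omega, not_lt.1 hn, h⟩

/-! ### Directions to the neighbours of a vertex and the cyclic order of its tiles. -/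

namespace UnitTiling

variable {ι : Type*} {X : Set ℂ} {τ : ι → TileType} {v : ι → Set ℂ} {c : ι → ℂ}

/-- Two vertices at distance `1` from `q` in directions `π/6` apart would have squared distance `2 -
2 cos (π/6) < 1`. -/
theorem not_neighbour_succ (h : UnitTiling X τ v c) {q u : ℂ} (hu : ‖u‖ = 1) {n : ℕ}
    (h1 : q + direction u n ∈ X) : q + direction u (n + 1) ∉ X := by
  intro h2
  have hd := dist_exp_sq hu q ((n + 1 : ℕ) * (Real.pi / 6)) (n * (Real.pi / 6))
  have hpi := Real.pi_pos
  rw [show ((n + 1 : ℕ) : ℝ) * (Real.pi / 6) - n * (Real.pi / 6) = Real.pi / 6 by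
    push_cast; ring] at hd
  have hc := lt_pi_div_three_of_cos (β := Real.pi / 6) (by linarith) (by linarith)
  have hc1 : Real.cos (Real.pi / 6) < 1 := by
    have := Real.cos_lt_cos_of_nonneg_of_le_pi le_rfl (by linarith)
      (show (0 : ℝ) < Real.pi / 6 by linarith)
    simpa using this
  have hne : q + direction u (n + 1) ≠ q + direction u n := by
    intro he
    have : dist (q + direction u (n + 1)) (q + direction u n) ^ 2 =
      2 - 2 * Real.cos (Real.pi / 6) := hd
    rw [he, dist_self] at this
    linarith
  have := one_le_pow₀ (n := 2) (h.separated _ h2 _ h1 hne)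
  have h3 : dist (q + direction u (n + 1)) (q + direction u n) ^ 2 =
      2 - 2 * Real.cos (Real.pi / 6) := hd
  linarith

theorem exists_tile_direction (h : UnitTiling X τ v c) {q u : ℂ} (hq : q ∈ X) (hu : ‖u‖ = 1)
    {n : ℕ} (hn : q + direction u n ∈ X) : ∃ i,
      v i = (fun ζ => q + direction u n * ζ) '' (τ i).corners ∧
      c i = q + direction u n * (τ i).centre ∧ q + direction u (n + (τ i).units) ∈ X := by
  obtain ⟨i, hv, hc⟩ := h.exists_left_tile hq (norm_direction hu n) hn
  refine ⟨i, hv, hc, h.subset i ?_⟩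
  rw [direction_units, hv]
  exact ⟨_, (τ i).dir_mem_corners, rfl⟩

/-- The two possible angles differ by one unit, so two different types would produce neighbours in
consecutive directions. -/
theorem type_eq (h : UnitTiling X τ v c) {q u : ℂ} (hu : ‖u‖ = 1) {n : ℕ} {t t' : TileType}
    (h1 : q + direction u (n + t.units) ∈ X) (h2 : q + direction u (n + t'.units) ∈ X) :
    t = t' := by
  cases t <;> cases t'
  · rfl
  · exact absurd h2 (h.not_neighbour_succ hu h1)
  · exact absurd h1 (h.not_neighbour_succ hu h2)
  · rfl

/-- The tile to the left of each unit edge shows that the next neighbour is `2` or `3` units further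
on, which is the input of `exists_walk`. Rotating `u` lets the word start at index `0`. -/
theorem exists_word (h : UnitTiling X τ v c) {q : ℂ} (hq : q ∈ X) :
    ∃ w ∈ faceWords, ∃ u : ℂ, ‖u‖ = 1 ∧ Walk (fun n => q + direction u n ∈ X) 0 w := by
  obtain ⟨i, hi⟩ : ∃ i, q ∈ v i := by simpa [h.vertices] using hq
  obtain ⟨u, hu, hv, -⟩ := (h.tile i).exists_of_mem hi
  have hqu : q + direction u 0 ∈ X := h.subset i (by
    rw [hv, direction_zero]; exact ⟨1, (τ i).one_mem_corners, by simp⟩)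
  obtain ⟨n, w, hw, hW⟩ := exists_walk (N := fun n => q + direction u n ∈ X)
    (fun n hn => h.not_neighbour_succ hu hn)
    (fun n hn => by
      obtain ⟨i, -, -, hi⟩ := h.exists_tile_direction hq hu hn
      cases hτ : τ i <;> rw [hτ] at hi
      exacts [Or.inl hi, Or.inr hi])
    (fun n => by rw [direction_twelve]) hqu
  refine ⟨w, hw, direction u n, norm_direction hu n, ?_⟩
  have shift : ∀ (w : List TileType) (m : ℕ), Walk (fun n => q + direction u n ∈ X) (n + m) w →
      Walk (fun k => q + direction (direction u n) k ∈ X) m w := by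
    intro w
    induction w with
    | nil => intro m hm; simpa only [Walk, direction_add] using hm
    | cons t w ih =>
      intro m hm
      exact ⟨by simpa only [direction_add] using hm.1, ih _ (by simpa only [add_assoc] using hm.2)⟩
  exact shift w 0 hW

theorem tileCentre_eq (w : List TileType) (k : Fin w.length) (u : ℂ) :
    u * tileCentre w k =
      direction u ((w.take k).map TileType.units).sum * (w.get k).centre := by
  have hs : ((w.take k).map TileType.angle).sum =
      ((w.take k).map TileType.units).sum * (Real.pi / 6) := by
    generalize w.take k = l
    induction l with
    | nil => simp
    | cons t l ih => simp only [List.map_cons, List.sum_cons, ih, t.angle_eq]; push_cast; ring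
  rw [TileType.centre_eq_exp, direction, tileCentre, hs]
  push_cast
  rw [add_mul, Complex.exp_add]
  ring

theorem sum_take_succ (w : List TileType) {k : ℕ} (hk : k < w.length) :
    ((w.take (k + 1)).map TileType.units).sum =
      ((w.take k).map TileType.units).sum + w[k].units := by
  rw [List.take_add_one, List.getElem?_eq_getElem hk, List.map_append, List.sum_append]
  simp

/-- The tiles around a vertex, in cyclic order. -/
theorem exists_cycle (h : UnitTiling X τ v c) {q : ℂ} (hq : q ∈ X) :
    ∃ w ∈ faceWords, ∃ (u : ℂ) (j : Fin w.length → ι), ‖u‖ = 1 ∧ Function.Injective j ∧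
      range j = {i | q ∈ v i} ∧ (∀ k, τ (j k) = w.get k) ∧
      (∀ k, j k ≠ j (finRotate _ k) ∧
        ∃ r, r ≠ q ∧ v (j k) ∩ v (j (finRotate _ k)) = {q, r}) ∧
      ∀ k, c (j k) = q + u * tileCentre w k := by
  obtain ⟨w, hw, u, hu, hW⟩ := h.exists_word hq
  obtain ⟨h12, hlen⟩ := faceWords_units hw
  refine ⟨w, hw, u, ?_⟩
  set s : ℕ → ℕ := fun k => ((w.take k).map TileType.units).sum with hs
  have hu0 : u ≠ 0 := by rintro rfl; simp at hu
  have hN : ∀ k, q + direction u (s k) ∈ X := fun k => by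
    simpa only [Nat.zero_add] using hW.apply_sum k
  have hstep : ∀ k : Fin w.length, s (k + 1) = s k + (w.get k).units := fun k =>
    sum_take_succ w k.2
  have hend : s w.length = 12 := by simp only [hs, List.take_length, h12]
  have hunits : ∀ t : TileType, 2 ≤ t.units ∧ t.units ≤ 3 := fun t => by
    cases t <;> simp [TileType.units]
  have hmono : ∀ k l : ℕ, k < l → l ≤ w.length → s k < s l := by
    intro k l hkl
    induction l with
    | zero => omega
    | succ l ih =>
      intro hl
      have h1 := hstep ⟨l, hl⟩
      have h2 := (hunits (w.get ⟨l, hl⟩)).1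
      simp only at h1
      rcases (Nat.lt_succ_iff.1 hkl).eq_or_lt with rfl | h3
      · omega
      · have := ih h3 (by omega); omega
  choose i hv hc hi using fun k : Fin w.length => h.exists_tile_direction hq hu (hN k)
  have hτ : ∀ k, τ (i k) = w.get k := fun k =>
    h.type_eq hu (hi k) (by rw [← hstep]; exact hN _)
  -- After the last tile `finRotate` returns to index `0`, and the partial sum `12` is a full turn.
  have hcyc : ∀ k : Fin w.length,
      direction u (s (finRotate _ k)) = direction u (s (k + 1)) := by
    intro k
    obtain ⟨m, hm⟩ : ∃ m, w.length = m + 1 := ⟨w.length - 1, by omega⟩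
    by_cases hk : (k : ℕ) + 1 < w.length
    · congr 2
      have hne : (k : ℕ) < m := by omega
      have := congrArg Fin.val (finRotate_of_lt (n := m) (k := k) hne)
      have e : ∀ (n : ℕ) (hn : n = m + 1) (k : Fin n) (hk : (k : ℕ) < m),
          (finRotate n k : ℕ) = k + 1 := by
        rintro _ rfl k hk
        exact congrArg Fin.val (finRotate_of_lt hk)
      exact e _ hm k hne
    · have e : ∀ (n : ℕ) (hn : n = m + 1) (k : Fin n) (hk : (k : ℕ) = m),
          (finRotate n k : ℕ) = 0 := by
        rintro _ rfl k hk
        have : k = Fin.last m := Fin.ext hk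
        rw [this, finRotate_last]; rfl
      have hkm : (k : ℕ) = m := by omega
      rw [e _ hm k hkm, show (k : ℕ) + 1 = w.length by omega, hend]
      simpa [hs] using (direction_twelve u 0).symm
  have hinj : Function.Injective i := by
    intro k l hkl
    have h1 := hc k
    have h2 := hc l
    rw [hkl] at h1
    have h3 := mul_right_cancel₀ (b := (τ (i l)).centre) (by
      rw [TileType.centre_eq_exp]
      exact mul_ne_zero (by exact_mod_cast (TileType.radius_pos _).ne') (Complex.exp_ne_zero _))
      (add_left_cancel (h1.symm.trans h2))
    have h4 := mul_left_cancel₀ hu0 h3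
    -- Equal tiles have equal centres, so the partial sums agree modulo `12`. Both are less than
    -- `12` and the sums increase strictly.
    obtain ⟨n, hn⟩ := Complex.exp_eq_exp_iff_exists_int.1 h4
    have h5 : ((s k : ℝ) * (Real.pi / 6)) = s l * (Real.pi / 6) + n * (2 * Real.pi) := by
      have := congrArg Complex.im hn
      simpa using this
    have h6 : (s k : ℝ) = s l + 12 * n := by
      have hpi := Real.pi_pos
      have : (Real.pi / 6) * (s k : ℝ) = (Real.pi / 6) * (s l + 12 * n) := by linarith
      exact mul_left_cancel₀ (by positivity) this
    have h7 : (s k : ℤ) = s l + 12 * n := by exact_mod_cast h6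
    have h8 := hmono k _ k.2 le_rfl
    have h9 := hmono l _ l.2 le_rfl
    rw [hend] at h8 h9
    have h10 : s k = s l := by omega
    ext
    rcases lt_trichotomy (k : ℕ) l with hlt | heq | hlt
    · have := hmono _ _ hlt l.2.le; omega
    · exact heq
    · have := hmono _ _ hlt k.2.le; omega
  have hqv : ∀ k, q ∈ v (i k) := fun k => by
    rw [hv]; exact ⟨0, TileType.zero_mem_corners _, by simp⟩
  refine ⟨i, hu, hinj, ?_, hτ, ?_, ?_⟩
  · ext l
    constructor
    · rintro ⟨k, rfl⟩; exact hqv k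
    intro hl
    obtain ⟨x, hx, hvx, -⟩ := (h.tile l).exists_of_mem hl
    have hxX : q + x ∈ X := h.subset l (by
      rw [hvx]; exact ⟨1, TileType.one_mem_corners _, by simp⟩)
    have hpi := Real.pi_pos
    obtain ⟨α, hα0, hα1, hα⟩ : ∃ α : ℝ, 0 ≤ α ∧ α < 2 * Real.pi ∧
        x = u * Complex.exp (α * Complex.I) := by
      have hxu : ‖x / u‖ = 1 := by rw [norm_div, hx, hu, div_one]
      have he : x = u * Complex.exp ((x / u).arg * Complex.I) := by
        have := Complex.norm_mul_exp_arg_mul_I (x / u)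
        rw [hxu, Complex.ofReal_one, one_mul] at this
        rw [this]; field_simp
      rcases le_or_gt 0 (x / u).arg with h0 | h0
      · exact ⟨_, h0, by linarith [Complex.arg_le_pi (x / u)], he⟩
      · refine ⟨(x / u).arg + 2 * Real.pi, by linarith [Complex.neg_pi_lt_arg (x / u)],
          by linarith, ?_⟩
        push_cast
        rw [add_mul, Complex.exp_add, Complex.exp_two_pi_mul_I, mul_one]
        exact he
    obtain ⟨k, hk, hk1, hk2⟩ := exists_step (s := s) (x := α / (Real.pi / 6))
      (by simp [hs]; positivity) w.length (by
        rw [hend, div_lt_iff₀ (by positivity)]; push_cast; linarith)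
    rw [le_div_iff₀ (by positivity)] at hk1
    rw [div_lt_iff₀ (by positivity)] at hk2
    have hgap : (s (k + 1) : ℝ) ≤ s k + 3 := by
      have := hstep ⟨k, hk⟩
      have h2 := (hunits (w.get ⟨k, hk⟩)).2
      simp only at this
      exact_mod_cast (by omega : s (k + 1) ≤ s k + 3)
    -- Any tile at `q` has a first edge in a direction `α` between two consecutive directions of the
    -- walk. Separation puts `α` at least `π/3` away from each of them unless it coincides with one,
    -- but their gap is at most `π/2`. Hence `α` is the lower direction, and the tile is the one
    -- already listed there.
    have far : ∀ m, q + x ≠ q + direction u m → q + direction u m ∈ X →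
        Real.cos (α - m * (Real.pi / 6)) ≤ 1 / 2 := by
      intro m hne hm
      have h1 := one_le_pow₀ (n := 2) (h.separated _ hxX _ hm hne)
      have h2 := dist_exp_sq hu q α (m * (Real.pi / 6))
      rw [← hα] at h2
      have h3 : dist (q + x) (q + direction u m) ^ 2 = _ := h2
      linarith
    have hxk : x = direction u (s k) := by
      by_contra hne
      have h1 := far (s k) (by simpa using hne) (hN k)
      have h1' : Real.pi / 3 ≤ α - s k * (Real.pi / 6) := by
        by_contra! hlt
        linarith [lt_pi_div_three_of_cos (by linarith) hlt]
      have h2 := far (s (k + 1)) (by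
        intro he
        have he' := add_left_cancel he
        have h3 := dist_exp_sq hu q α (s (k + 1) * (Real.pi / 6))
        rw [← hα] at h3
        have h4 : dist (q + x) (q + direction u (s (k + 1))) ^ 2 = _ := h3
        rw [← he', dist_self, ← Real.cos_neg] at h4
        have h5 := lt_pi_div_three_of_cos (β := -(α - s (k + 1) * (Real.pi / 6)))
          (by linarith) (by nlinarith)
        have h6 := Real.cos_lt_cos_of_nonneg_of_le_pi le_rfl (by nlinarith)
          (show 0 < -(α - s (k + 1) * (Real.pi / 6)) by linarith)
        rw [Real.cos_zero] at h6
        linarith) (hN _)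
      have h2' : Real.pi / 3 ≤ s (k + 1) * (Real.pi / 6) - α := by
        by_contra! hlt
        rw [← Real.cos_neg, neg_sub] at h2
        linarith [lt_pi_div_three_of_cos (by linarith) hlt]
      nlinarith
    refine ⟨⟨k, hk⟩, h.injective ?_⟩
    rw [hv ⟨k, hk⟩, hvx, hxk]
    have : τ l = τ (i ⟨k, hk⟩) := by
      refine h.type_eq (q := q) hu (n := s k) ?_ (hi ⟨k, hk⟩)
      rw [direction_units, ← hxk]
      exact h.subset l (by rw [hvx]; exact ⟨_, TileType.dir_mem_corners _, rfl⟩)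
    rw [this]
  · intro k
    have hne : i k ≠ i (finRotate _ k) := by
      refine hinj.ne fun he => ?_
      have h1 := hcyc k
      rw [← he] at h1
      have h2 := hN k
      have h3 : direction u (s k) = direction u (s k) * (w.get k).dir := by
        rw [← direction_units, ← hstep]; exact h1
      have h4 : (w.get k).dir = 1 := by
        have hd : direction u (s k) ≠ 0 := by
          intro h0; have := norm_direction hu (s k); rw [h0] at this; simp at this
        exact mul_left_cancel₀ hd (by rw [← h3, mul_one])
      have := (w.get k).dir_im_pos
      rw [h4] at this
      simp at this
    refine ⟨hne, q + direction u (s (k + 1)), ?_, h.inter_eq_pair hne ⟨hqv _, hqv _⟩ ⟨?_, ?_⟩ ?_⟩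
    · intro he
      have := norm_direction hu (s (k + 1))
      rw [show direction u (s (k + 1)) = 0 by simpa using he] at this
      simp at this
    · rw [hv, hτ, hstep, direction_units]
      exact ⟨_, TileType.dir_mem_corners _, rfl⟩
    · rw [hv, hcyc]
      exact ⟨_, TileType.one_mem_corners _, by simp⟩
    · intro he
      have := norm_direction hu (s (k + 1))
      rw [show direction u (s (k + 1)) = 0 by simpa using he.symm] at this
      simp at this
  · intro k
    rw [tileCentre_eq, hc, hτ]

end UnitTiling

/-! ### Geodesic convexity of half-spaces -/

namespace H3

theorem dist_eq_of_cosh_eq {x y x' y' : H3}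
    (h : Real.cosh (dist x y) = Real.cosh (dist x' y')) : dist x y = dist x' y' := by
  have h1 := Real.cosh_le_cosh.1 h.le
  have h2 := Real.cosh_le_cosh.1 h.ge
  rw [abs_of_nonneg dist_nonneg, abs_of_nonneg dist_nonneg] at h1 h2
  exact le_antisymm h1 h2

/-- The Lorentzian expression of the hyperbolic distance. -/
theorem two_mul_cosh_dist (x y : H3) : 2 * Real.cosh (dist x y) =
    (Complex.normSq x.z + x.t ^ 2) / x.t * (1 / y.t) +
      (Complex.normSq y.z + y.t ^ 2) / y.t * (1 / x.t) -
      2 * (x.z.re / x.t * (y.z.re / y.t) + x.z.im / x.t * (y.z.im / y.t)) := by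
  have hx := x.t_pos
  have hy := y.t_pos
  rw [cosh_dist, dist_sq_complex, Complex.normSq_apply, Complex.normSq_apply]
  field_simp
  ring

/-- The form `P S - X² - Y²` has signature `(1, 3)`, and a null vector orthogonal to a timelike
vector vanishes. -/
theorem eq_zero_of_null {P X Y S p x y s : ℝ} (h1 : P * S = X ^ 2 + Y ^ 2)
    (h2 : P * s + p * S = 2 * (X * x + Y * y)) (h3 : p * s - x ^ 2 - y ^ 2 = 1) (hs : s ≠ 0) :
    P = 0 ∧ X = 0 ∧ Y = 0 ∧ S = 0 := by
  have h4 : (s * X - x * S) ^ 2 + (s * Y - y * S) ^ 2 + S ^ 2 = 0 := by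
    linear_combination -s ^ 2 * h1 + s * S * h2 - S ^ 2 * h3
  have hS : S = 0 := by
    have : S ^ 2 ≤ 0 := by nlinarith [sq_nonneg (s * X - x * S), sq_nonneg (s * Y - y * S)]
    nlinarith
  subst hS
  have hXY : X ^ 2 + Y ^ 2 = 0 := by linarith
  have hX : X = 0 := by nlinarith [sq_nonneg X, sq_nonneg Y]
  have hY : Y = 0 := by nlinarith [sq_nonneg X, sq_nonneg Y]
  subst hX hY
  simp at h2
  exact ⟨h2.resolve_right hs, rfl, rfl, rfl⟩

/-- Along a geodesic, the normalized defining functions of half-spaces are combinations of their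
values at the ends. -/
theorem eval_between (h : HalfSpace) {x w y : H3} (hd : dist x w + dist w y = dist x y) :
    Real.sinh (dist x y) * (h.eval w / w.t) =
      Real.sinh (dist w y) * (h.eval x / x.t) + Real.sinh (dist x w) * (h.eval y / y.t) := by
  have hx := x.t_pos
  have hw := w.t_pos
  have hy := y.t_pos
  have Hxx := two_mul_cosh_dist x x
  have Hww := two_mul_cosh_dist w w
  have Hyy := two_mul_cosh_dist y y
  have Hxw := two_mul_cosh_dist x w
  have Hwy := two_mul_cosh_dist w y
  have Hxy := two_mul_cosh_dist x y
  rw [dist_self, Real.cosh_zero] at Hxx Hww Hyy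
  rw [← hd, Real.cosh_add] at Hxy
  rw [← hd, Real.sinh_add]
  have Ha := Real.cosh_sq (dist x w)
  have Hb := Real.cosh_sq (dist w y)
  have key : ∀ u : H3, h.eval u / u.t = h.A * ((Complex.normSq u.z + u.t ^ 2) / u.t) +
      2 * (h.b.re * (u.z.re / u.t) + h.b.im * (u.z.im / u.t)) + h.C * (1 / u.t) := by
    intro u
    have := u.t_pos
    simp only [HalfSpace.eval, Complex.mul_re, Complex.conj_re, Complex.conj_im]
    field_simp
    ring
  rw [key, key, key]
  have hs : 1 / x.t ≠ 0 := by positivity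
  generalize Real.sinh (dist x w) = sa at *
  generalize Real.sinh (dist w y) = sb at *
  generalize Real.cosh (dist x w) = ca at *
  generalize Real.cosh (dist w y) = cb at *
  generalize (Complex.normSq x.z + x.t ^ 2) / x.t = Px at *
  generalize (Complex.normSq y.z + y.t ^ 2) / y.t = Py at *
  generalize (Complex.normSq w.z + w.t ^ 2) / w.t = Pw at *
  generalize 1 / x.t = Sx at *
  generalize 1 / y.t = Sy at *
  generalize 1 / w.t = Sw at *
  generalize x.z.re / x.t = Xx at *
  generalize y.z.re / y.t = Xy at *
  generalize w.z.re / w.t = Xw at *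
  generalize x.z.im / x.t = Yx at *
  generalize y.z.im / y.t = Yy at *
  generalize w.z.im / w.t = Yw at *
  -- For points of the hyperboloid at distances `a = d(x,w)`, `b = d(w,y)` with `a + b = d(x,y)`,
  -- the vector `sinh (a + b) w - sinh b x - sinh a y` is null and orthogonal to `x`, so it is zero.
  -- The normalized defining functions are linear in these coordinates.
  obtain ⟨e1, e2, e3, e4⟩ := eq_zero_of_null
    (P := (sa * cb + ca * sb) * Pw - sb * Px - sa * Py)
    (X := (sa * cb + ca * sb) * Xw - sb * Xx - sa * Xy)
    (Y := (sa * cb + ca * sb) * Yw - sb * Yx - sa * Yy)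
    (S := (sa * cb + ca * sb) * Sw - sb * Sx - sa * Sy)
    (p := Px) (x := Xx) (y := Yx) (s := Sx) (by
      linear_combination (-(sa * cb + ca * sb) ^ 2 / 2) * Hww - sb ^ 2 / 2 * Hxx -
        sa ^ 2 / 2 * Hyy + (sa * cb + ca * sb) * sb * Hxw + (sa * cb + ca * sb) * sa * Hwy -
        sa * sb * Hxy - sa ^ 2 * Hb - sb ^ 2 * Ha) (by
      linear_combination -(sa * cb + ca * sb) * Hxw + sb * Hxx + sa * Hxy + 2 * sb * Ha) (by
      linear_combination -Hxx / 2) hs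
  linear_combination h.A * e1 + 2 * h.b.re * e2 + 2 * h.b.im * e3 + h.C * e4

/-- In the hyperboloid model the midpoint is `(x + y) / (2 cosh (d/2))`; the two hypotheses express
this in coordinates of the upper half-space. -/
theorem dist_half_aux (x y : H3) (w : H3)
    (hz : w.z = (y.t * x.z + x.t * y.z) / (x.t + y.t : ℝ))
    (ht : w.t = 2 * Real.cosh (dist x y / 2) * (x.t * y.t) / (x.t + y.t)) :
    dist x w = dist x y / 2 := by
  have hx := x.t_pos
  have hy := y.t_pos
  set κ := Real.cosh (dist x y / 2) with hκ
  have hκ0 : 0 < κ := Real.cosh_pos _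
  have hk : 4 * κ ^ 2 * (x.t * y.t) = dist x.z y.z ^ 2 + (x.t + y.t) ^ 2 := by
    have h1 : Real.cosh (dist x y) = 2 * κ ^ 2 - 1 := by
      have h2 := Real.cosh_two_mul (dist x y / 2)
      have h3 := Real.cosh_sq (dist x y / 2)
      rw [mul_div_cancel₀ _ two_ne_zero] at h2
      rw [h2, hκ]; linarith
    rw [cosh_dist] at h1
    field_simp at h1
    linear_combination -h1
  have hzz : dist x.z w.z ^ 2 = x.t ^ 2 * dist x.z y.z ^ 2 / (x.t + y.t) ^ 2 := by
    have : x.z - w.z = ((x.t / (x.t + y.t) : ℝ) : ℂ) * (x.z - y.z) := by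
      have : (x.t : ℂ) + y.t ≠ 0 := by
        exact_mod_cast (show x.t + y.t ≠ 0 by positivity)
      rw [hz]; push_cast; field_simp; ring
    rw [dist_eq_norm, this, norm_mul, ← dist_eq_norm, Complex.norm_real,
      Real.norm_of_nonneg (by positivity), mul_pow, div_pow]
    ring
  have hc : Real.cosh (dist x w) = Real.cosh (dist x y / 2) := by
    rw [cosh_dist, hzz, ht, ← hκ]
    field_simp
    linear_combination (-κ * (x.t + y.t) * x.t) * hk * 0 + (-1 : ℝ) * hk
  have h1 := Real.cosh_le_cosh.1 hc.le
  have h2 := Real.cosh_le_cosh.1 hc.ge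
  rw [abs_of_nonneg dist_nonneg, abs_of_nonneg (by positivity)] at h1 h2
  exact le_antisymm h1 h2

theorem exists_midpoint (x y : H3) : ∃ w : H3, dist x w = dist x y / 2 ∧ dist w y = dist x y / 2 := by
  have hx := x.t_pos
  have hy := y.t_pos
  have hκ := Real.cosh_pos (dist x y / 2)
  let w : H3 := ⟨(y.t * x.z + x.t * y.z) / (x.t + y.t : ℝ),
    2 * Real.cosh (dist x y / 2) * (x.t * y.t) / (x.t + y.t), by positivity⟩
  refine ⟨w, dist_half_aux x y w rfl rfl, ?_⟩
  rw [dist_comm w, dist_comm x]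
  refine dist_half_aux y x w ?_ ?_
  · simp only [w]; push_cast; rw [add_comm (y.t : ℂ), add_comm ((x.t : ℂ) * y.z)]
  · simp only [w]; rw [dist_comm x, mul_comm y.t, add_comm y.t]

theorem continuous_vertical (z : ℂ) {t : ℝ} (ht : 0 < t) :
    Continuous fun s : ℝ => (⟨z, t * Real.exp s, by positivity⟩ : H3) := by
  refine continuous_induced_rng.2 ?_
  refine (WithLp.prod_continuous_toLp 2 ℂ ℝ).comp ?_
  fun_prop

/-- Interior points of a set can be moved down a little. -/
theorem exists_lower_mem {S : Set H3} {x : H3} (hx : x ∈ interior S) :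
    ∃ y ∈ S, y.z = x.z ∧ y.t < x.t := by
  have hc := continuous_vertical x.z x.t_pos
  have hopen := ((isOpen_interior (s := S)).preimage hc).mem_nhds (x := 0)
    (by simpa using hx)
  obtain ⟨ε, hε, hball⟩ := Metric.mem_nhds_iff.1 hopen
  have hm : (-(ε / 2)) ∈ ball (0 : ℝ) ε := by
    rw [mem_ball, dist_zero_right, norm_neg, Real.norm_of_nonneg (by positivity)]; linarith
  refine ⟨_, interior_subset (hball hm), rfl, ?_⟩
  have h1 : Real.exp (-(ε / 2)) < 1 := by
    rw [← Real.exp_zero]; exact Real.exp_lt_exp.2 (by linarith)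
  exact mul_lt_of_lt_one_right x.t_pos h1

end H3

namespace HalfSpace

theorem continuous_eval (h : HalfSpace) : Continuous h.eval := by
  unfold eval
  have := H3.continuous_z
  have := H3.continuous_t
  have : Continuous Complex.normSq := Complex.continuous_normSq
  fun_prop

/-- By `eval_between` the normalized value at a point of the segment is a combination of the end
values with nonnegative coefficients. -/
theorem gConvex_carrier (h : HalfSpace) : GConvex h.carrier := by
  intro x hx y hy w hd
  have hxt := x.t_pos
  have hyt := y.t_pos
  have hwt := w.t_pos
  by_cases h0 : dist x y = 0
  · have : dist x w = 0 := by
      have := dist_nonneg (x := x) (y := w)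
      have := dist_nonneg (x := w) (y := y)
      linarith
    rwa [← dist_eq_zero.1 this]
  have hpos : 0 < Real.sinh (dist x y) :=
    Real.sinh_pos_iff.2 (lt_of_le_of_ne dist_nonneg (Ne.symm h0))
  have e := H3.eval_between h hd
  simp only [carrier, mem_ofPred_eq] at *
  have s1 := Real.sinh_nonneg_iff.2 (dist_nonneg (x := w) (y := y))
  have s2 := Real.sinh_nonneg_iff.2 (dist_nonneg (x := x) (y := w))
  have : 0 ≤ Real.sinh (dist x y) * (h.eval w / w.t) := by rw [e]; positivity
  have := nonneg_of_mul_nonneg_right this hpos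
  by_contra! hlt
  exact absurd this (not_le.2 (div_neg_of_neg_of_pos hlt hwt))

theorem gConvex_plane (h : HalfSpace) : GConvex h.plane := by
  intro x hx y hy w hd
  have hwt := w.t_pos
  by_cases h0 : dist x y = 0
  · have : dist x w = 0 := by
      have := dist_nonneg (x := x) (y := w)
      have := dist_nonneg (x := w) (y := y)
      linarith
    rwa [← dist_eq_zero.1 this]
  have hpos : 0 < Real.sinh (dist x y) :=
    Real.sinh_pos_iff.2 (lt_of_le_of_ne dist_nonneg (Ne.symm h0))
  have e := H3.eval_between h hd
  simp only [plane, mem_ofPred_eq] at *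
  rw [hx, hy] at e
  simp [hpos.ne', hwt.ne'] at e
  exact e

/-- A half-space whose bounding plane contains an inner point of a geodesic segment in the
half-space contains the end points. -/
theorem eval_eq_zero_of_midpoint (h : HalfSpace) {x w y : H3} (hx : x ∈ h.carrier)
    (hy : y ∈ h.carrier) (h1 : dist x w = dist x y / 2) (h2 : dist w y = dist x y / 2)
    (hw : h.eval w = 0) : h.eval x = 0 ∧ h.eval y = 0 := by
  have hxt := x.t_pos
  have hyt := y.t_pos
  by_cases h0 : dist x y = 0
  · rw [h0, zero_div, dist_eq_zero] at h1 h2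
    subst h1
    subst h2
    exact ⟨hw, hw⟩
  have hd : 0 < dist x y := lt_of_le_of_ne dist_nonneg (Ne.symm h0)
  have e := H3.eval_between h (x := x) (w := w) (y := y) (by linarith)
  have hs : 0 < Real.sinh (dist x y / 2) := Real.sinh_pos_iff.2 (by linarith)
  simp only [carrier, mem_ofPred_eq] at hx hy
  rw [hw, h1, h2, zero_div, mul_zero] at e
  have a1 : 0 ≤ Real.sinh (dist x y / 2) * (h.eval x / x.t) := by positivity
  have a2 : 0 ≤ Real.sinh (dist x y / 2) * (h.eval y / y.t) := by positivity
  have b1 : Real.sinh (dist x y / 2) * (h.eval x / x.t) = 0 := by linarith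
  have b2 : Real.sinh (dist x y / 2) * (h.eval y / y.t) = 0 := by linarith
  simp [hs.ne', hxt.ne'] at b1
  simp [hs.ne', hyt.ne'] at b2
  exact ⟨b1, b2⟩

end HalfSpace

theorem GConvex.inter {S S' : Set H3} (h : GConvex S) (h' : GConvex S') : GConvex (S ∩ S') :=
  fun x hx y hy w hd => ⟨h x hx.1 y hy.1 w hd, h' x hx.2 y hy.2 w hd⟩

/-! ### Horoballs -/

theorem mem_horoball_infty {r : ℝ} {x : H3} : x ∈ horoball inftyPt r ↔ r ≤ x.t := Iff.rfl

theorem mem_horoball_finPt {q : ℂ} {r : ℝ} {x : H3} :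
    x ∈ horoball (finPt q) r ↔ dist x.z q ^ 2 + x.t ^ 2 ≤ 2 * r * x.t := by
  change dist x.z q ^ 2 + (x.t - r) ^ 2 ≤ r ^ 2 ↔ _
  constructor <;> intro h <;> nlinarith

theorem interior_horoball_infty (r : ℝ) : interior (horoball inftyPt r) = {x : H3 | r < x.t} := by
  apply Subset.antisymm
  · intro x hx
    obtain ⟨y, hy, -, hlt⟩ := H3.exists_lower_mem hx
    exact (mem_horoball_infty.1 hy).trans_lt hlt
  · exact interior_maximal (fun x (hx : r < x.t) => hx.le) (isOpen_lt continuous_const H3.continuous_t)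

theorem frontier_horoball_infty (r : ℝ) : frontier (horoball inftyPt r) = {x : H3 | x.t = r} := by
  have hc : IsClosed (horoball inftyPt r) := isClosed_le continuous_const H3.continuous_t
  rw [hc.frontier_eq, interior_horoball_infty]
  ext x
  simp only [mem_sdiff, mem_horoball_infty, mem_ofPred_eq, not_lt]
  exact ⟨fun h => le_antisymm h.2 h.1, fun h => ⟨h.ge, h.le⟩⟩

theorem mem_interior_horoball_finPt {q : ℂ} {r : ℝ} {x : H3}
    (h : dist x.z q ^ 2 + x.t ^ 2 < 2 * r * x.t) : x ∈ interior (horoball (finPt q) r) := by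
  have ho : IsOpen {x : H3 | dist x.z q ^ 2 + x.t ^ 2 < 2 * r * x.t} :=
    isOpen_lt (by have := H3.continuous_z; have := H3.continuous_t; fun_prop)
      (by have := H3.continuous_t; fun_prop)
  exact interior_maximal (fun x hx => mem_horoball_finPt.2 (le_of_lt hx)) ho h

theorem le_of_disjoint_infty {q : ℂ} {r s : ℝ} (hr : 0 < r)
    (h : Disjoint (interior (horoball inftyPt s)) (interior (horoball (finPt q) r))) :
    2 * r ≤ s := by
  by_contra! hlt
  -- The common point is taken above `q`, at a height between `s` and `2 * r`. As `s` may be any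
  -- real number, the maximum with `r` keeps that height positive.
  have hs : 0 < max s r := lt_max_of_lt_right hr
  have hm : max s r < 2 * r := max_lt hlt (by linarith)
  refine Set.not_disjoint_iff.2 ⟨⟨q, (max s r + 2 * r) / 2, by positivity⟩, ?_, ?_⟩ h
  · rw [interior_horoball_infty]
    have := le_max_left s r
    simp only [mem_ofPred_eq]; linarith
  · apply mem_interior_horoball_finPt
    simp only [dist_self]
    nlinarith

theorem le_of_disjoint {q q' : ℂ} {r r' : ℝ} (hr : 0 < r) (hr' : 0 < r')
    (h : Disjoint (interior (horoball (finPt q) r)) (interior (horoball (finPt q') r'))) :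
    4 * r * r' ≤ dist q q' ^ 2 := by
  by_contra! hlt
  -- The point dividing the segment between the Euclidean centres of the balls in the ratio `r :
  -- r'`. It is the point of tangency when `4 r r' = dist q q' ^ 2`, and it is interior to both
  -- balls when they overlap.
  let x : H3 := ⟨((r' / (r + r') : ℝ) : ℂ) * q + ((r / (r + r') : ℝ) : ℂ) * q',
    2 * r * r' / (r + r'), by positivity⟩
  have hsum : ((r : ℂ) + r') ≠ 0 := by exact_mod_cast (show r + r' ≠ 0 by positivity)
  have h1 : dist x.z q = r / (r + r') * dist q q' := by
    rw [dist_eq_norm, show x.z - q = ((r / (r + r') : ℝ) : ℂ) * (q' - q) by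
      simp only [x]; push_cast; field_simp; ring, norm_mul, Complex.norm_real,
      Real.norm_of_nonneg (by positivity), dist_comm, dist_eq_norm]
  have h2 : dist x.z q' = r' / (r + r') * dist q q' := by
    rw [dist_eq_norm, show x.z - q' = ((r' / (r + r') : ℝ) : ℂ) * (q - q') by
      simp only [x]; push_cast; field_simp; ring, norm_mul, Complex.norm_real,
      Real.norm_of_nonneg (by positivity), dist_eq_norm]
  refine Set.not_disjoint_iff.2 ⟨x, ?_, ?_⟩ h <;> apply mem_interior_horoball_finPt
  · rw [h1, mul_pow]
    calc _ < (r / (r + r')) ^ 2 * (4 * r * r') + x.t ^ 2 := by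
          gcongr
      _ = _ := by simp only [x]; field_simp; ring
  · rw [h2, mul_pow]
    calc _ < (r' / (r + r')) ^ 2 * (4 * r * r') + x.t ^ 2 := by
          gcongr
      _ = _ := by simp only [x]; field_simp; ring

theorem disjoint_of_le_infty {q : ℂ} {r s : ℝ} (h : 2 * r ≤ s) :
    Disjoint (interior (horoball inftyPt s)) (interior (horoball (finPt q) r)) := by
  refine Set.disjoint_left.2 fun x hx hx' => ?_
  rw [interior_horoball_infty] at hx
  have hx'' := mem_horoball_finPt.1 (interior_subset hx')
  have := x.t_pos
  simp only [mem_ofPred_eq] at hx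
  nlinarith [sq_nonneg (dist x.z q)]

/-- Two horoballs with the same centre overlap. -/
theorem not_disjoint_same_centre {p : Ideal3} {B B' : Set H3} (h : IsHoroballAt p B)
    (h' : IsHoroballAt p B') : ¬ Disjoint (interior B) (interior B') := by
  obtain ⟨r, hr, rfl⟩ := h
  obtain ⟨r', hr', rfl⟩ := h'
  intro hd
  induction p using OnePoint.rec with
  | infty =>
    have h0 : 0 < max r r' + 1 := by positivity
    refine Set.not_disjoint_iff.2 ⟨⟨0, max r r' + 1, h0⟩, ?_, ?_⟩ hd <;>
      erw [interior_horoball_infty]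
    · have := le_max_left r r'; simp only [mem_ofPred_eq]; linarith
    · have := le_max_right r r'; simp only [mem_ofPred_eq]; linarith
  | coe q =>
    have := le_of_disjoint hr hr' hd
    rw [dist_self] at this
    nlinarith [mul_pos hr hr']

/-! ### Extensions of Möbius transformations -/

namespace H3

theorem isometry_of_formula {f : H3 → H3}
    (h : ∀ x y : H3, (dist (f x).z (f y).z ^ 2 + ((f x).t - (f y).t) ^ 2) / (2 * (f x).t * (f y).t) =
      (dist x.z y.z ^ 2 + (x.t - y.t) ^ 2) / (2 * x.t * y.t)) : Isometry f :=
  Isometry.of_dist_eq fun x y => dist_eq_of_cosh_eq (by rw [cosh_dist, cosh_dist, h])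

/-- The similarity `(z, t) ↦ (a z + b, |a| t)`. -/
def affineMap (a b : ℂ) (ha : a ≠ 0) (x : H3) : H3 :=
  ⟨a * x.z + b, ‖a‖ * x.t, mul_pos (norm_pos_iff.2 ha) x.t_pos⟩

/-- The similarity `(z, t) ↦ (a z + b, |a| t)` as an isometry. -/
def affineIso (a b : ℂ) (ha : a ≠ 0) : H3 ≃ᵢ H3 where
  toFun := affineMap a b ha
  invFun := affineMap a⁻¹ (-(a⁻¹ * b)) (inv_ne_zero ha)
  left_inv x := by
    have := norm_pos_iff.2 ha
    ext1
    · simp only [affineMap]; field_simp; ring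
    · simp only [affineMap, norm_inv]; field_simp
  right_inv x := by
    have := norm_pos_iff.2 ha
    ext1
    · simp only [affineMap]; field_simp; ring
    · simp only [affineMap, norm_inv]; field_simp
  isometry_toFun := by
    refine isometry_of_formula fun x y => ?_
    have := norm_pos_iff.2 ha
    have hx := x.t_pos
    have hy := y.t_pos
    simp only [affineMap]
    rw [dist_add_right, dist_eq_norm, ← mul_sub, norm_mul, ← dist_eq_norm]
    field_simp

theorem normSq_add_pos (x : H3) : 0 < Complex.normSq x.z + x.t ^ 2 := by
  have := x.t_pos
  have := Complex.normSq_nonneg x.z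
  positivity

/-- The extension `(z, t) ↦ (conj z, t) / (|z|² + t²)` of `z ↦ 1 / z`. -/
def invMap (x : H3) : H3 :=
  ⟨starRingEnd ℂ x.z / ((Complex.normSq x.z + x.t ^ 2 : ℝ) : ℂ), x.t / (Complex.normSq x.z + x.t ^ 2),
    div_pos x.t_pos x.normSq_add_pos⟩

theorem invMap_z_re (x : H3) : (invMap x).z.re = x.z.re / (Complex.normSq x.z + x.t ^ 2) := by
  simp only [invMap, Complex.div_ofReal_re, Complex.conj_re]

theorem invMap_z_im (x : H3) : (invMap x).z.im = -x.z.im / (Complex.normSq x.z + x.t ^ 2) := by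
  simp only [invMap, Complex.div_ofReal_im, Complex.conj_im]

theorem normSq_invMap (x : H3) : Complex.normSq (invMap x).z + (invMap x).t ^ 2 =
    1 / (Complex.normSq x.z + x.t ^ 2) := by
  have := x.normSq_add_pos
  rw [Complex.normSq_apply, invMap_z_re, invMap_z_im]
  simp only [invMap]
  field_simp
  rw [Complex.normSq_apply]
  ring

theorem invMap_invMap (x : H3) : invMap (invMap x) = x := by
  have := x.normSq_add_pos
  ext1
  · apply Complex.ext
    · rw [invMap_z_re, invMap_z_re, normSq_invMap]; field_simp
    · rw [invMap_z_im, invMap_z_im, normSq_invMap]; field_simp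
  · change (invMap x).t / (Complex.normSq (invMap x).z + (invMap x).t ^ 2) = _
    rw [normSq_invMap]
    simp only [invMap]
    field_simp

/-- The extension of `z ↦ 1 / z` as an isometry. -/
def invIso : H3 ≃ᵢ H3 where
  toFun := invMap
  invFun := invMap
  left_inv := invMap_invMap
  right_inv := invMap_invMap
  isometry_toFun := by
    refine isometry_of_formula fun x y => ?_
    have hx := x.t_pos
    have hy := y.t_pos
    have hx' := x.normSq_add_pos
    have hy' := y.normSq_add_pos
    rw [dist_sq_complex, dist_sq_complex, invMap_z_re, invMap_z_re, invMap_z_im, invMap_z_im]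
    simp only [invMap]
    have ex : Complex.normSq x.z + x.t ^ 2 = x.z.re ^ 2 + x.z.im ^ 2 + x.t ^ 2 := by
      rw [Complex.normSq_apply]; ring
    have ey : Complex.normSq y.z + y.t ^ 2 = y.z.re ^ 2 + y.z.im ^ 2 + y.t ^ 2 := by
      rw [Complex.normSq_apply]; ring
    rw [ex] at hx' ⊢
    rw [ey] at hy' ⊢
    field_simp
    ring

end H3

/-- The Möbius transformation `z ↦ a z + b`. -/
def affineGL (a b : ℂ) (ha : a ≠ 0) : GL (Fin 2) ℂ :=
  Matrix.GeneralLinearGroup.mkOfDetNeZero !![a, b; 0, 1] (by simp [Matrix.det_fin_two, ha])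

/-- The Möbius transformation `z ↦ 1 / z`. -/
def invGL : GL (Fin 2) ℂ :=
  Matrix.GeneralLinearGroup.mkOfDetNeZero !![0, 1; 1, 0] (by simp [Matrix.det_fin_two])

@[simp] theorem affineGL_smul_infty (a b : ℂ) (ha : a ≠ 0) :
    affineGL a b ha • inftyPt = inftyPt := by
  rw [OnePoint.smul_infty_eq_ite]
  simp [affineGL, Matrix.GeneralLinearGroup.mkOfDetNeZero]

@[simp] theorem affineGL_smul_coe (a b : ℂ) (ha : a ≠ 0) (q : ℂ) :
    affineGL a b ha • finPt q = finPt (a * q + b) := by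
  rw [OnePoint.smul_some_eq_ite]
  simp [affineGL, Matrix.GeneralLinearGroup.mkOfDetNeZero]

@[simp] theorem invGL_smul_infty : invGL • inftyPt = finPt 0 := by
  rw [OnePoint.smul_infty_eq_ite]
  simp [invGL, Matrix.GeneralLinearGroup.mkOfDetNeZero]

@[simp] theorem invGL_smul_zero : invGL • finPt 0 = inftyPt := by
  rw [OnePoint.smul_some_eq_ite]
  simp [invGL, Matrix.GeneralLinearGroup.mkOfDetNeZero]

theorem invGL_smul_coe {q : ℂ} (hq : q ≠ 0) : invGL • finPt q = finPt q⁻¹ := by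
  rw [OnePoint.smul_some_eq_ite]
  simp [invGL, Matrix.GeneralLinearGroup.mkOfDetNeZero, hq]

/-- The isometry `φ` pulls back half-spaces and maps horoballs as an extension of the Möbius
transformation `g` does. -/
structure ExtendsMap (g : GL (Fin 2) ℂ) (φ : H3 ≃ᵢ H3) : Prop where
  halfSpace : ∀ h' : HalfSpace, ∃ h : HalfSpace, (∀ x, x ∈ h.carrier ↔ φ x ∈ h'.carrier) ∧
    ∀ p, p ∈ h.idealCarrier ↔ g • p ∈ h'.idealCarrier
  horoball : ∀ p B, IsHoroballAt p B → IsHoroballAt (g • p) (φ '' B)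

/-- `φ` is the extension of `g` to hyperbolic space. -/
def IsExtension (g : GL (Fin 2) ℂ) (φ : H3 ≃ᵢ H3) : Prop :=
  ExtendsMap g φ ∧ ExtendsMap g⁻¹ φ.symm

theorem ExtendsMap.mul {g g' : GL (Fin 2) ℂ} {φ φ' : H3 ≃ᵢ H3} (h : ExtendsMap g φ)
    (h' : ExtendsMap g' φ') : ExtendsMap (g * g') (φ'.trans φ) where
  halfSpace k := by
    obtain ⟨l, hl, hl'⟩ := h.halfSpace k
    obtain ⟨m, hm, hm'⟩ := h'.halfSpace l
    exact ⟨m, fun x => (hm x).trans (hl _), fun p => by rw [hm', hl', mul_smul]⟩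
  horoball p B hB := by
    rw [mul_smul]
    have := h.horoball _ _ (h'.horoball p B hB)
    rwa [image_image] at this

theorem IsExtension.mul {g g' : GL (Fin 2) ℂ} {φ φ' : H3 ≃ᵢ H3} (h : IsExtension g φ)
    (h' : IsExtension g' φ') : IsExtension (g * g') (φ'.trans φ) :=
  ⟨h.1.mul h'.1, by rw [mul_inv_rev]; exact h'.2.mul h.2⟩

theorem IsExtension.inv {g : GL (Fin 2) ℂ} {φ : H3 ≃ᵢ H3} (h : IsExtension g φ) :
    IsExtension g⁻¹ φ.symm := ⟨h.2, by rw [inv_inv]; exact h.1⟩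

theorem IsExtension.image_idealHull {g : GL (Fin 2) ℂ} {φ : H3 ≃ᵢ H3} (h : IsExtension g φ)
    (V : Set Ideal3) : φ '' idealHull V = idealHull ((fun p : Ideal3 => g • p) '' V) := by
  apply Subset.antisymm
  · rintro _ ⟨x, hx, rfl⟩ k hk
    obtain ⟨l, hl, hl'⟩ := h.1.halfSpace k
    exact (hl x).1 (hx l fun p hp => (hl' p).2 (hk (mem_image_of_mem _ hp)))
  · intro y hy
    refine ⟨φ.symm y, fun k hk => ?_, φ.apply_symm_apply y⟩
    obtain ⟨l, hl, hl'⟩ := h.2.halfSpace k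
    refine (hl y).1 (hy l ?_)
    rintro _ ⟨p, hp, rfl⟩
    refine (hl' _).2 ?_
    simpa using hk hp

theorem image_eq_of_mem_iff {φ : H3 ≃ᵢ H3} {S S' : Set H3} (h : ∀ x, x ∈ S ↔ φ x ∈ S') :
    φ '' S = S' := by
  ext y
  constructor
  · rintro ⟨x, hx, rfl⟩; exact (h x).1 hx
  · intro hy; exact ⟨φ.symm y, (h _).2 (by simpa using hy), by simp⟩

theorem affineIso_image_horoball_infty (a b : ℂ) (ha : a ≠ 0) (r : ℝ) :
    H3.affineIso a b ha '' horoball inftyPt r = horoball inftyPt (‖a‖ * r) := by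
  have := norm_pos_iff.2 ha
  refine image_eq_of_mem_iff fun x => ?_
  rw [mem_horoball_infty, mem_horoball_infty]
  exact (mul_le_mul_iff_right₀ this).symm

theorem affineIso_image_horoball_coe (a b : ℂ) (ha : a ≠ 0) (q : ℂ) (r : ℝ) :
    H3.affineIso a b ha '' horoball (finPt q) r = horoball (finPt (a * q + b)) (‖a‖ * r) := by
  have := norm_pos_iff.2 ha
  refine image_eq_of_mem_iff fun x => ?_
  rw [mem_horoball_finPt, mem_horoball_finPt]
  change _ ↔ dist (a * x.z + b) (a * q + b) ^ 2 + (‖a‖ * x.t) ^ 2 ≤ 2 * (‖a‖ * r) * (‖a‖ * x.t)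
  rw [dist_add_right, dist_eq_norm (a * x.z), ← mul_sub, norm_mul, ← dist_eq_norm,
    show (‖a‖ * dist x.z q) ^ 2 + (‖a‖ * x.t) ^ 2 = ‖a‖ ^ 2 * (dist x.z q ^ 2 + x.t ^ 2) by ring,
    show 2 * (‖a‖ * r) * (‖a‖ * x.t) = ‖a‖ ^ 2 * (2 * r * x.t) by ring]
  exact (mul_le_mul_iff_right₀ (by positivity)).symm

theorem invIso_image_horoball_infty {r : ℝ} (hr : 0 < r) :
    H3.invIso '' horoball inftyPt r = horoball (finPt 0) (1 / (2 * r)) := by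
  refine image_eq_of_mem_iff fun x => ?_
  have hx := x.normSq_add_pos
  have hxt := x.t_pos
  rw [mem_horoball_infty, mem_horoball_finPt]
  change _ ↔ dist (H3.invMap x).z 0 ^ 2 + (H3.invMap x).t ^ 2 ≤ 2 * (1 / (2 * r)) * (H3.invMap x).t
  rw [dist_zero_right, Complex.sq_norm, H3.normSq_invMap]
  simp only [H3.invMap]
  rw [show 2 * (1 / (2 * r)) * (x.t / (Complex.normSq x.z + x.t ^ 2)) =
    (x.t / r) / (Complex.normSq x.z + x.t ^ 2) by field_simp, div_le_div_iff_of_pos_right hx,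
    le_div_iff₀ hr, one_mul]

theorem invIso_image_horoball_zero {r : ℝ} (hr : 0 < r) :
    H3.invIso '' horoball (finPt 0) r = horoball inftyPt (1 / (2 * r)) := by
  rw [show r = 1 / (2 * (1 / (2 * r))) by field_simp, ← invIso_image_horoball_infty (by positivity),
    image_image]
  have : ∀ x, H3.invIso (H3.invIso x) = x := H3.invMap_invMap
  simp only [this, image_id']
  congr 1
  field_simp

theorem invIso_image_horoball_coe {q : ℂ} (hq : q ≠ 0) (r : ℝ) :
    H3.invIso '' horoball (finPt q) r = horoball (finPt q⁻¹) (r / Complex.normSq q) := by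
  refine image_eq_of_mem_iff fun x => ?_
  have hx := x.normSq_add_pos
  have hxt := x.t_pos
  have hq' := Complex.normSq_pos.2 hq
  rw [mem_horoball_finPt, mem_horoball_finPt]
  change _ ↔ dist (H3.invMap x).z q⁻¹ ^ 2 + (H3.invMap x).t ^ 2 ≤
    2 * (r / Complex.normSq q) * (H3.invMap x).t
  have e : dist (H3.invMap x).z q⁻¹ ^ 2 + (H3.invMap x).t ^ 2 = (dist x.z q ^ 2 + x.t ^ 2) /
      ((Complex.normSq x.z + x.t ^ 2) * Complex.normSq q) := by
    rw [dist_sq_complex, dist_sq_complex, H3.invMap_z_re, H3.invMap_z_im, Complex.inv_re,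
      Complex.inv_im]
    simp only [H3.invMap]
    field_simp
    simp only [Complex.normSq_apply]
    ring
  rw [e, show 2 * (r / Complex.normSq q) * (H3.invMap x).t = 2 * r * x.t /
    ((Complex.normSq x.z + x.t ^ 2) * Complex.normSq q) by simp only [H3.invMap]; field_simp,
    div_le_div_iff_of_pos_right (by positivity)]

theorem extendsMap_affine (a b : ℂ) (ha : a ≠ 0) :
    ExtendsMap (affineGL a b ha) (H3.affineIso a b ha) where
  halfSpace k := by
    have hn : 0 < ‖a‖ ^ 2 := by have := norm_pos_iff.2 ha; positivity
    have hns : Complex.normSq a = ‖a‖ ^ 2 := (Complex.sq_norm a).symm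
    have hns' : a.re * a.re + a.im * a.im = ‖a‖ ^ 2 := by rw [← hns, Complex.normSq_apply]
    refine ⟨⟨k.A * ‖a‖ ^ 2, starRingEnd ℂ a * (k.A * b + k.b),
      k.A * Complex.normSq b + 2 * (starRingEnd ℂ k.b * b).re + k.C, ?_⟩, fun x => ?_, fun p => ?_⟩
    · rw [map_mul, Complex.normSq_conj, hns]
      have : Complex.normSq (k.A * b + k.b) = k.A * (k.A * Complex.normSq b +
          2 * (starRingEnd ℂ k.b * b).re) + Complex.normSq k.b := by
        simp only [Complex.normSq_apply]; simp; ring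
      rw [this]
      nlinarith [k.nondeg]
    · change 0 ≤ HalfSpace.eval _ _ ↔ 0 ≤ HalfSpace.eval _ _
      suffices e : ∀ u v : ℝ, u = v → (0 ≤ u ↔ 0 ≤ v) by
        apply e
        change _ = k.A * (Complex.normSq (a * x.z + b) + (‖a‖ * x.t) ^ 2) +
          2 * (starRingEnd ℂ k.b * (a * x.z + b)).re + k.C
        simp only [HalfSpace.eval, Complex.normSq_apply, mul_pow, ← hns']
        simp
        ring
      rintro u _ rfl; rfl
    · induction p using OnePoint.rec with
      | infty =>
        erw [affineGL_smul_infty]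
        change 0 ≤ k.A * ‖a‖ ^ 2 ↔ 0 ≤ k.A
        exact mul_nonneg_iff_of_pos_right hn
      | coe q =>
        erw [affineGL_smul_coe]
        suffices e : ∀ u v : ℝ, u = v → (0 ≤ u ↔ 0 ≤ v) by
          apply e
          change k.A * ‖a‖ ^ 2 * Complex.normSq q + 2 * (starRingEnd ℂ (starRingEnd ℂ a *
            (k.A * b + k.b)) * q).re + (k.A * Complex.normSq b + 2 * (starRingEnd ℂ k.b * b).re +
            k.C) = k.A * Complex.normSq (a * q + b) +
            2 * (starRingEnd ℂ k.b * (a * q + b)).re + k.C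
          simp only [Complex.normSq_apply, ← hns']
          simp
          ring
        rintro u _ rfl; rfl
  horoball p B hB := by
    have := norm_pos_iff.2 ha
    obtain ⟨r, hr, rfl⟩ := hB
    induction p using OnePoint.rec with
    | infty =>
      erw [affineGL_smul_infty]
      exact ⟨_, mul_pos this hr, affineIso_image_horoball_infty a b ha r⟩
    | coe q =>
      erw [affineGL_smul_coe]
      exact ⟨_, mul_pos this hr, affineIso_image_horoball_coe a b ha q r⟩

theorem affineGL_inv (a b : ℂ) (ha : a ≠ 0) :
    (affineGL a b ha)⁻¹ = affineGL a⁻¹ (-(a⁻¹ * b)) (inv_ne_zero ha) := by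
  rw [inv_eq_iff_mul_eq_one]
  ext i j
  fin_cases i <;> fin_cases j <;>
    simp [affineGL, Matrix.GeneralLinearGroup.mkOfDetNeZero, ha]

theorem isExtension_affine (a b : ℂ) (ha : a ≠ 0) :
    IsExtension (affineGL a b ha) (H3.affineIso a b ha) := by
  refine ⟨extendsMap_affine a b ha, ?_⟩
  rw [affineGL_inv]
  have : (H3.affineIso a b ha).symm = H3.affineIso a⁻¹ (-(a⁻¹ * b)) (inv_ne_zero ha) :=
    IsometryEquiv.ext fun x => rfl
  rw [this]
  exact extendsMap_affine _ _ _

theorem extendsMap_inv : ExtendsMap invGL H3.invIso where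
  halfSpace k := by
    refine ⟨⟨k.C, starRingEnd ℂ k.b, k.A, by rw [Complex.normSq_conj, mul_comm]; exact k.nondeg⟩,
      fun x => ?_, fun p => ?_⟩
    · have hx := x.normSq_add_pos
      change 0 ≤ k.C * (Complex.normSq x.z + x.t ^ 2) +
        2 * (starRingEnd ℂ (starRingEnd ℂ k.b) * x.z).re + k.A ↔
        0 ≤ k.A * (Complex.normSq (H3.invMap x).z + (H3.invMap x).t ^ 2) +
        2 * (starRingEnd ℂ k.b * (H3.invMap x).z).re + k.C
      have e : k.A * (Complex.normSq (H3.invMap x).z + (H3.invMap x).t ^ 2) +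
        2 * (starRingEnd ℂ k.b * (H3.invMap x).z).re + k.C =
        (k.C * (Complex.normSq x.z + x.t ^ 2) +
        2 * (starRingEnd ℂ (starRingEnd ℂ k.b) * x.z).re + k.A) /
          (Complex.normSq x.z + x.t ^ 2) := by
        rw [H3.normSq_invMap, Complex.mul_re, H3.invMap_z_re, H3.invMap_z_im]
        simp only [Complex.conj_conj, Complex.conj_re, Complex.conj_im, Complex.mul_re]
        field_simp
        ring
      rw [e]
      rw [le_div_iff₀ hx, zero_mul]
    · induction p using OnePoint.rec with
      | infty =>
        erw [invGL_smul_infty]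
        change 0 ≤ k.C ↔ 0 ≤ k.A * Complex.normSq 0 + 2 * (starRingEnd ℂ k.b * 0).re + k.C
        simp
      | coe q =>
        by_cases hq : q = 0
        · subst hq
          erw [invGL_smul_zero]
          change 0 ≤ k.C * Complex.normSq 0 + 2 * (starRingEnd ℂ (starRingEnd ℂ k.b) * 0).re + k.A ↔
            0 ≤ k.A
          simp
        · have hq' := Complex.normSq_pos.2 hq
          erw [invGL_smul_coe hq]
          change 0 ≤ k.C * Complex.normSq q + 2 * (starRingEnd ℂ (starRingEnd ℂ k.b) * q).re + k.A ↔
            0 ≤ k.A * Complex.normSq q⁻¹ + 2 * (starRingEnd ℂ k.b * q⁻¹).re + k.C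
          have e : k.A * Complex.normSq q⁻¹ + 2 * (starRingEnd ℂ k.b * q⁻¹).re + k.C =
              (k.C * Complex.normSq q + 2 * (starRingEnd ℂ (starRingEnd ℂ k.b) * q).re + k.A) /
                Complex.normSq q := by
            rw [Complex.normSq_inv, Complex.mul_re, Complex.inv_re, Complex.inv_im]
            simp only [Complex.conj_conj, Complex.conj_re, Complex.conj_im, Complex.mul_re]
            field_simp
            ring
          rw [e]
          rw [le_div_iff₀ hq', zero_mul]
  horoball p B hB := by
    obtain ⟨r, hr, rfl⟩ := hB
    induction p using OnePoint.rec with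
    | infty =>
      erw [invGL_smul_infty]
      exact ⟨_, by positivity, invIso_image_horoball_infty hr⟩
    | coe q =>
      by_cases hq : q = 0
      · subst hq
        erw [invGL_smul_zero]
        exact ⟨_, by positivity, invIso_image_horoball_zero hr⟩
      · erw [invGL_smul_coe hq]
        exact ⟨_, div_pos hr (Complex.normSq_pos.2 hq), invIso_image_horoball_coe hq r⟩

theorem isExtension_inv : IsExtension invGL H3.invIso := by
  refine ⟨extendsMap_inv, ?_⟩
  have h1 : invGL⁻¹ = invGL := by
    rw [inv_eq_iff_mul_eq_one]
    ext i j
    fin_cases i <;> fin_cases j <;> simp [invGL, Matrix.GeneralLinearGroup.mkOfDetNeZero]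
  have h2 : H3.invIso.symm = H3.invIso := IsometryEquiv.ext fun x => rfl
  rw [h1, h2]
  exact extendsMap_inv

/-- Only the Möbius action of the matrix matters, and it does not see scalar factors. -/
theorem IsExtension.congr {g g' : GL (Fin 2) ℂ} {φ : H3 ≃ᵢ H3} (h : IsExtension g φ)
    (hg : ∀ p : Ideal3, g • p = g' • p) : IsExtension g' φ := by
  have hg' : ∀ p : Ideal3, g⁻¹ • p = g'⁻¹ • p := fun p => by
    rw [inv_smul_eq_iff, hg, smul_inv_smul]
  refine ⟨⟨fun k => ?_, fun p B hB => ?_⟩, ⟨fun k => ?_, fun p B hB => ?_⟩⟩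
  · simpa only [hg] using h.1.halfSpace k
  · rw [← hg]; exact h.1.horoball p B hB
  · simpa only [hg'] using h.2.halfSpace k
  · rw [← hg']; exact h.2.horoball p B hB

/-- The Bruhat decomposition: a Möbius transformation either fixes `∞` and is affine, or is an
affine map after `1 / z` after an affine map. -/
theorem exists_isExtension (g : GL (Fin 2) ℂ) : ∃ φ, IsExtension g φ := by
  have hdet : g 0 0 * g 1 1 - g 0 1 * g 1 0 ≠ 0 := by
    rw [← Matrix.det_fin_two]; exact g.det_ne_zero
  by_cases hc : g 1 0 = 0
  · have ha : g 0 0 ≠ 0 := by rintro h0; rw [h0, hc] at hdet; simp at hdet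
    have hd : g 1 1 ≠ 0 := by rintro h0; rw [h0, hc] at hdet; simp at hdet
    refine ⟨_, (isExtension_affine (g 0 0 / g 1 1) (g 0 1 / g 1 1) (div_ne_zero ha hd)).congr
      fun p => ?_⟩
    induction p using OnePoint.rec with
    | infty =>
      erw [affineGL_smul_infty, OnePoint.smul_infty_eq_ite, if_pos hc]
    | coe q =>
      erw [affineGL_smul_coe, OnePoint.smul_some_eq_ite, hc, zero_mul, zero_add, if_neg hd]
      congr 1
      field_simp
  · have hc' : (g 0 1 * g 1 0 - g 0 0 * g 1 1) / g 1 0 ≠ 0 :=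
      div_ne_zero (fun h0 => hdet (by linear_combination -h0)) hc
    have : g = affineGL _ (g 0 0 / g 1 0) hc' * (invGL * affineGL (g 1 0) (g 1 1) hc) := by
      ext i j
      fin_cases i <;> fin_cases j <;>
        simp [affineGL, invGL, Matrix.GeneralLinearGroup.mkOfDetNeZero] <;> field_simp
      ring
    rw [this]
    exact ⟨_, (isExtension_affine _ _ hc').mul (isExtension_inv.mul (isExtension_affine _ _ hc))⟩

/-! ### Transport of symmetric packings -/

theorem image_interior (φ : H3 ≃ᵢ H3) (S : Set H3) : interior (φ '' S) = φ '' interior S :=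
  (φ.toHomeomorph.image_interior S).symm

theorem IsPackingOn.image {g : GL (Fin 2) ℂ} {φ : H3 ≃ᵢ H3} (h : IsExtension g φ)
    {V : Set Ideal3} {H : Set (Set H3)} (hH : IsPackingOn V H) :
    IsPackingOn ((fun p : Ideal3 => g • p) '' V) ((fun B => φ '' B) '' H) := by
  constructor
  · rintro _ ⟨B, hB, rfl⟩
    obtain ⟨p, hp, hpB⟩ := hH.1 B hB
    exact ⟨_, mem_image_of_mem _ hp, h.1.horoball p B hpB⟩
  · rintro _ ⟨B, hB, rfl⟩ _ ⟨B', hB', rfl⟩ hne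
    simp only [image_interior]
    exact (Set.disjoint_image_iff φ.injective).2 (hH.2 B hB B' hB' fun he => hne (by rw [he]))

theorem image_symm_image_collection (φ : H3 ≃ᵢ H3) (H : Set (Set H3)) :
    (fun B => φ '' B) '' ((fun B => φ.symm '' B) '' H) = H := by
  simp only [image_image, IsometryEquiv.apply_symm_apply, image_id']

theorem image_image_symm_collection (φ : H3 ≃ᵢ H3) (H : Set (Set H3)) :
    (fun B => φ.symm '' B) '' ((fun B => φ '' B) '' H) = H := by
  simp only [image_image, IsometryEquiv.symm_apply_apply, image_id']

theorem IsSymmetricPacking.image {g : GL (Fin 2) ℂ} {φ : H3 ≃ᵢ H3} (h : IsExtension g φ)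
    {V : Set Ideal3} {H : Set (Set H3)} (hH : IsSymmetricPacking V H) :
    IsSymmetricPacking ((fun p : Ideal3 => g • p) '' V) ((fun B => φ '' B) '' H) where
  packing := hH.packing.image h
  invariant := by
    rintro ψ hψ _ ⟨B, hB, rfl⟩
    refine ⟨φ.symm '' (ψ '' (φ '' B)), ?_, by simp only [image_image,
      IsometryEquiv.apply_symm_apply]⟩
    have := hH.invariant ((φ.trans ψ).trans φ.symm) (by
      rw [← h.image_idealHull] at hψ
      have e : ((φ.trans ψ).trans φ.symm) '' idealHull V =
          φ.symm '' (ψ '' (φ '' idealHull V)) := by simp only [image_image]; rfl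
      rw [e, hψ]
      simp only [image_image, IsometryEquiv.symm_apply_apply, image_id']) B hB
    have e : ((φ.trans ψ).trans φ.symm) '' B = φ.symm '' (ψ '' (φ '' B)) := by
      simp only [image_image]; rfl
    rwa [e] at this
  maximal := by
    intro H' hH' hle
    have h1 := hH'.image h.inv
    rw [image_image] at h1
    simp only [inv_smul_smul, image_id'] at h1
    have h2 := hH.maximal _ h1 (by
      intro B hB
      obtain ⟨B', hB', hs⟩ := hle _ (mem_image_of_mem _ hB)
      refine ⟨_, mem_image_of_mem _ hB', ?_⟩
      intro x hx
      exact ⟨φ x, hs (mem_image_of_mem _ hx), by simp⟩)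
    rw [← h2, image_symm_image_collection]

/-! ### The symmetric packing of a regular ideal tetrahedron or octahedron -/

/-- A horoball at `∞` contains arbitrarily high points, one at `q ∈ ℂ` does not. Above its centre
`q` the latter contains arbitrarily low points, which a horoball at another point of `ℂ` does not.
-/
theorem IsHoroballAt.centre_unique {p p' : Ideal3} {B : Set H3} (h : IsHoroballAt p B)
    (h' : IsHoroballAt p' B) : p = p' := by
  obtain ⟨r, hr, rfl⟩ := h
  obtain ⟨r', hr', he⟩ := h'
  have aux : ∀ (q : ℂ) (r s : ℝ), 0 < r → horoball inftyPt s ≠ horoball (finPt q) r := by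
    intro q r s hr he
    have hm : 0 < max s 0 + 2 * r + 1 := by positivity
    have h1 : (⟨q, max s 0 + 2 * r + 1, hm⟩ : H3) ∈ horoball inftyPt s := by
      rw [mem_horoball_infty]; have := le_max_left s 0; simp only; linarith
    rw [he, mem_horoball_finPt] at h1
    have := le_max_right s 0
    simp only [dist_self] at h1
    nlinarith
  induction p using OnePoint.rec with
  | infty =>
    induction p' using OnePoint.rec with
    | infty => rfl
    | coe q' => exact absurd he (aux q' r' r hr')
  | coe q =>
    induction p' using OnePoint.rec with
    | infty => exact absurd he.symm (aux q r r' hr)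
    | coe q' =>
      by_contra hne
      have hqq : q ≠ q' := fun h => hne (by rw [h])
      have hd : 0 < dist q q' := dist_pos.2 hqq
      -- The first bound places the point above `q` inside the ball at `q`; the second gives `2 r' ε
      -- < dist q q' ^ 2`, which places it outside the ball at `q'`.
      set ε := min (2 * r) (dist q q' ^ 2 / (4 * r')) with hε
      have hε0 : 0 < ε := lt_min (by positivity) (by positivity)
      have h1 : (⟨q, ε, hε0⟩ : H3) ∈ horoball (finPt q) r := by
        rw [mem_horoball_finPt]
        have := min_le_left (2 * r) (dist q q' ^ 2 / (4 * r'))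
        simp only [dist_self]
        nlinarith
      have he' : horoball (finPt q) r = horoball (finPt q') r' := he
      rw [he', mem_horoball_finPt] at h1
      have h2 := min_le_right (2 * r) (dist q q' ^ 2 / (4 * r'))
      rw [← hε, le_div_iff₀ (by positivity)] at h2
      simp only at h1
      nlinarith

namespace TileType

/-- The linear coefficient of the rotation of the unit triangle or square. -/
def rot : TileType → ℂ
  | .T => omega - 1
  | .O => Complex.I

theorem norm_rot (τ : TileType) : ‖τ.rot‖ = 1 := by
  cases τ
  · change ‖omega - 1‖ = 1
    rw [← omega_sq, norm_pow, show ‖omega‖ = 1 from TileType.T.norm_dir, one_pow]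
  · simp [rot]

theorem rot_ne_zero (τ : TileType) : τ.rot ≠ 0 := norm_ne_zero_iff.1 (by simp [norm_rot])
theorem dir_ne_zero (τ : TileType) : τ.dir ≠ 0 := norm_ne_zero_iff.1 (by simp [norm_dir])

/-- The maximal symmetric packing of the standard tile. -/
def stdPacking : TileType → Set (Set H3)
  | .T => {horoball inftyPt 1, horoball (finPt 0) (1 / 2), horoball (finPt 1) (1 / 2),
      horoball (finPt omega) (1 / 2)}
  | .O => {horoball inftyPt 1, horoball (finPt 0) (1 / 2), horoball (finPt 1) (1 / 2),
      horoball (finPt (1 + Complex.I)) (1 / 2), horoball (finPt Complex.I) (1 / 2),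
      horoball (finPt ((1 + Complex.I) / 2)) (1 / 4)}

theorem horoball_infty_mem (τ : TileType) : horoball inftyPt 1 ∈ τ.stdPacking := by
  cases τ <;> exact Or.inl rfl

theorem infty_mem_std (τ : TileType) : inftyPt ∈ τ.std := by cases τ <;> exact Or.inl rfl

/-- `φ` is a symmetry of the standard tile and its packing that extends `g`. -/
structure IsSymmetry (τ : TileType) (g : GL (Fin 2) ℂ) (φ : H3 ≃ᵢ H3) : Prop where
  ext : IsExtension g φ
  std : (fun p : Ideal3 => g • p) '' τ.std = τ.std
  packing : (fun B => φ '' B) '' τ.stdPacking = τ.stdPacking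

theorem IsSymmetry.mul {τ : TileType} {g g' : GL (Fin 2) ℂ} {φ φ' : H3 ≃ᵢ H3}
    (h : IsSymmetry τ g φ) (h' : IsSymmetry τ g' φ') : IsSymmetry τ (g * g') (φ'.trans φ) where
  ext := h.ext.mul h'.ext
  std := by
    have : (fun p : Ideal3 => (g * g') • p) = (fun p => g • p) ∘ fun p => g' • p :=
      funext fun p => mul_smul g g' p
    rw [this, image_comp, h'.std, h.std]
  packing := by
    have : (fun B : Set H3 => (φ'.trans φ) '' B) = (fun B => φ '' B) ∘ fun B => φ' '' B :=
      funext fun B => by simp only [Function.comp, image_image]; rfl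
    rw [this, image_comp, h'.packing, h.packing]

theorem IsSymmetry.inv {τ : TileType} {g : GL (Fin 2) ℂ} {φ : H3 ≃ᵢ H3}
    (h : IsSymmetry τ g φ) : IsSymmetry τ g⁻¹ φ.symm where
  ext := h.ext.inv
  std := by
    conv_lhs => rw [← h.std]
    rw [image_image]
    simp only [inv_smul_smul, image_id']
  packing := by
    conv_lhs => rw [← h.packing]
    exact image_image_symm_collection φ _

theorem IsSymmetry.image_idealHull {τ : TileType} {g : GL (Fin 2) ℂ} {φ : H3 ≃ᵢ H3}
    (h : IsSymmetry τ g φ) : φ '' idealHull τ.std = idealHull τ.std := by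
  rw [h.ext.image_idealHull, h.std]

theorem isSymmetry_rot (τ : TileType) :
    IsSymmetry τ (affineGL τ.rot 1 τ.rot_ne_zero) (H3.affineIso τ.rot 1 τ.rot_ne_zero) where
  ext := isExtension_affine _ _ _
  std := by
    cases τ
    · simp only [std, stdTet, image_insert_eq, image_singleton, affineGL_smul_infty,
        affineGL_smul_coe, rot]
      rw [show (omega - 1) * 0 + 1 = 1 by ring, show (omega - 1) * 1 + 1 = omega by ring,
        show (omega - 1) * omega + 1 = 0 by linear_combination omega_sq]
      ext; simp; tauto
    · simp only [std, stdOct, image_insert_eq, image_singleton, affineGL_smul_infty,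
        affineGL_smul_coe, rot]
      have hI := Complex.I_sq
      rw [show Complex.I * 0 + 1 = 1 by ring, show Complex.I * 1 + 1 = 1 + Complex.I by ring,
        show Complex.I * (1 + Complex.I) + 1 = Complex.I by linear_combination hI,
        show Complex.I * Complex.I + 1 = 0 by linear_combination hI,
        show Complex.I * ((1 + Complex.I) / 2) + 1 = (1 + Complex.I) / 2 by
          linear_combination hI / 2]
      ext; simp; tauto
  packing := by
    cases τ
    · simp only [stdPacking, image_insert_eq, image_singleton, affineIso_image_horoball_infty,
        affineIso_image_horoball_coe, norm_rot, one_mul]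
      simp only [rot]
      rw [show (omega - 1) * 0 + 1 = 1 by ring, show (omega - 1) * 1 + 1 = omega by ring,
        show (omega - 1) * omega + 1 = 0 by linear_combination omega_sq]
      ext; simp; tauto
    · simp only [stdPacking, image_insert_eq, image_singleton, affineIso_image_horoball_infty,
        affineIso_image_horoball_coe, norm_rot, one_mul]
      simp only [rot]
      have hI := Complex.I_sq
      rw [show Complex.I * 0 + 1 = 1 by ring, show Complex.I * 1 + 1 = 1 + Complex.I by ring,
        show Complex.I * (1 + Complex.I) + 1 = Complex.I by linear_combination hI,
        show Complex.I * Complex.I + 1 = 0 by linear_combination hI,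
        show Complex.I * ((1 + Complex.I) / 2) + 1 = (1 + Complex.I) / 2 by
          linear_combination hI / 2]
      ext; simp; tauto

theorem omega_ne_zero : omega ≠ 0 := TileType.T.dir_ne_zero

theorem one_add_I_ne_zero : 1 + Complex.I ≠ 0 := by
  intro h; simpa using congrArg Complex.re h

/-- The Möbius transformation `z ↦ u / z` that exchanges `0` and `∞`. -/
def swapGL (τ : TileType) : GL (Fin 2) ℂ := affineGL τ.dir 0 τ.dir_ne_zero * invGL

/-- The extension of `z ↦ u / z`. -/
def swapIso (τ : TileType) : H3 ≃ᵢ H3 := H3.invIso.trans (H3.affineIso τ.dir 0 τ.dir_ne_zero)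

theorem swapGL_smul_infty (τ : TileType) : τ.swapGL • inftyPt = finPt 0 := by
  rw [swapGL, mul_smul, invGL_smul_infty, affineGL_smul_coe]; simp

theorem swapGL_smul_zero (τ : TileType) : τ.swapGL • finPt 0 = inftyPt := by
  rw [swapGL, mul_smul, invGL_smul_zero, affineGL_smul_infty]

theorem swapGL_smul_coe (τ : TileType) {q q' : ℂ} (hq : q ≠ 0) (h : τ.dir = q' * q) :
    τ.swapGL • finPt q = finPt q' := by
  rw [swapGL, mul_smul, invGL_smul_coe hq, affineGL_smul_coe, h, add_zero,
    mul_inv_cancel_right₀ hq]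

theorem swapIso_image (τ : TileType) (S : Set H3) :
    τ.swapIso '' S = H3.affineIso τ.dir 0 τ.dir_ne_zero '' (H3.invIso '' S) := by
  rw [image_image]; rfl

theorem swapIso_image_infty (τ : TileType) {r : ℝ} (hr : 0 < r) :
    τ.swapIso '' horoball inftyPt r = horoball (finPt 0) (1 / (2 * r)) := by
  rw [swapIso_image, invIso_image_horoball_infty hr, affineIso_image_horoball_coe, norm_dir,
    one_mul, mul_zero, add_zero]

theorem swapIso_image_zero (τ : TileType) {r : ℝ} (hr : 0 < r) :
    τ.swapIso '' horoball (finPt 0) r = horoball inftyPt (1 / (2 * r)) := by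
  rw [swapIso_image, invIso_image_horoball_zero hr, affineIso_image_horoball_infty, norm_dir,
    one_mul]

theorem swapIso_image_coe (τ : TileType) {q q' : ℂ} (hq : q ≠ 0) (h : τ.dir = q' * q) (r : ℝ) :
    τ.swapIso '' horoball (finPt q) r = horoball (finPt q') (r / Complex.normSq q) := by
  rw [swapIso_image, invIso_image_horoball_coe hq, affineIso_image_horoball_coe, norm_dir,
    one_mul, h, add_zero, mul_inv_cancel_right₀ hq]

theorem isSymmetry_swap (τ : TileType) : IsSymmetry τ τ.swapGL τ.swapIso where
  ext := (isExtension_affine _ _ _).mul isExtension_inv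
  std := by
    have hI := Complex.I_sq
    cases τ
    · simp only [std, stdTet, image_insert_eq, image_singleton, swapGL_smul_infty,
        swapGL_smul_zero]
      rw [swapGL_smul_coe (q' := omega) _ one_ne_zero (by simp [dir]),
        swapGL_smul_coe (q' := 1) _ omega_ne_zero (by simp [dir])]
      ext; simp; tauto
    · simp only [std, stdOct, image_insert_eq, image_singleton, swapGL_smul_infty,
        swapGL_smul_zero]
      rw [swapGL_smul_coe (q' := Complex.I) _ one_ne_zero (by simp [dir]),
        swapGL_smul_coe (q' := 1) _ Complex.I_ne_zero (by simp [dir]),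
        swapGL_smul_coe (q' := (1 + Complex.I) / 2) _ one_add_I_ne_zero (by
          simp only [dir]; linear_combination -hI / 2),
        swapGL_smul_coe (q' := 1 + Complex.I) _ (div_ne_zero one_add_I_ne_zero two_ne_zero) (by
          simp only [dir]; linear_combination -hI / 2)]
      ext; simp; tauto
  packing := by
    have hI := Complex.I_sq
    cases τ
    · simp only [stdPacking, image_insert_eq, image_singleton]
      rw [swapIso_image_infty _ one_pos, swapIso_image_zero _ (by norm_num),
        swapIso_image_coe (q' := omega) _ one_ne_zero (by simp [dir]),
        swapIso_image_coe (q' := 1) _ omega_ne_zero (by simp [dir]),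
        ← Complex.sq_norm omega, show ‖omega‖ = 1 from TileType.T.norm_dir]
      norm_num
      ext; simp; tauto
    · simp only [stdPacking, image_insert_eq, image_singleton]
      rw [swapIso_image_infty _ one_pos, swapIso_image_zero _ (by norm_num),
        swapIso_image_coe (q' := Complex.I) _ one_ne_zero (by simp [dir]),
        swapIso_image_coe (q' := 1) _ Complex.I_ne_zero (by simp [dir]),
        swapIso_image_coe (q' := (1 + Complex.I) / 2) _ one_add_I_ne_zero (by
          simp only [dir]; linear_combination -hI / 2),
        swapIso_image_coe (q' := 1 + Complex.I) _ (div_ne_zero one_add_I_ne_zero two_ne_zero) (by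
          simp only [dir]; linear_combination -hI / 2)]
      have e1 : Complex.normSq (1 + Complex.I) = 2 := by rw [Complex.normSq_apply]; norm_num
      have e2 : Complex.normSq ((1 + Complex.I) / 2) = 1 / 2 := by
        rw [Complex.normSq_apply]; norm_num
      rw [e1, e2, Complex.normSq_I, Complex.normSq_one]
      norm_num
      ext; simp; tauto

/-- The symmetry group of the standard tile is transitive on the ideal vertices. -/
theorem exists_symmetry (τ : TileType) {p : Ideal3} (hp : p ∈ τ.std) :
    ∃ g φ, IsSymmetry τ g φ ∧ g • inftyPt = p := by
  have hJ := τ.isSymmetry_swap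
  have hR := τ.isSymmetry_rot
  have j0 := τ.swapGL_smul_infty
  have hI := Complex.I_sq
  have r0 : affineGL τ.rot 1 τ.rot_ne_zero • finPt 0 = finPt 1 := by simp
  cases τ
  · have r1 : affineGL TileType.T.rot 1 TileType.T.rot_ne_zero • finPt 1 = finPt omega := by
      rw [affineGL_smul_coe]; simp [rot]
    simp only [std, stdTet, mem_insert_iff, mem_singleton_iff] at hp
    rcases hp with rfl | rfl | rfl | rfl
    · exact ⟨_, _, hR, by simp⟩
    · exact ⟨_, _, hJ, j0⟩
    · exact ⟨_, _, hR.mul hJ, by rw [mul_smul, j0, r0]⟩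
    · exact ⟨_, _, hR.mul (hR.mul hJ), by rw [mul_smul, mul_smul, j0, r0, r1]⟩
  · have r1 : affineGL TileType.O.rot 1 TileType.O.rot_ne_zero • finPt 1 =
        finPt (1 + Complex.I) := by
      rw [affineGL_smul_coe]; simp only [rot]; rw [mul_one, add_comm]
    have r2 : affineGL TileType.O.rot 1 TileType.O.rot_ne_zero • finPt (1 + Complex.I) =
        finPt Complex.I := by
      rw [affineGL_smul_coe]; congr 1; simp only [rot]; linear_combination hI
    have j1 : TileType.O.swapGL • finPt (1 + Complex.I) = finPt ((1 + Complex.I) / 2) :=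
      swapGL_smul_coe _ one_add_I_ne_zero (by simp only [dir]; linear_combination -hI / 2)
    simp only [std, stdOct, mem_insert_iff, mem_singleton_iff] at hp
    rcases hp with rfl | rfl | rfl | rfl | rfl | rfl
    · exact ⟨_, _, hR, by simp⟩
    · exact ⟨_, _, hJ, j0⟩
    · exact ⟨_, _, hR.mul hJ, by rw [mul_smul, j0, r0]⟩
    · exact ⟨_, _, hR.mul (hR.mul hJ), by rw [mul_smul, mul_smul, j0, r0, r1]⟩
    · exact ⟨_, _, hR.mul (hR.mul (hR.mul hJ)), by
        rw [mul_smul, mul_smul, mul_smul, j0, r0, r1, r2]⟩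
    · exact ⟨_, _, hJ.mul (hR.mul (hR.mul hJ)), by
        rw [mul_smul, mul_smul, mul_smul, j0, r0, r1, j1]⟩

theorem stdPacking_centre (τ : TileType) {B : Set H3} (hB : B ∈ τ.stdPacking) :
    ∃ p ∈ τ.std, IsHoroballAt p B ∧ (p = inftyPt → B = horoball inftyPt 1) ∧
      ∀ q, p = finPt q → ∃ r, r ≤ 1 / 2 ∧ B = horoball (finPt q) r := by
  have hfin : ∀ (q : ℂ) (r : ℝ), finPt q ∈ τ.std → 0 < r → r ≤ 1 / 2 →
      B = horoball (finPt q) r → ∃ p ∈ τ.std, IsHoroballAt p B ∧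
      (p = inftyPt → B = horoball inftyPt 1) ∧
      ∀ q, p = finPt q → ∃ r, r ≤ 1 / 2 ∧ B = horoball (finPt q) r := by
    rintro q r hq hr hr2 rfl
    refine ⟨finPt q, hq, ⟨r, hr, rfl⟩, fun h => absurd h (OnePoint.coe_ne_infty q), ?_⟩
    intro q' hq'
    exact ⟨r, hr2, by rw [OnePoint.coe_injective hq']⟩
  have hinf : B = horoball inftyPt 1 → ∃ p ∈ τ.std, IsHoroballAt p B ∧
      (p = inftyPt → B = horoball inftyPt 1) ∧
      ∀ q, p = finPt q → ∃ r, r ≤ 1 / 2 ∧ B = horoball (finPt q) r := by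
    rintro rfl
    exact ⟨inftyPt, τ.infty_mem_std, ⟨1, one_pos, rfl⟩, fun _ => rfl,
      fun q h => absurd h.symm (OnePoint.coe_ne_infty q)⟩
  cases τ
  · rcases hB with h | h | h | h
    · exact hinf h
    all_goals exact hfin _ _ (by simp [std, stdTet]) (by norm_num) (by norm_num) h
  · rcases hB with h | h | h | h | h | h
    · exact hinf h
    all_goals exact hfin _ _ (by simp [std, stdOct]) (by norm_num) (by norm_num) h

/-- A symmetry moves the first of two horoballs to `t ≥ 1`; any other one is then a ball of radius
at most `1/2`, which lies below. -/
theorem isPackingOn_stdPacking (τ : TileType) : IsPackingOn τ.std τ.stdPacking := by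
  refine ⟨fun B hB => ?_, fun B hB B' hB' hne => ?_⟩
  · obtain ⟨p, hp, h, -⟩ := τ.stdPacking_centre hB
    exact ⟨p, hp, h⟩
  obtain ⟨p, hp, h, -⟩ := τ.stdPacking_centre hB
  obtain ⟨g, φ, hs, rfl⟩ := τ.exists_symmetry hp
  have hi := hs.inv
  have m : φ.symm '' B ∈ τ.stdPacking := hi.packing ▸ mem_image_of_mem _ hB
  have m' : φ.symm '' B' ∈ τ.stdPacking := hi.packing ▸ mem_image_of_mem _ hB'
  have hc := hs.ext.2.horoball _ _ h
  rw [inv_smul_smul] at hc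
  obtain ⟨p1, -, h1, h2, -⟩ := τ.stdPacking_centre m
  have e1 := h2 (h1.centre_unique hc)
  obtain ⟨p2, -, h3, h4, h5⟩ := τ.stdPacking_centre m'
  rw [← Set.disjoint_image_iff φ.symm.injective, ← image_interior, ← image_interior, e1]
  have hne' : φ.symm '' B ≠ φ.symm '' B' := fun he => hne (φ.symm.injective.image_injective he)
  induction p2 using OnePoint.rec with
  | infty => exact absurd (e1.trans (h4 rfl).symm) hne'
  | coe q =>
    obtain ⟨r, hr, e2⟩ := h5 q rfl
    rw [e2]
    exact disjoint_of_le_infty (by linarith)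

/-- In an invariant packing a horoball can be moved to `t ≥ s`. The swap of `0` and `∞` makes the
ball of radius `1 / (2 s)` at `0` a member too, so disjointness gives `1 / s ≤ s`, that is `1 ≤ s`.
Hence every member is contained in one of the standard packing, and maximality yields equality. -/
theorem eq_stdPacking {τ : TileType} {H : Set (Set H3)} (hH : IsSymmetricPacking τ.std H) :
    H = τ.stdPacking := by
  refine (hH.maximal _ τ.isPackingOn_stdPacking fun B hB => ?_).symm
  obtain ⟨p, hp, hpB⟩ := hH.packing.1 B hB
  obtain ⟨g, φ, hs, rfl⟩ := τ.exists_symmetry hp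
  have m := hH.invariant φ.symm hs.inv.image_idealHull B hB
  obtain ⟨s, hs0, e⟩ : IsHoroballAt inftyPt (φ.symm '' B) := by
    have := hs.inv.ext.1.horoball _ _ hpB
    rwa [inv_smul_smul] at this
  have m' := hH.invariant _ τ.isSymmetry_swap.image_idealHull _ m
  rw [e] at m m'
  rw [swapIso_image_infty τ hs0] at m'
  have hne : horoball inftyPt s ≠ horoball (finPt 0) (1 / (2 * s)) := fun he =>
    OnePoint.coe_ne_infty (0 : ℂ) (IsHoroballAt.centre_unique
      (B := horoball inftyPt s) ⟨_, by positivity, he⟩ ⟨s, hs0, rfl⟩)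
  have hle := le_of_disjoint_infty (by positivity) (hH.packing.2 _ m _ m' hne)
  have hs1 : 1 ≤ s := by
    rw [show 2 * (1 / (2 * s)) = 1 / s by field_simp, div_le_iff₀ hs0] at hle
    nlinarith
  refine ⟨φ '' horoball inftyPt 1, hs.packing ▸ mem_image_of_mem _ τ.horoball_infty_mem, ?_⟩
  have : B = φ '' horoball inftyPt s := by
    rw [← e, image_image]; simp
  rw [this]
  exact image_mono fun x (hx : s ≤ x.t) => hs1.trans hx

end TileType

/-- The symmetric packing of a regular ideal polyhedron is the image of the standard one. -/
theorem eq_image_stdPacking {τ : TileType} {g : GL (Fin 2) ℂ} {φ : H3 ≃ᵢ H3}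
    (h : IsExtension g φ) {H : Set (Set H3)}
    (hH : IsSymmetricPacking ((fun p : Ideal3 => g • p) '' τ.std) H) :
    H = (fun B => φ '' B) '' τ.stdPacking := by
  have := hH.image h.inv
  rw [image_image] at this
  simp only [inv_smul_smul, image_id'] at this
  rw [← TileType.eq_stdPacking this, image_symm_image_collection]

/-- A regular ideal polyhedron with vertex `∞` is the image of the standard one under a
similarity. -/
theorem IsRegular.exists_affine {τ : TileType} {V : Set Ideal3} (h : IsRegular τ V)
    (hV : inftyPt ∈ V) : ∃ (a b : ℂ) (ha : a ≠ 0),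
      V = (fun p : Ideal3 => affineGL a b ha • p) '' τ.std := by
  obtain ⟨g, rfl⟩ := h
  obtain ⟨p, hp, hgp⟩ := hV
  obtain ⟨g', φ', hs, rfl⟩ := τ.exists_symmetry hp
  dsimp only at hgp
  rw [← mul_smul] at hgp
  have hc := OnePoint.smul_infty_eq_self_iff.1 hgp
  set k := g * g' with hk
  have hdet : k 0 0 * k 1 1 - k 0 1 * k 1 0 ≠ 0 := by
    rw [← Matrix.det_fin_two]; exact k.det_ne_zero
  have ha : k 0 0 ≠ 0 := by rintro h0; rw [h0, hc] at hdet; simp at hdet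
  have hd : k 1 1 ≠ 0 := by rintro h0; rw [h0, hc] at hdet; simp at hdet
  refine ⟨k 0 0 / k 1 1, k 0 1 / k 1 1, div_ne_zero ha hd, ?_⟩
  have e : (fun p : Ideal3 => affineGL (k 0 0 / k 1 1) (k 0 1 / k 1 1) (div_ne_zero ha hd) • p) =
      fun p => k • p := by
    funext p
    induction p using OnePoint.rec with
    | infty =>
      erw [affineGL_smul_infty, OnePoint.smul_infty_eq_ite, if_pos hc]
    | coe q =>
      erw [affineGL_smul_coe, OnePoint.smul_some_eq_ite, hc, zero_mul, zero_add, if_neg hd]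
      congr 1
      field_simp
  rw [e]
  conv_lhs => rw [← hs.std]
  rw [image_image]
  simp only [hk, mul_smul]

/-! ### Tiles and horoballs -/

/-- A closed half-plane, as a vertical half-space. -/
theorem exists_vertical_halfSpace {K : Set ℂ} (hK : IsClosed K) (hconv : Convex ℝ K) {z : ℂ}
    (hne : K.Nonempty) (hz : z ∉ K) : ∃ h : HalfSpace, h.A = 0 ∧
      (∀ w ∈ K, 0 ≤ 2 * (starRingEnd ℂ h.b * w).re + h.C) ∧
      2 * (starRingEnd ℂ h.b * z).re + h.C < 0 := by
  obtain ⟨f, u, hfz, hfK⟩ := geometric_hahn_banach_point_closed hconv hK hz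
  have hf : ∀ w : ℂ, f w = 2 * (starRingEnd ℂ (⟨f 1 / 2, f Complex.I / 2⟩ : ℂ) * w).re := by
    intro w
    have : w = w.re • (1 : ℂ) + w.im • Complex.I := by
      simp only [Complex.real_smul, mul_one]; exact (Complex.re_add_im w).symm
    conv_lhs => rw [this, map_add, map_smul, map_smul]
    simp only [Complex.mul_re, Complex.conj_re, Complex.conj_im, smul_eq_mul]
    ring
  obtain ⟨k, hk⟩ := hne
  refine ⟨⟨0, ⟨f 1 / 2, f Complex.I / 2⟩, -u, ?_⟩, rfl, fun w hw => ?_, ?_⟩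
  · rw [zero_mul, Complex.normSq_pos]
    intro h0
    have h1 := hf z
    have h2 := hf k
    rw [h0] at h1 h2
    simp at h1 h2
    have := hfK k hk
    linarith
  · have := hfK w hw
    simp only
    rw [← hf]; linarith
  · simp only
    rw [← hf]; linarith

/-- Separation of a point from `K` by a line gives a vertical half-space, which always contains `∞`.
-/
theorem z_mem_of_mem_idealHull {V : Set Ideal3} {K : Set ℂ} (hK : IsClosed K)
    (hconv : Convex ℝ K) (hne : K.Nonempty) (hV : ∀ p ∈ V, p = inftyPt ∨ ∃ q ∈ K, p = finPt q)
    {x : H3} (hx : x ∈ idealHull V) : x.z ∈ K := by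
  by_contra hz
  obtain ⟨h, hA, h1, h2⟩ := exists_vertical_halfSpace hK hconv hne hz
  have := hx h (by
    intro p hp
    rcases hV p hp with rfl | ⟨q, hq, rfl⟩
    · exact hA.ge
    · change 0 ≤ h.A * Complex.normSq q + 2 * (starRingEnd ℂ h.b * q).re + h.C
      rw [hA, zero_mul, zero_add]
      exact h1 q hq)
  change 0 ≤ h.A * (Complex.normSq x.z + x.t ^ 2) + 2 * (starRingEnd ℂ h.b * x.z).re + h.C at this
  rw [hA, zero_mul, zero_add] at this
  linarith

/-- Points of the hull lie above the hemispheres that lie below the vertices. -/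
theorem le_of_mem_idealHull {V : Set Ideal3} {m : ℂ} {ρ : ℝ} (hρ : 0 < ρ)
    (hV : ∀ q, finPt q ∈ V → ρ ≤ dist q m ^ 2) {x : H3} (hx : x ∈ idealHull V) :
    ρ ≤ dist x.z m ^ 2 + x.t ^ 2 := by
  have hd : ∀ w : ℂ, dist w m ^ 2 = Complex.normSq w + 2 * (starRingEnd ℂ (-m) * w).re +
      Complex.normSq m := by
    intro w
    rw [dist_sq_complex, Complex.normSq_apply, Complex.normSq_apply]
    simp; ring
  have := hx ⟨1, -m, Complex.normSq m - ρ, by rw [Complex.normSq_neg]; linarith⟩ (by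
    intro p hp
    induction p using OnePoint.rec with
    | infty => exact zero_le_one (α := ℝ)
    | coe q =>
      change 0 ≤ 1 * Complex.normSq q + 2 * (starRingEnd ℂ (-m) * q).re + (Complex.normSq m - ρ)
      have := hV q hp
      rw [hd] at this
      linarith)
  change 0 ≤ 1 * (Complex.normSq x.z + x.t ^ 2) + 2 * (starRingEnd ℂ (-m) * x.z).re +
    (Complex.normSq m - ρ) at this
  rw [hd]
  linarith

/-! ### The standard tile and the horoballs centred elsewhere. -/

namespace TileType

theorem centre_mem_convexHull (τ : TileType) : τ.centre ∈ convexHull ℝ τ.corners := by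
  have mem : ∀ p ∈ τ.corners, p ∈ convexHull ℝ τ.corners := fun p hp => subset_convexHull ℝ _ hp
  cases τ
  · have := (convex_convexHull ℝ TileType.T.corners).sum_mem (t := Finset.univ)
      (w := ![1 / 3, 1 / 3, 1 / 3]) (z := ![0, 1, omega])
      (by simp [Fin.forall_fin_succ]) (by norm_num [Fin.sum_univ_succ])
      (by
        simp only [Finset.mem_univ, forall_const, Fin.forall_fin_succ]
        exact ⟨mem _ (by simp [corners]), mem _ (by simp [corners]), mem _ (by simp [corners]),
          by simp⟩)
    convert this using 1
    simp [Fin.sum_univ_succ, centre]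
    ring
  · have := (convex_convexHull ℝ TileType.O.corners) (mem 0 (by simp [corners]))
      (mem (1 + Complex.I) (by simp [corners])) (a := 1 / 2) (b := 1 / 2) (by norm_num)
      (by norm_num) (by norm_num)
    convert this using 1
    simp [centre]
    ring

theorem mem_std_finPt (τ : TileType) {q : ℂ} :
    finPt q ∈ τ.std ↔ q ∈ τ.corners ∨ (τ = .O ∧ q = τ.centre) := by
  have hinj : ∀ q q' : ℂ, finPt q = finPt q' ↔ q = q' := fun q q' => OnePoint.coe_injective.eq_iff
  have hinf : ∀ q : ℂ, finPt q ≠ inftyPt := OnePoint.coe_ne_infty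
  cases τ
  · simp only [std, stdTet, corners, mem_insert_iff, mem_singleton_iff, hinj, hinf, false_or]
    simp
  · simp only [std, stdOct, corners, mem_insert_iff, mem_singleton_iff, hinj, hinf, false_or,
      centre]
    simp only [true_and]
    tauto

theorem std_subset (τ : TileType) {p : Ideal3} (hp : p ∈ τ.std) :
    p = inftyPt ∨ ∃ q ∈ convexHull ℝ τ.corners, p = finPt q := by
  induction p using OnePoint.rec with
  | infty => exact Or.inl rfl
  | coe q =>
    right
    refine ⟨q, ?_, rfl⟩
    rcases τ.mem_std_finPt.1 hp with h | ⟨-, rfl⟩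
    · exact subset_convexHull ℝ _ h
    · exact τ.centre_mem_convexHull

theorem z_mem_of_mem_std (τ : TileType) {x : H3} (hx : x ∈ idealHull τ.std) :
    x.z ∈ convexHull ℝ τ.corners :=
  z_mem_of_mem_idealHull (τ.finite_corners.isClosed_convexHull ℝ) (convex_convexHull ℝ _)
    ⟨_, subset_convexHull ℝ _ τ.zero_mem_corners⟩ (fun _ => τ.std_subset) hx

theorem corner_horoball_mem (τ : TileType) {q : ℂ} (hq : q ∈ τ.corners) :
    horoball (finPt q) (1 / 2) ∈ τ.stdPacking := by
  cases τ
  · rcases hq with rfl | rfl | rfl <;> simp [stdPacking]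
  · rcases hq with rfl | rfl | rfl | rfl <;> simp [stdPacking]

/-- A finite combination of the defining inequalities on a quarter of a square. -/
theorem quarter_square_aux {l0 l1 l2 d t S : ℝ} (h1 : 0 ≤ l1)
    (hl : l0 + l1 + l2 = 1) (hS : S = l1 * l2 + l0 * (l1 + l2) / 2) (hd0 : 0 < d) (hd : d ≤ 1)
    (hSt : S ≤ t ^ 2) : 0 < d * (1 - l0 / 2) - S + t ^ 2 - t * d := by
  rcases lt_or_ge t (1 - l0 / 2) with hlt | hge
  · nlinarith
  -- Here the coefficient of `d` is nonpositive, so `d = 1` is the worst case. With `S ≤ (1 - l0 ^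
  -- 2) / 4` the expression is then at least `(t - 1/2) ^ 2 + ((1 - l0) ^ 2 + 1) / 4`.
  · have e1 : (1 - l0 / 2 - t) ≤ d * (1 - l0 / 2 - t) := by nlinarith
    have e2 : S ≤ (1 - l0 ^ 2) / 4 := by
      obtain rfl : l1 = 1 - l0 - l2 := by linarith
      rw [hS]; nlinarith [sq_nonneg (1 - l0 - l2 - l2)]
    nlinarith [sq_nonneg (t - 1 / 2), sq_nonneg (1 - l0)]

/-- The point `z` is in the triangle spanned by the centre `e` and a side `p q` of a unit square.
The barycentric formula for squared distances bounds `dist z ζ ^ 2` below by `d (1 - l0 / 2) - S`,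
with `S` the correction term. Applied to the midpoint of the side it gives `1/4 - S`, so being above
the hemisphere over the side means `S ≤ t ^ 2`. -/
theorem quarter_square {p q e ζ : ℂ} (hpq : dist p q ^ 2 = 1) (hpe : dist p e ^ 2 = 1 / 2)
    (hqe : dist q e ^ 2 = 1 / 2) {l0 l1 l2 d t : ℝ} (h0 : 0 ≤ l0) (h1 : 0 ≤ l1) (h2 : 0 ≤ l2)
    (hl : l0 + l1 + l2 = 1) (hd0 : 0 < d) (hd : d ≤ 1) (dp : d ≤ dist p ζ ^ 2)
    (dq : d ≤ dist q ζ ^ 2) (de : d / 2 ≤ dist e ζ ^ 2) {z : ℂ} (hz : z = l0 * e + l1 * p + l2 * q)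
    (hm : 1 / 4 ≤ dist z ((p + q) / 2) ^ 2 + t ^ 2) : 0 < dist z ζ ^ 2 + t ^ 2 - d * t := by
  have id1 : dist z ζ ^ 2 = l0 * dist e ζ ^ 2 + l1 * dist p ζ ^ 2 + l2 * dist q ζ ^ 2 -
      (l1 * l2 * dist p q ^ 2 + l0 * l1 * dist p e ^ 2 + l0 * l2 * dist q e ^ 2) := by
    obtain rfl : l0 = 1 - l1 - l2 := by linarith
    simp only [dist_sq_complex, hz]; simp; ring
  have id2 : dist z ((p + q) / 2) ^ 2 = l0 * (dist p e ^ 2 / 2 + dist q e ^ 2 / 2 -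
      dist p q ^ 2 / 4) + l1 * (dist p q ^ 2 / 4) + l2 * (dist p q ^ 2 / 4) -
      (l1 * l2 * dist p q ^ 2 + l0 * l1 * dist p e ^ 2 + l0 * l2 * dist q e ^ 2) := by
    obtain rfl : l0 = 1 - l1 - l2 := by linarith
    simp only [dist_sq_complex, hz]; simp; ring
  rw [hpq, hpe, hqe] at id1 id2
  have key := quarter_square_aux (t := t) h1 hl rfl hd0 hd (by nlinarith)
  have : l0 * (d / 2) + l1 * d + l2 * d ≤ l0 * dist e ζ ^ 2 + l1 * dist p ζ ^ 2 +
      l2 * dist q ζ ^ 2 := by gcongr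
  have e4 : l0 * (d / 2) + l1 * d + l2 * d = d * (1 - l0 / 2) := by
    obtain rfl : l0 = 1 - l1 - l2 := by linarith
    ring
  nlinarith

/-- The standard tile does not meet the horoballs disjoint from its packing. -/
theorem std_disjoint (τ : TileType) {ζ : ℂ} {r : ℝ} (hr : 0 < r)
    (h : ∀ B ∈ τ.stdPacking, Disjoint (interior B) (interior (horoball (finPt ζ) r))) :
    Disjoint (idealHull τ.std) (horoball (finPt ζ) r) := by
  refine Set.disjoint_left.2 fun x hx hxB => ?_
  have ht := x.t_pos
  have hz := τ.z_mem_of_mem_std hx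
  have hd1 := le_of_disjoint_infty hr (h _ τ.horoball_infty_mem)
  have hdq : ∀ q ∈ τ.corners, 2 * r ≤ dist q ζ ^ 2 := fun q hq => by
    have := le_of_disjoint (by norm_num) hr (h _ (τ.corner_horoball_mem hq))
    linarith
  rw [mem_horoball_finPt] at hxB
  cases τ
  -- The tetrahedron lies above the hemisphere through its three finite vertices. The affine
  -- comparison of the squared distances to the centre and to `ζ` turns this into `2 r ≤ dist x.z ζ
  -- ^ 2 + t ^ 2`, which excludes `t < 1`; larger `t` is excluded by `2 r ≤ 1`.
  · have h1 := le_of_mem_idealHull (m := TileType.T.centre) (ρ := 1 / 3) (by norm_num) (by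
      intro q hq
      rcases TileType.T.mem_std_finPt.1 hq with h | ⟨h, -⟩
      · rw [dist_centre_of_mem_corners _ h]; simp [radius]
      · exact absurd h (by simp)) hx
    have h2 := power_le_of_mem_convexHull (p := TileType.T.centre) (q := ζ) (k := 1 / 3 - 2 * r)
      hz (by
        intro q hq
        have := hdq q hq
        rw [dist_centre_of_mem_corners _ hq]
        simp only [radius, div_pow, Real.sq_sqrt (show (0 : ℝ) ≤ 3 by norm_num)]
        linarith)
    rcases lt_or_ge x.t 1 with h3 | h3
    · nlinarith
    · have h4 := sq_nonneg (dist x.z TileType.T.centre)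
      nlinarith
  · have hc : r ≤ dist TileType.O.centre ζ ^ 2 := by
      have := le_of_disjoint (by norm_num) hr
        (h (horoball (finPt ((1 + Complex.I) / 2)) (1 / 4)) (by simp [stdPacking]))
      simp only [centre]
      linarith
    have hx0 : 0 ≤ x.z.re ∧ x.z.re ≤ 1 ∧ 0 ≤ x.z.im ∧ x.z.im ≤ 1 := by
      refine ⟨?_, ?_, ?_, ?_⟩
      · refine convexHull_min (t := {z : ℂ | 0 ≤ z.re}) ?_
          (convex_halfSpace_re_ge 0) hz
        rintro p (rfl | rfl | rfl | rfl) <;> simp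
      · refine convexHull_min (t := {z : ℂ | z.re ≤ 1}) ?_
          (convex_halfSpace_re_le 1) hz
        rintro p (rfl | rfl | rfl | rfl) <;> simp
      · refine convexHull_min (t := {z : ℂ | 0 ≤ z.im}) ?_
          (convex_halfSpace_im_ge 0) hz
        rintro p (rfl | rfl | rfl | rfl) <;> simp
      · refine convexHull_min (t := {z : ℂ | z.im ≤ 1}) ?_
          (convex_halfSpace_im_le 1) hz
        rintro p (rfl | rfl | rfl | rfl) <;> simp
    obtain ⟨x0, x1, y0, y1⟩ := hx0
    -- The lower faces of the octahedron through the centre of the square lie on the hemispheres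
    -- having its sides as diameters.
    have hem : ∀ p ∈ TileType.O.corners, ∀ q ∈ TileType.O.corners, dist p q ^ 2 = 1 →
        1 / 4 ≤ dist x.z ((p + q) / 2) ^ 2 + x.t ^ 2 := by
      intro p hp q hq hpq
      refine le_of_mem_idealHull (by norm_num) (fun w hw => ?_) hx
      rw [UnitTiling.dist_midpoint_sq, hpq]
      rcases TileType.O.mem_std_finPt.1 hw with hw | ⟨-, rfl⟩
      · have far : ∀ a ∈ TileType.O.corners, ∀ b ∈ TileType.O.corners, a ≠ b →
            1 ≤ dist a b ^ 2 := by
          rintro a (rfl | rfl | rfl | rfl) b (rfl | rfl | rfl | rfl) hab <;>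
            first
            | exact absurd rfl hab
            | (rw [dist_sq_complex]; norm_num)
        by_cases h1 : w = p
        · rw [h1, hpq, dist_self]; norm_num
        · have := far w hw p hp h1
          have := sq_nonneg (dist w q)
          linarith
      · rw [dist_comm, dist_centre_of_mem_corners _ hp, dist_comm,
          dist_centre_of_mem_corners _ hq]
        norm_num [radius]
    have R2 : TileType.O.radius ^ 2 = 1 / 2 := by norm_num [radius]
    have fin : ∀ p ∈ TileType.O.corners, ∀ q ∈ TileType.O.corners, dist p q ^ 2 = 1 →
        ∀ l0 l1 l2 : ℝ, 0 ≤ l0 → 0 ≤ l1 → 0 ≤ l2 → l0 + l1 + l2 = 1 →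
        x.z ≠ l0 * TileType.O.centre + l1 * p + l2 * q := by
      intro p hp q hq hpq l0 l1 l2 h0 h1 h2 hl he
      have := quarter_square (t := x.t) hpq
        (by rw [dist_centre_of_mem_corners _ hp, R2])
        (by rw [dist_centre_of_mem_corners _ hq, R2]) h0 h1 h2 hl (d := 2 * r) (by positivity) hd1
        (hdq p hp) (hdq q hq) (by linarith) he (hem p hp q hq hpq)
      linarith
    -- The two diagonals cut the square into four triangles, each spanned by the centre and a side.
    rcases le_total x.z.im x.z.re with h1 | h1 <;> rcases le_total (x.z.re + x.z.im) 1 with h2 | h2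
    · refine fin 0 (by simp [corners]) 1 (by simp [corners]) (by simp) (2 * x.z.im)
        (1 - x.z.re - x.z.im) (x.z.re - x.z.im) (by linarith) (by linarith) (by linarith)
        (by ring) ?_
      apply Complex.ext <;> simp [centre] <;> ring
    · refine fin 1 (by simp [corners]) (1 + Complex.I) (by simp [corners]) (by simp)
        (2 * (1 - x.z.re)) (x.z.re - x.z.im) (x.z.re + x.z.im - 1) (by linarith) (by linarith)
        (by linarith) (by ring) ?_
      apply Complex.ext <;> simp [centre] <;> ring
    · refine fin Complex.I (by simp [corners]) 0 (by simp [corners]) (by simp)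
        (2 * x.z.re) (x.z.im - x.z.re) (1 - x.z.re - x.z.im) (by linarith) (by linarith)
        (by linarith) (by ring) ?_
      apply Complex.ext <;> simp [centre] <;> ring
    · refine fin (1 + Complex.I) (by simp [corners]) Complex.I (by simp [corners]) (by simp)
        (2 * (1 - x.z.im)) (x.z.re + x.z.im - 1) (x.z.im - x.z.re) (by linarith) (by linarith)
        (by linarith) (by ring) ?_
      apply Complex.ext <;> simp [centre] <;> ring

end TileType

/-- A tile does not meet a horoball that is not centred at one of its vertices, if this horoball
and those of the tile belong to a packing. -/
theorem IsRegular.disjoint_horoball {τ : TileType} {V : Set Ideal3} (h : IsRegular τ V)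
    {H : Set (Set H3)} (hH : IsPackingOn univ H)
    (hs : IsSymmetricPacking V {B ∈ H | ∃ p ∈ V, IsHoroballAt p B}) {B : Set H3} (hB : B ∈ H)
    {p : Ideal3} (hp : IsHoroballAt p B) (hpV : p ∉ V) : Disjoint (idealHull V) B := by
  obtain ⟨g, rfl⟩ := h
  obtain ⟨φ, hφ⟩ := exists_isExtension g
  have he := eq_image_stdPacking hφ hs
  have hB' := hφ.2.horoball p B hp
  have hne : g⁻¹ • p ∉ τ.std := fun hm => hpV ⟨_, hm, smul_inv_smul g p⟩
  obtain ⟨r, hr, hBr⟩ := hB'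
  have hBφ : B = φ '' (φ.symm '' B) := by rw [image_image]; simp
  rw [← hφ.image_idealHull, hBφ, Set.disjoint_image_iff φ.injective]
  generalize g⁻¹ • p = ζ at *
  induction ζ using OnePoint.rec with
  | infty => exact absurd τ.infty_mem_std hne
  | coe ζ =>
    rw [hBr]
    refine τ.std_disjoint hr fun A hA => ?_
    rw [← hBr, ← Set.disjoint_image_iff φ.injective, ← image_interior, ← image_interior, ← hBφ]
    have hA' : φ '' A ∈ {B ∈ H | ∃ q ∈ (fun p : Ideal3 => g • p) '' τ.std, IsHoroballAt q B} := by
      rw [he]; exact mem_image_of_mem _ hA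
    refine hH.2 _ hA'.1 _ hB ?_
    rintro heq
    obtain ⟨q, hq, hqB⟩ := hA'.2
    rw [heq] at hqB
    exact hpV (hp.centre_unique hqB ▸ hq)

/-- The cross-section of a tile with vertex `∞` at height `1`. -/
theorem crossSection_eq {τ : TileType} {V : Set Ideal3} {v : Set ℂ} {c : ℂ}
    (hv : IsUnitTile τ v c)
    (hV : ∀ p, p ∈ V ↔ p = inftyPt ∨ ∃ q, p = finPt q ∧ (q ∈ v ∨ (τ = .O ∧ q = c)))
    (hc : c ∈ convexHull ℝ v) :
    crossSection (horoball inftyPt 1) V = convexHull ℝ v := by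
  rw [crossSection, frontier_horoball_infty]
  apply Subset.antisymm
  · rintro _ ⟨x, ⟨hx, -⟩, rfl⟩
    refine z_mem_of_mem_idealHull (hv.finite.isClosed_convexHull ℝ) (convex_convexHull ℝ _)
      ⟨c, hc⟩ (fun p hp => ?_) hx
    rcases (hV p).1 hp with rfl | ⟨q, rfl, hq | ⟨-, rfl⟩⟩
    · exact Or.inl rfl
    · exact Or.inr ⟨q, subset_convexHull ℝ _ hq, rfl⟩
    · exact Or.inr ⟨q, hc, rfl⟩
  · intro z hz
    refine ⟨⟨z, 1, one_pos⟩, ⟨fun h hh => ?_, rfl⟩, rfl⟩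
    have hA : 0 ≤ h.A := hh ((hV _).2 (Or.inl rfl))
    have hq : ∀ q ∈ v, 0 ≤ h.A * Complex.normSq q + 2 * (starRingEnd ℂ h.b * q).re + h.C :=
      fun q hq => hh ((hV (finPt q)).2 (Or.inr ⟨q, rfl, Or.inl hq⟩))
    change 0 ≤ h.A * (Complex.normSq z + 1 ^ 2) + 2 * (starRingEnd ℂ h.b * z).re + h.C
    -- A half-space containing the vertices contains `∞`, so it is vertical or the exterior of a
    -- hemisphere. The vertical case is convexity. Otherwise, with `m` the centre of the hemisphere,
    -- some corner `p` has `dist p m ^ 2 ≤ dist z m ^ 2 + 1/2`, so the point over `z` at height `1`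
    -- is outside.
    rcases hA.eq_or_lt with h0 | hpos
    · rw [← h0] at hq ⊢
      simp only [zero_mul, zero_add] at hq ⊢
      refine convexHull_min (t := {w : ℂ | 0 ≤ 2 * (starRingEnd ℂ h.b * w).re + h.C}) hq ?_ hz
      intro x hx y hy a b ha hb hab
      simp only [mem_ofPred_eq] at *
      have e : 2 * (starRingEnd ℂ h.b * (a • x + b • y)).re + h.C =
          a * (2 * (starRingEnd ℂ h.b * x).re + h.C) +
          b * (2 * (starRingEnd ℂ h.b * y).re + h.C) := by
        obtain rfl : b = 1 - a := by linarith
        simp; ring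
      rw [e]; positivity
    · set m : ℂ := -h.b / h.A with hm
      have hd : ∀ w : ℂ, h.A * Complex.normSq w + 2 * (starRingEnd ℂ h.b * w).re + h.C =
          h.A * dist w m ^ 2 + (h.C - Complex.normSq h.b / h.A) := by
        intro w
        rw [dist_sq_complex, Complex.normSq_apply, Complex.normSq_apply, hm,
          Complex.div_ofReal_re, Complex.div_ofReal_im]
        simp
        field_simp
        ring
      obtain ⟨p, hp, hle⟩ := hv.exists_dist_sq_le hz m
      have h1 := hq p hp
      rw [hd] at h1
      have h2 := hd z
      have h3 := τ.radius_sq_le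
      nlinarith [sq_nonneg (dist z c)]

theorem IsUnitTile.centre_mem_convexHull {τ : TileType} {v : Set ℂ} {c : ℂ}
    (h : IsUnitTile τ v c) : c ∈ convexHull ℝ v := by
  obtain ⟨a, u, hu, rfl, rfl⟩ := h
  let f : ℂ →ᵃ[ℝ] ℂ := (LinearMap.mulLeft ℝ u).toAffineMap + AffineMap.const ℝ ℂ a
  have hf : (f : ℂ → ℂ) = fun ζ => a + u * ζ := funext fun ζ => by simp [f, add_comm]
  rw [← hf, ← f.image_convexHull, hf]
  exact mem_image_of_mem _ τ.centre_mem_convexHull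

/-- A tile with vertex `∞` is determined by a unit triangle or square. -/
theorem IsRegular.exists_unitTile {τ : TileType} {V : Set Ideal3} (h : IsRegular τ V)
    (hV : inftyPt ∈ V) {H : Set (Set H3)} (hH : IsPackingOn univ H)
    (hs : IsSymmetricPacking V {B ∈ H | ∃ p ∈ V, IsHoroballAt p B})
    (hB : horoball inftyPt 1 ∈ H) : ∃ v c, IsUnitTile τ v c ∧
      (∀ p, p ∈ V ↔ p = inftyPt ∨ ∃ q, p = finPt q ∧ (q ∈ v ∨ (τ = .O ∧ q = c))) ∧
      ∀ q ∈ v, horoball (finPt q) (1 / 2) ∈ H := by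
  obtain ⟨a, b, ha, rfl⟩ := h.exists_affine hV
  have he := eq_image_stdPacking (isExtension_affine a b ha) hs
  have hsub : ∀ A ∈ τ.stdPacking, H3.affineIso a b ha '' A ∈ H := fun A hA => by
    have : H3.affineIso a b ha '' A ∈ {B ∈ H | ∃ p ∈ (fun p : Ideal3 => affineGL a b ha • p) ''
        τ.std, IsHoroballAt p B} := by rw [he]; exact mem_image_of_mem _ hA
    exact this.1
  have hn := norm_pos_iff.2 ha
  have h1 := hsub _ τ.horoball_infty_mem
  rw [affineIso_image_horoball_infty, mul_one] at h1
  -- The similarity takes `t ≥ 1` to `t ≥ ‖a‖`, and the packing has only one horoball at `∞`.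
  have ha1 : ‖a‖ = 1 := by
    have heq : horoball inftyPt 1 = horoball inftyPt ‖a‖ := by
      by_contra hne
      exact not_disjoint_same_centre (p := inftyPt) ⟨1, one_pos, rfl⟩ ⟨_, hn, rfl⟩
        (hH.2 _ hB _ h1 hne)
    have e1 : (⟨0, 1, one_pos⟩ : H3) ∈ horoball inftyPt ‖a‖ := heq ▸ le_refl (1 : ℝ)
    have e2 : (⟨0, ‖a‖, hn⟩ : H3) ∈ horoball inftyPt 1 := heq ▸ le_refl ‖a‖
    exact le_antisymm e1 e2
  refine ⟨_, _, ⟨b, a, ha1, rfl, rfl⟩, fun p => ?_, ?_⟩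
  · constructor
    · rintro ⟨p, hp, rfl⟩
      induction p using OnePoint.rec with
      | infty => left; exact affineGL_smul_infty a b ha
      | coe q =>
        right
        refine ⟨_, affineGL_smul_coe a b ha q, ?_⟩
        rcases τ.mem_std_finPt.1 hp with h | ⟨h, rfl⟩
        · exact Or.inl ⟨q, h, add_comm _ _⟩
        · exact Or.inr ⟨h, add_comm _ _⟩
    · rintro (rfl | ⟨q, rfl, ⟨ζ, hζ, rfl⟩ | ⟨hO, rfl⟩⟩)
      · exact hV
      · exact ⟨finPt ζ, τ.mem_std_finPt.2 (Or.inl hζ), by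
          dsimp only; rw [affineGL_smul_coe, add_comm]⟩
      · exact ⟨finPt τ.centre, τ.mem_std_finPt.2 (Or.inr ⟨hO, rfl⟩), by
          dsimp only; rw [affineGL_smul_coe, add_comm]⟩
  · rintro _ ⟨ζ, hζ, rfl⟩
    have := hsub _ (τ.corner_horoball_mem hζ)
    rwa [affineIso_image_horoball_coe, ha1, one_mul, add_comm] at this

/-- The size of the horoball at `∞` in standard position. -/
theorem horoball_infty_mem_of_std {τ : TileType} {H : Set (Set H3)}
    (hs : IsSymmetricPacking τ.std {B ∈ H | ∃ p ∈ τ.std, IsHoroballAt p B}) :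
    horoball inftyPt 1 ∈ H := by
  have : horoball inftyPt 1 ∈ {B ∈ H | ∃ p ∈ τ.std, IsHoroballAt p B} := by
    rw [TileType.eq_stdPacking hs]; exact τ.horoball_infty_mem
  exact this.1

/-! ### Distances to horoballs -/

theorem H3.dist_vertical (z : ℂ) {s t : ℝ} (hs : 0 < s) (ht : 0 < t) (hst : t ≤ s) :
    dist (⟨z, t, ht⟩ : H3) ⟨z, s, hs⟩ = Real.log (s / t) := by
  have h0 : 0 ≤ Real.log (s / t) := Real.log_nonneg ((one_le_div₀ ht).2 hst)
  have hc : Real.cosh (dist (⟨z, t, ht⟩ : H3) ⟨z, s, hs⟩) = Real.cosh (Real.log (s / t)) := by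
    rw [H3.cosh_dist, Real.cosh_log (by positivity)]
    simp only [dist_self]
    field_simp
    ring
  have h1 := Real.cosh_le_cosh.1 hc.le
  have h2 := Real.cosh_le_cosh.1 hc.ge
  rw [abs_of_nonneg dist_nonneg, abs_of_nonneg h0] at h1 h2
  exact le_antisymm h1 h2

theorem H3.log_div_le_dist {x y : H3} (hxy : x.t ≤ y.t) : Real.log (y.t / x.t) ≤ dist x y := by
  have hx := x.t_pos
  have hy := y.t_pos
  rw [← H3.dist_vertical 0 hy hx hxy]
  have hc : Real.cosh (dist (⟨0, x.t, hx⟩ : H3) ⟨0, y.t, hy⟩) ≤ Real.cosh (dist x y) := by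
    rw [H3.cosh_dist, H3.cosh_dist]
    simp only [dist_self]
    gcongr
    positivity
  have := Real.cosh_le_cosh.1 hc
  rwa [abs_of_nonneg dist_nonneg, abs_of_nonneg dist_nonneg] at this

theorem infDist_horoball_infty {s : ℝ} (hs : 0 < s) (x : H3) :
    infDist x (horoball inftyPt s) = max 0 (Real.log (s / x.t)) := by
  have hx := x.t_pos
  have hne : (horoball inftyPt s).Nonempty := ⟨⟨0, s, hs⟩, le_refl s⟩
  apply le_antisymm
  · rcases le_total s x.t with h | h
    · rw [infDist_zero_of_mem (show x ∈ horoball inftyPt s from h)]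
      exact le_max_left _ _
    · refine le_max_of_le_right ?_
      rw [← H3.dist_vertical x.z hs hx h]
      exact infDist_le_dist_of_mem (mem_horoball_infty.2 le_rfl)
  · refine max_le infDist_nonneg ?_
    rw [le_infDist hne]
    intro y hy
    have hy' : s ≤ y.t := hy
    rcases le_total s x.t with h | h
    · exact (Real.log_nonpos (by positivity) ((div_le_one hx).2 h)).trans dist_nonneg
    · refine le_trans ?_ (H3.log_div_le_dist (h.trans hy'))
      gcongr

/-- The isometry `z ↦ 1 / (z - q)` takes the horoball to one at `∞`. -/
theorem infDist_horoball_finPt {q : ℂ} {r : ℝ} (hr : 0 < r) (x : H3) :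
    infDist x (horoball (finPt q) r) =
      max 0 (Real.log ((dist x.z q ^ 2 + x.t ^ 2) / (2 * r * x.t))) := by
  have hx := x.t_pos
  let ψ := (H3.affineIso 1 (-q) one_ne_zero).trans H3.invIso
  have h1 : ψ '' horoball (finPt q) r = horoball inftyPt (1 / (2 * r)) := by
    have : ψ '' horoball (finPt q) r =
        H3.invIso '' (H3.affineIso 1 (-q) one_ne_zero '' horoball (finPt q) r) := by
      rw [image_image]; rfl
    rw [this, affineIso_image_horoball_coe, norm_one, one_mul, one_mul, add_neg_cancel,
      invIso_image_horoball_zero hr]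
  rw [← infDist_image ψ.isometry, h1, infDist_horoball_infty (by positivity)]
  congr 2
  have : (ψ x).t = x.t / (dist x.z q ^ 2 + x.t ^ 2) := by
    change ‖(1 : ℂ)‖ * x.t / (Complex.normSq (1 * x.z + -q) + (‖(1 : ℂ)‖ * x.t) ^ 2) = _
    rw [norm_one, one_mul, one_mul, dist_eq_norm, Complex.sq_norm, sub_eq_add_neg]
  rw [this]
  have : 0 < dist x.z q ^ 2 + x.t ^ 2 := by positivity
  field_simp

/-- Comparing the two logarithms gives the exterior of the hemisphere of squared radius `2 r`. The
truncation at `0` does no harm: for `1 ≤ x.t` the right side holds because `2 * r ≤ 1`. -/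
theorem infDist_le_iff {q : ℂ} {r : ℝ} (hr : 0 < r) (hr1 : 2 * r ≤ 1) (x : H3) :
    infDist x (horoball inftyPt 1) ≤ infDist x (horoball (finPt q) r) ↔
      2 * r ≤ dist x.z q ^ 2 + x.t ^ 2 := by
  have hx := x.t_pos
  have hN : 0 < dist x.z q ^ 2 + x.t ^ 2 := by positivity
  rw [infDist_horoball_infty one_pos, infDist_horoball_finPt hr]
  have key : Real.log (1 / x.t) ≤ Real.log ((dist x.z q ^ 2 + x.t ^ 2) / (2 * r * x.t)) ↔
      2 * r ≤ dist x.z q ^ 2 + x.t ^ 2 := by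
    rw [Real.log_le_log_iff (by positivity) (by positivity), div_le_div_iff₀ hx (by positivity),
      one_mul, mul_le_mul_iff_left₀ hx]
  constructor
  · intro h
    rcases lt_or_ge x.t 1 with h1 | h1
    · have hpos : 0 < Real.log (1 / x.t) := Real.log_pos ((one_lt_div hx).2 h1)
      refine key.1 ?_
      rcases le_max_iff.1 ((le_max_right _ _).trans h) with h2 | h2
      · linarith
      · exact h2
    · nlinarith [sq_nonneg (dist x.z q)]
  · intro h
    exact max_le_max le_rfl (key.2 h)

theorem infDist_eq_iff {q : ℂ} {x : H3} (h : 1 ≤ dist x.z q ^ 2 + x.t ^ 2) :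
    infDist x (horoball (finPt q) (1 / 2)) = infDist x (horoball inftyPt 1) ↔
      dist x.z q ^ 2 + x.t ^ 2 = 1 := by
  have hx := x.t_pos
  have hN : 0 < dist x.z q ^ 2 + x.t ^ 2 := by positivity
  rw [infDist_horoball_infty one_pos, infDist_horoball_finPt (by norm_num), mul_one_div_cancel
    (two_ne_zero' ℝ), one_mul]
  constructor
  · intro he
    refine le_antisymm ?_ h
    have h2 := (le_max_right _ _).trans he.le
    rcases le_max_iff.1 h2 with h3 | h3
    · have h4 : (dist x.z q ^ 2 + x.t ^ 2) / x.t ≤ 1 := by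
        by_contra! hlt
        exact absurd (Real.log_pos hlt) (not_lt.2 h3)
      rw [div_le_one hx] at h4
      nlinarith [sq_nonneg (dist x.z q)]
    · rw [Real.log_le_log_iff (by positivity) (by positivity),
        div_le_div_iff_of_pos_right hx] at h3
      exact h3
  · intro he
    rw [he]

/-! ### The cell above the isometric spheres -/

/-- The exterior of the unit hemisphere with centre `q`. -/
def unitExterior (q : ℂ) : HalfSpace where
  A := 1
  b := -q
  C := Complex.normSq q - 1
  nondeg := by rw [Complex.normSq_neg]; linarith

theorem unitExterior_eval (q : ℂ) (x : H3) :
    (unitExterior q).eval x = dist x.z q ^ 2 + x.t ^ 2 - 1 := by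
  rw [dist_sq_complex]
  simp [HalfSpace.eval, unitExterior, Complex.normSq_apply]
  ring

/-- The region above all unit hemispheres with centres in `X`. -/
def cuspCell (X : Set ℂ) : Set H3 := {x | ∀ q ∈ X, 1 ≤ dist x.z q ^ 2 + x.t ^ 2}

/-- The part of the cell on the unit hemisphere with centre `q`. -/
def cuspFace (X : Set ℂ) (q : ℂ) : Set H3 := {x ∈ cuspCell X | dist x.z q ^ 2 + x.t ^ 2 = 1}

theorem cuspCell_eq (X : Set ℂ) : cuspCell X = ⋂ q ∈ X, (unitExterior q).carrier := by
  ext x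
  simp only [cuspCell, HalfSpace.carrier, mem_iInter, mem_ofPred_eq, unitExterior_eval, sub_nonneg]

theorem cuspCell_subset (X : Set ℂ) {q : ℂ} (hq : q ∈ X) :
    cuspCell X ⊆ (unitExterior q).carrier := by
  rw [cuspCell_eq]; exact biInter_subset_of_mem hq

theorem cuspFace_eq (X : Set ℂ) (q : ℂ) : cuspFace X q = cuspCell X ∩ (unitExterior q).plane := by
  ext x
  simp only [cuspFace, HalfSpace.plane, mem_inter_iff, mem_ofPred_eq, unitExterior_eval,
    sub_eq_zero]

theorem isClosed_cuspCell (X : Set ℂ) : IsClosed (cuspCell X) := by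
  rw [cuspCell_eq]
  exact isClosed_biInter fun q _ => isClosed_le continuous_const (unitExterior q).continuous_eval

theorem gConvex_cuspCell (X : Set ℂ) : GConvex (cuspCell X) := by
  rw [cuspCell_eq]
  intro x hx y hy w hd
  simp only [mem_iInter] at *
  exact fun q hq => (unitExterior q).gConvex_carrier x (hx q hq) y (hy q hq) w hd

theorem gConvex_cuspFace (X : Set ℂ) (q : ℂ) : GConvex (cuspFace X q) := by
  rw [cuspFace_eq]
  exact (gConvex_cuspCell X).inter (unitExterior q).gConvex_plane

theorem interior_cuspCell_nonempty (X : Set ℂ) : (interior (cuspCell X)).Nonempty := by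
  refine ⟨⟨0, 2, two_pos⟩, interior_maximal (t := {x : H3 | 1 < x.t}) ?_
    (isOpen_lt continuous_const H3.continuous_t) (show (1 : ℝ) < 2 by norm_num)⟩
  intro x hx q _
  have hx' : 1 < x.t := hx
  nlinarith [sq_nonneg (dist x.z q)]

theorem apex_mem_cuspFace (X : Set ℂ) (q : ℂ) : (⟨q, 1, one_pos⟩ : H3) ∈ cuspFace X q := by
  refine ⟨fun y _ => ?_, by simp⟩
  have := sq_nonneg (dist q y)
  simp only
  linarith

theorem apex_unique {X : Set ℂ} {q q' : ℂ}
    (h : (⟨q, 1, one_pos⟩ : H3) ∈ cuspFace X q') : q = q' := by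
  have := h.2
  simp only [one_pow, add_eq_right] at this
  exact dist_eq_zero.1 (pow_eq_zero_iff two_ne_zero |>.1 this)

theorem cuspFace_injective (X : Set ℂ) : Function.Injective (cuspFace X) := fun q _ he =>
  apex_unique (he ▸ apex_mem_cuspFace X q)

namespace UnitTiling

variable {ι : Type*} {X : Set ℂ} {τ : ι → TileType} {v : ι → Set ℂ} {c : ι → ℂ}

/-- Near a point only finitely many hemispheres matter, so a point strictly above all of them is
interior. A point on a hemisphere leaves the cell when it is lowered. -/
theorem frontier_cuspCell (h : UnitTiling X τ v c) :
    frontier (cuspCell X) = {x | x ∈ cuspCell X ∧ ∃ q ∈ X, dist x.z q ^ 2 + x.t ^ 2 = 1} := by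
  rw [(isClosed_cuspCell X).frontier_eq]
  ext x
  refine and_congr_right fun hx => ?_
  constructor
  · intro hint
    by_contra! hne
    apply hint
    set F := X ∩ ball x.z 2 with hF
    have hFfin : F.Finite := h.finite_inter_ball x.z 2
    refine interior_maximal (t := {y : H3 | dist y.z x.z < 1} ∩
      ⋂ q ∈ F, {y : H3 | 1 < dist y.z q ^ 2 + y.t ^ 2}) ?_ ?_ ?_
    · rintro y ⟨hy1, hy2⟩ q hq
      by_cases hqF : q ∈ F
      · exact le_of_lt (mem_iInter₂.1 hy2 q hqF)
      · have h1 : 2 ≤ dist q x.z := by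
          by_contra! hlt; exact hqF ⟨hq, hlt⟩
        have h2 : dist y.z x.z < 1 := hy1
        have h3 := dist_triangle_left q x.z y.z
        have h4 : 1 ≤ dist y.z q := by linarith
        nlinarith [sq_nonneg y.t]
    · have := H3.continuous_z
      have := H3.continuous_t
      refine (isOpen_lt (by fun_prop) continuous_const).inter
        (hFfin.isOpen_biInter fun q _ => isOpen_lt continuous_const (by fun_prop))
    · refine ⟨by simp, mem_iInter₂.2 fun q hq => ?_⟩
      exact lt_of_le_of_ne (hx q hq.1) (Ne.symm (hne q hq.1))
  · rintro ⟨q, hq, he⟩ hint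
    obtain ⟨y, hy, hyz, hyt⟩ := H3.exists_lower_mem hint
    have h1 := hy q hq
    rw [hyz] at h1
    have := y.t_pos
    nlinarith

theorem cuspFace_subset_frontier (h : UnitTiling X τ v c) {q : ℂ} (hq : q ∈ X) :
    cuspFace X q ⊆ frontier (cuspCell X) := by
  rw [h.frontier_cuspCell]
  exact fun x hx => ⟨hx.1, q, hq, hx.2⟩

/-- A convex subset of the boundary of the cell lies on a single hemisphere. -/
theorem exists_face_of_gConvex (h : UnitTiling X τ v c) {S : Set H3} (hne : S.Nonempty)
    (hS : S ⊆ frontier (cuspCell X)) (hconv : GConvex S) : ∃ q ∈ X, S ⊆ cuspFace X q := by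
  rw [h.frontier_cuspCell] at hS
  let I : H3 → Set ℂ := fun x => {q ∈ X | dist x.z q ^ 2 + x.t ^ 2 = 1}
  have hI : ∀ x, (I x).Finite := fun x => (h.finite_inter_ball x.z 1).subset fun q hq => by
    refine ⟨hq.1, ?_⟩
    have h1 := hq.2
    have h2 := x.t_pos
    rw [mem_ball, dist_comm, ← pow_lt_pow_iff_left₀ dist_nonneg zero_le_one two_ne_zero]
    nlinarith
  -- A point `x` of `S` on the fewest hemispheres is chosen. A hemisphere through the midpoint of
  -- `x` and `y` contains both, since they are on its exterior side; by minimality the midpoint lies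
  -- on all hemispheres through `x`, hence so does `y`.
  obtain ⟨x, hx, hmin⟩ : ∃ x ∈ S, ∀ y ∈ S, (I x).ncard ≤ (I y).ncard := by
    obtain ⟨x, hx⟩ := hne
    have := WellFounded.min_mem (wellFounded_lt (α := ℕ)) ((fun x => (I x).ncard) '' S)
      ⟨_, mem_image_of_mem _ hx⟩
    obtain ⟨y, hy, he⟩ := this
    refine ⟨y, hy, fun z hz => ?_⟩
    dsimp only at he
    rw [he]
    exact not_lt.1 (WellFounded.not_lt_min (wellFounded_lt (α := ℕ)) _
      (mem_image_of_mem (fun x => (I x).ncard) hz))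
  obtain ⟨hxc, q, hq, hxq⟩ := hS hx
  refine ⟨q, hq, fun y hy => ⟨(hS hy).1, ?_⟩⟩
  obtain ⟨w, hw1, hw2⟩ := H3.exists_midpoint x y
  have hwS : w ∈ S := hconv x hx y hy w (by rw [hw1, hw2]; ring)
  have hsub : ∀ p ∈ I w, p ∈ I x ∧ p ∈ I y := by
    intro p hp
    have e0 : (unitExterior p).eval w = 0 := by rw [unitExterior_eval, hp.2, sub_self]
    obtain ⟨e1, e2⟩ := (unitExterior p).eval_eq_zero_of_midpoint
      (cuspCell_subset X hp.1 hxc) (cuspCell_subset X hp.1 (hS hy).1) hw1 hw2 e0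
    rw [unitExterior_eval, sub_eq_zero] at e1 e2
    exact ⟨⟨hp.1, e1⟩, hp.1, e2⟩
  have heq : I w = I x :=
    eq_of_subset_of_ncard_le (fun p hp => (hsub p hp).1) (hmin w hwS) (hI x)
  have hqw : q ∈ I w := heq ▸ ⟨hq, hxq⟩
  exact (hsub q hqw).2.2

/-- Every convex subset of the boundary lies in one face, and no face contains another: the apex
above `q` is only on the face of `q`. -/
theorem sides_cuspCell (h : UnitTiling X τ v c) : sides (cuspCell X) = cuspFace X '' X := by
  have hface : ∀ q ∈ X, (cuspFace X q).Nonempty ∧ cuspFace X q ⊆ frontier (cuspCell X) ∧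
      GConvex (cuspFace X q) := fun q hq =>
    ⟨⟨_, apex_mem_cuspFace X q⟩, h.cuspFace_subset_frontier hq, gConvex_cuspFace X q⟩
  ext S
  constructor
  · rintro ⟨hS, hmax⟩
    obtain ⟨q, hq, hsub⟩ := h.exists_face_of_gConvex hS.1 hS.2.1 hS.2.2
    exact ⟨q, hq, (hmax (hface q hq) hsub).antisymm hsub⟩
  · rintro ⟨q, hq, rfl⟩
    refine ⟨hface q hq, fun S hS hsub => ?_⟩
    obtain ⟨q', hq', hsub'⟩ := h.exists_face_of_gConvex hS.1 hS.2.1 hS.2.2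
    have := apex_unique (hsub' (hsub (apex_mem_cuspFace X q)))
    rw [this]
    exact hsub'

theorem isConvexPolyhedron_cuspCell (h : UnitTiling X τ v c) :
    IsConvexPolyhedron (cuspCell X) where
  isClosed := isClosed_cuspCell X
  convex := gConvex_cuspCell X
  interior_nonempty := interior_cuspCell_nonempty X
  locallyFinite := by
    intro x
    refine ⟨H3.z ⁻¹' ball x.z 1, (isOpen_ball.preimage H3.continuous_z).mem_nhds
      (mem_ball_self one_pos), ?_⟩
    refine Set.Finite.of_finite_image (f := Subtype.val) ?_ Subtype.val_injective.injOn
    refine ((h.finite_inter_ball x.z 2).image (cuspFace X)).subset ?_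
    rintro _ ⟨⟨S, hS⟩, ⟨y, hy, hyx⟩, rfl⟩
    have hS' := hS
    rw [h.sides_cuspCell] at hS'
    obtain ⟨q, hq, rfl⟩ := hS'
    refine ⟨q, ⟨hq, ?_⟩, rfl⟩
    have h1 : dist y.z q ^ 2 + y.t ^ 2 = 1 := hy.2
    have h2 : dist y.z q ≤ 1 := by
      rw [← pow_le_pow_iff_left₀ dist_nonneg zero_le_one two_ne_zero]
      nlinarith [sq_nonneg y.t]
    have h3 : dist y.z x.z < 1 := hyx
    have h4 := dist_triangle_left q x.z y.z
    rw [mem_ball]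
    linarith

/-- On the unit hemisphere about `q` one has `t ^ 2 = 1 - dist z q ^ 2`, and being above the
hemisphere about `y` becomes `dist z q ≤ dist z y`. Every point of the cell lifts since its distance
to `q` is less than `1`. -/
theorem image_cuspFace (h : UnitTiling X τ v c) (q : ℂ) :
    H3.z '' cuspFace X q = planeVoronoiCell X q := by
  ext z
  constructor
  · rintro ⟨x, hx, rfl⟩ y hy
    have h1 := hx.1 y hy
    have h2 := hx.2
    rw [← pow_le_pow_iff_left₀ dist_nonneg dist_nonneg two_ne_zero]
    linarith
  · intro hz
    have h1 := h.dist_sq_le_of_mem_cell hz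
    have h0 : 0 < 1 - dist z q ^ 2 := by linarith
    have hs := Real.sq_sqrt h0.le
    refine ⟨⟨z, √(1 - dist z q ^ 2), Real.sqrt_pos.2 h0⟩, ⟨fun y hy => ?_, ?_⟩, rfl⟩
    · have := pow_le_pow_left₀ dist_nonneg (hz y hy) 2
      simp only
      rw [hs]; linarith
    · simp only
      rw [hs]; ring

/-- Two faces sharing more than a point project to adjacent cells, so their centres are the ends of
an edge and have distance `1`. At common points the normals are unit vectors with inner product `1 -
dist q q' ^ 2 / 2 = 1/2`. -/
theorem hasDihedralAngle_cuspCell (h : UnitTiling X τ v c) {q q' : ℂ} (hq : q ∈ X) (hq' : q' ∈ X)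
    (hne : q ≠ q') (hn : (cuspFace X q ∩ cuspFace X q').Nontrivial) :
    HasDihedralAngle (cuspCell X) (cuspFace X q) (cuspFace X q') (2 * Real.pi / 3) := by
  have hcell : (planeVoronoiCell X q ∩ planeVoronoiCell X q').Nontrivial := by
    obtain ⟨x, hx, y, hy, hxy⟩ := hn
    have hmem : ∀ w ∈ cuspFace X q ∩ cuspFace X q', w.z ∈ planeVoronoiCell X q ∩
        planeVoronoiCell X q' := fun w hw =>
      ⟨h.image_cuspFace q ▸ mem_image_of_mem _ hw.1, h.image_cuspFace q' ▸ mem_image_of_mem _ hw.2⟩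
    refine ⟨x.z, hmem x hx, y.z, hmem y hy, fun he => hxy (H3.ext he ?_)⟩
    have h1 := hx.1.2
    have h2 := hy.1.2
    rw [he] at h1
    have h3 := x.t_pos
    have h4 := y.t_pos
    rw [← sq_eq_sq₀ h3.le h4.le]
    linarith
  obtain ⟨i, j, hij, hi, hj⟩ := h.exists_ne_of_nontrivial hq hq' hcell
  have hd := h.dist_eq_one_of_mem_inter hij hi hj hne
  refine ⟨unitExterior q, unitExterior q', cuspCell_subset X hq, cuspCell_subset X hq',
    cuspFace_eq X q, cuspFace_eq X q', ?_⟩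
  rintro x ⟨hx, hx'⟩
  simp only [HalfSpace.plane, mem_ofPred_eq, unitExterior_eval, sub_eq_zero] at hx hx'
  have hnorm : ∀ p, dist x.z p ^ 2 + x.t ^ 2 = 1 → ‖(unitExterior p).normal x‖ = 1 := by
    intro p hp
    rw [← sq_eq_sq₀ (norm_nonneg _) zero_le_one, WithLp.prod_norm_sq_eq_of_L2]
    simp only [HalfSpace.normal, unitExterior, Complex.ofReal_one, one_mul, one_pow]
    rw [← sub_eq_add_neg, WithLp.toLp_fst, WithLp.toLp_snd, ← dist_eq_norm, Real.norm_eq_abs,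
      sq_abs, hp]
  have hin : inner ℝ ((unitExterior q).normal x) ((unitExterior q').normal x) = (1 / 2 : ℝ) := by
    rw [WithLp.prod_inner_apply]
    simp only [HalfSpace.normal, unitExterior, Complex.ofReal_one, one_mul]
    have hd2 : dist q q' ^ 2 = 1 := by rw [hd, one_pow]
    rw [dist_sq_complex] at hx hx' hd2
    rw [Complex.inner]
    simp
    linarith
  rw [InnerProductGeometry.angle, hin, hnorm q hx, hnorm q' hx', mul_one, div_one,
    ← Real.cos_pi_div_three, Real.arccos_cos (by positivity) (by linarith [Real.pi_pos])]
  ring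

end UnitTiling

/-! ### Unit tiles: centres and interiors -/

/-- The map `ζ ↦ a + u * ζ` as an affine map. -/
def unitAffine (a u : ℂ) : ℂ →ᵃ[ℝ] ℂ :=
  (LinearMap.mulLeft ℝ u).toAffineMap + AffineMap.const ℝ ℂ a

theorem coe_unitAffine (a u : ℂ) : (unitAffine a u : ℂ → ℂ) = fun ζ => a + u * ζ :=
  funext fun ζ => by simp [unitAffine, add_comm]

/-- The map `ζ ↦ a + u * ζ` as an isometry of the plane. -/
def unitIsometry (a : ℂ) {u : ℂ} (hu : ‖u‖ = 1) : ℂ ≃ᵢ ℂ :=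
  (rotation ⟨u, mem_sphere_zero_iff_norm.2 hu⟩).toIsometryEquiv.trans (IsometryEquiv.addLeft a)

theorem coe_unitIsometry (a : ℂ) {u : ℂ} (hu : ‖u‖ = 1) :
    (unitIsometry a hu : ℂ → ℂ) = fun ζ => a + u * ζ := rfl

theorem unitIsometry_image_convexHull (a : ℂ) {u : ℂ} (hu : ‖u‖ = 1) (s : Set ℂ) :
    unitIsometry a hu '' convexHull ℝ s = convexHull ℝ (unitIsometry a hu '' s) := by
  rw [coe_unitIsometry, ← coe_unitAffine]
  exact (unitAffine a u).image_convexHull s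

theorem TileType.centre_mem_interior (τ : TileType) :
    τ.centre ∈ interior (convexHull ℝ τ.corners) := by
  have mem : ∀ p ∈ τ.corners, p ∈ convexHull ℝ τ.corners := fun p hp => subset_convexHull ℝ _ hp
  have h3 : 0 < √3 := by positivity
  have h3' : √3 * √3 = 3 := Real.mul_self_sqrt (by norm_num)
  cases τ
  · refine interior_maximal (t := {z : ℂ | 0 < z.im} ∩ ({z : ℂ | 0 < z.re - z.im / √3} ∩
      {z : ℂ | 0 < 1 - z.re - z.im / √3})) ?_ ?_ ?_
    · rintro z ⟨h0, h1, h2⟩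
      simp only [mem_ofPred_eq] at h0 h1 h2
      have := (convex_convexHull ℝ TileType.T.corners).sum_mem (t := Finset.univ)
        (w := ![1 - z.re - z.im / √3, z.re - z.im / √3, 2 * z.im / √3]) (z := ![0, 1, omega])
        (by simp only [Finset.mem_univ, forall_const, Fin.forall_fin_succ]
            exact ⟨h2.le, h1.le, show 0 ≤ 2 * z.im / √3 by positivity, fun i => i.elim0⟩)
        (by simp [Fin.sum_univ_succ]; ring)
        (by
          simp only [Finset.mem_univ, forall_const, Fin.forall_fin_succ]
          exact ⟨mem _ (by simp [corners]), mem _ (by simp [corners]), mem _ (by simp [corners]),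
            by simp⟩)
      convert this using 1
      simp only [Fin.sum_univ_succ, Complex.real_smul]
      apply Complex.ext
      · simp
        ring
      · simp
        field_simp
    · refine (isOpen_lt ?_ ?_).inter ((isOpen_lt ?_ ?_).inter (isOpen_lt ?_ ?_)) <;> fun_prop
    · simp only [mem_inter_iff, mem_ofPred_eq, centre]
      norm_num
      field_simp
      norm_num
  · refine interior_maximal (t := ({z : ℂ | 0 < z.re} ∩ {z : ℂ | z.re < 1}) ∩
      ({z : ℂ | 0 < z.im} ∩ {z : ℂ | z.im < 1})) ?_ ?_ ?_
    · rintro z ⟨⟨h0, h1⟩, h2, h3⟩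
      simp only [mem_ofPred_eq] at h0 h1 h2 h3
      have e0 := (convex_convexHull ℝ TileType.O.corners) (mem 0 (by simp [corners]))
        (mem 1 (by simp [corners])) (a := 1 - z.re) (b := z.re) (by linarith) h0.le (by ring)
      have e1 := (convex_convexHull ℝ TileType.O.corners) (mem Complex.I (by simp [corners]))
        (mem (1 + Complex.I) (by simp [corners])) (a := 1 - z.re) (b := z.re) (by linarith) h0.le
        (by ring)
      have := (convex_convexHull ℝ TileType.O.corners) e0 e1 (a := 1 - z.im) (b := z.im)
        (by linarith) h2.le (by ring)
      convert this using 1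
      apply Complex.ext <;> simp <;> ring
    · refine ((isOpen_lt ?_ ?_).inter (isOpen_lt ?_ ?_)).inter
        ((isOpen_lt ?_ ?_).inter (isOpen_lt ?_ ?_)) <;> fun_prop
    · simp only [mem_inter_iff, mem_ofPred_eq, centre]
      norm_num

namespace IsUnitTile

variable {τ τ' : TileType} {v : Set ℂ} {c c' : ℂ}

theorem centre_mem_interior (h : IsUnitTile τ v c) : c ∈ interior (convexHull ℝ v) := by
  obtain ⟨a, u, hu, rfl, rfl⟩ := h
  rw [← coe_unitIsometry a hu, ← unitIsometry_image_convexHull,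
    show a + u * τ.centre = unitIsometry a hu τ.centre from rfl,
    ← IsometryEquiv.coe_toHomeomorph, ← Homeomorph.image_interior]
  exact mem_image_of_mem _ τ.centre_mem_interior

/-- `exists_dist_sq_le` at the other centre gives `R'² ≤ R² - dist c' c ^ 2` for the circumradii,
and symmetrically with the roles exchanged; adding the two leaves distance zero. -/
theorem centre_unique (h : IsUnitTile τ v c) (h' : IsUnitTile τ' v c') : c = c' := by
  obtain ⟨p, hp, h1⟩ := h.exists_dist_sq_le h'.centre_mem_convexHull c'
  obtain ⟨p', hp', h2⟩ := h'.exists_dist_sq_le h.centre_mem_convexHull c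
  rw [h'.dist_centre hp, dist_self] at h1
  rw [h.dist_centre hp', dist_self, dist_comm] at h2
  have : dist c' c ^ 2 = 0 := le_antisymm (by linarith) (sq_nonneg _)
  exact (dist_eq_zero.1 (pow_eq_zero_iff two_ne_zero |>.1 this)).symm

theorem type_unique (h : IsUnitTile τ v c) (h' : IsUnitTile τ' v c') : τ = τ' := by
  obtain rfl := h.centre_unique h'
  obtain ⟨p, hp⟩ := h.nonempty
  have := (h.dist_centre hp).symm.trans (h'.dist_centre hp)
  have := congrArg (· ^ 2) this
  cases τ <;> cases τ' <;> first | rfl | norm_num [TileType.radius] at this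

end IsUnitTile

/-! ### The tiles and horoballs around the cusp `∞` -/

theorem idealPlane_pair_infty {h : HalfSpace} {q : ℂ}
    (hsub : ({inftyPt, finPt q} : Set Ideal3) ⊆ h.idealPlane) : h.A = 0 ∧
      2 * (starRingEnd ℂ h.b * q).re + h.C = 0 := by
  have h1 : h.A = 0 := hsub (mem_insert _ _)
  have h2 : h.A * Complex.normSq q + 2 * (starRingEnd ℂ h.b * q).re + h.C = 0 :=
    hsub (mem_insert_of_mem _ rfl)
  rw [h1, zero_mul, zero_add] at h2
  exact ⟨h1, h2⟩

/-- The tiles `V i` of `P` with vertex `∞` are the tetrahedra and octahedra over the unit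
triangles and squares `v i` of a tiling of the plane, and the horoballs of the packing `H` centred
at `∞` and at their corners are of standard size. -/
structure CuspTiling (P : Set (Set Ideal3)) (H : Set (Set H3)) {ι : Type*} (X : Set ℂ)
    (τ : ι → TileType) (v : ι → Set ℂ) (c : ι → ℂ) (V : ι → Set Ideal3) : Prop extends
    UnitTiling X τ v c where
  packing : IsPackingOn univ H
  horoball_infty_mem : horoball inftyPt 1 ∈ H
  horoball_mem : ∀ q ∈ X, horoball (finPt q) (1 / 2) ∈ H
  range_eq : range V = {W ∈ P | inftyPt ∈ W}
  tile_injective : Function.Injective V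
  regular : ∀ i, IsRegular (τ i) (V i)
  mem_iff : ∀ i p, p ∈ V i ↔ p = inftyPt ∨ ∃ q, p = finPt q ∧ (q ∈ v i ∨ (τ i = .O ∧ q = c i))
  disjoint : ∀ W ∈ P, inftyPt ∉ W → Disjoint (idealHull W) (horoball inftyPt 1)

/-- The plane at height `1` is covered by tiles, and only those with vertex `∞` reach it, so their
cross-sections cover. The separation of the corners is disjointness of horoballs of radius `1/2`. A
tile is recovered from its corners because the centre and the type are determined by them. -/
theorem exists_cuspTiling {P : Set (Set Ideal3)} {H : Set (Set H3)} (hP : IsTiling P)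
    (hH : IsPackingOn univ H)
    (hs : ∀ V ∈ P, IsSymmetricPacking V {B ∈ H | ∃ p ∈ V, IsHoroballAt p B})
    (hB : horoball inftyPt 1 ∈ H) :
    ∃ (X : Set ℂ) (τ : {V ∈ P | inftyPt ∈ V} → TileType) (v : {V ∈ P | inftyPt ∈ V} → Set ℂ)
      (c : {V ∈ P | inftyPt ∈ V} → ℂ), CuspTiling P H X τ v c Subtype.val := by
  have hreg : ∀ i : {V ∈ P | inftyPt ∈ V}, ∃ τ, IsRegular τ i.1 := fun i => hP.regular _ i.2.1
  choose τ hτ using hreg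
  choose v c hv hV hm using fun i => (hτ i).exists_unitTile i.2.2 hH (hs _ i.2.1) hB
  have hdis : ∀ W ∈ P, inftyPt ∉ W → Disjoint (idealHull W) (horoball inftyPt 1) := by
    intro W hW hne
    obtain ⟨σ, hσ⟩ := hP.regular W hW
    exact hσ.disjoint_horoball hH (hs W hW) hB ⟨1, one_pos, rfl⟩ hne
  have hX : ∀ q ∈ ⋃ i, v i, horoball (finPt q) (1 / 2) ∈ H := by
    intro q hq
    obtain ⟨i, hi⟩ := mem_iUnion.1 hq
    exact hm i q hi
  refine ⟨⋃ i, v i, τ, v, c, ⟨hv, fun z => ?_, rfl, fun x hx y hy hxy => ?_, fun i j hij => ?_⟩,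
    hH, hB, hX, Subtype.range_coe, Subtype.val_injective, hτ, hV, hdis⟩
  · obtain ⟨W, hW, hz⟩ := mem_iUnion₂.1 (hP.covers ▸ mem_univ (⟨z, 1, one_pos⟩ : H3))
    have hinf : inftyPt ∈ W := by
      by_contra hne
      exact Set.disjoint_left.1 (hdis W hW hne) hz (le_refl (1 : ℝ))
    refine ⟨⟨W, hW, hinf⟩, ?_⟩
    rw [← crossSection_eq (hv _) (hV _) (hv _).centre_mem_convexHull, crossSection,
      frontier_horoball_infty]
    exact ⟨_, ⟨hz, rfl⟩, rfl⟩
  · have hne : horoball (finPt x) (1 / 2) ≠ horoball (finPt y) (1 / 2) := fun he =>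
      hxy (OnePoint.coe_injective (IsHoroballAt.centre_unique
        ⟨1 / 2, one_half_pos, rfl⟩ ⟨1 / 2, one_half_pos, he⟩))
    have := le_of_disjoint one_half_pos one_half_pos (hH.2 _ (hX x hx) _ (hX y hy) hne)
    rw [← pow_le_pow_iff_left₀ zero_le_one dist_nonneg two_ne_zero]
    linarith
  · have hvj := hv j
    rw [← hij] at hvj
    apply Subtype.ext
    ext p
    rw [hV, hV, (hv i).centre_unique hvj, (hv i).type_unique hvj, hij]

namespace CuspTiling

variable {P : Set (Set Ideal3)} {H : Set (Set H3)} {ι : Type*} {X : Set ℂ} {τ : ι → TileType}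
  {v : ι → Set ℂ} {c : ι → ℂ} {V : ι → Set Ideal3}

theorem exists_index (h : CuspTiling P H X τ v c V) {W : Set Ideal3} (hW : W ∈ P)
    (hinf : inftyPt ∈ W) : ∃ i, V i = W := by
  have : W ∈ range V := h.range_eq ▸ ⟨hW, hinf⟩
  exact this

theorem infty_mem (h : CuspTiling P H X τ v c V) (i : ι) : inftyPt ∈ V i :=
  (h.mem_iff i _).2 (Or.inl rfl)

theorem tile_mem (h : CuspTiling P H X τ v c V) (i : ι) : V i ∈ P := by
  have : V i ∈ {W ∈ P | inftyPt ∈ W} := h.range_eq ▸ mem_range_self i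
  exact this.1

theorem finPt_mem_iff (h : CuspTiling P H X τ v c V) (i : ι) (q : ℂ) :
    finPt q ∈ V i ↔ q ∈ v i ∨ (τ i = .O ∧ q = c i) := by
  rw [h.mem_iff]
  constructor
  · rintro (he | ⟨q', he, hq⟩)
    · exact absurd he (OnePoint.coe_ne_infty q)
    · rwa [OnePoint.coe_injective he]
  · exact fun hq => Or.inr ⟨q, rfl, hq⟩

theorem crossSection_tile (h : CuspTiling P H X τ v c V) (i : ι) :
    crossSection (horoball inftyPt 1) (V i) = convexHull ℝ (v i) :=
  crossSection_eq (h.tile i) (h.mem_iff i) (h.tile i).centre_mem_convexHull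

theorem peripheralTiling_eq (h : CuspTiling P H X τ v c V) :
    peripheralTiling P (horoball inftyPt 1) = range fun i => convexHull ℝ (v i) := by
  ext σ
  constructor
  · rintro ⟨hne, W, hW, rfl⟩
    have hinf : inftyPt ∈ W := by
      by_contra hinf
      obtain ⟨-, x, ⟨hx, hxB⟩, rfl⟩ := hne
      rw [frontier_horoball_infty] at hxB
      exact Set.disjoint_left.1 (h.disjoint W hW hinf) hx hxB.ge
    obtain ⟨i, rfl⟩ := h.exists_index hW hinf
    exact ⟨i, (h.crossSection_tile i).symm⟩
  · rintro ⟨i, rfl⟩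
    exact ⟨⟨_, (h.tile i).centre_mem_convexHull⟩, V i, h.tile_mem i, (h.crossSection_tile i).symm⟩

theorem centre_notMem (h : CuspTiling P H X τ v c V) (i : ι) : c i ∉ X := fun hc => by
  have h1 := h.mem_of_dist_centre_le hc (by rw [dist_self]; exact (τ i).radius_pos.le)
  have h2 := (h.tile i).dist_centre h1
  rw [dist_self] at h2
  exact (τ i).radius_pos.ne h2

theorem pair_mem_edges (h : CuspTiling P H X τ v c V) {q : ℂ} (hq : q ∈ X) :
    {inftyPt, finPt q} ∈ edges P := by
  refine ⟨ncard_pair (OnePoint.infty_ne_coe q), ?_⟩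
  have hq' := hq
  rw [h.vertices] at hq'
  obtain ⟨i, hi⟩ := mem_iUnion.1 hq'
  have hne : c i - q ≠ 0 := sub_ne_zero.2 fun he => h.centre_notMem i (he ▸ hq)
  -- The vertical plane through `q` perpendicular to the direction of the centre; its defining
  -- function has value `dist p q ^ 2` at a corner `p`.
  let k : HalfSpace := ⟨0, c i - q, -(2 * (starRingEnd ℂ (c i - q) * q).re), by
    rw [zero_mul]; exact Complex.normSq_pos.2 hne⟩
  have hk : ∀ p, k.idealEval (finPt p) = dist p q ^ 2 + dist q (c i) ^ 2 - dist p (c i) ^ 2 := by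
    intro p
    change 0 * Complex.normSq p + 2 * (starRingEnd ℂ (c i - q) * p).re +
      -(2 * (starRingEnd ℂ (c i - q) * q).re) = _
    simp only [dist_sq_complex]
    simp
    ring
  have hv : ∀ p ∈ v i, k.idealEval (finPt p) = dist p q ^ 2 := fun p hp => by
    rw [hk, (h.tile i).dist_centre hp, (h.tile i).dist_centre hi, add_sub_cancel_right]
  have hc : 0 < k.idealEval (finPt (c i)) := by
    have : 0 < dist (c i) q := dist_pos.2 (sub_ne_zero.1 hne)
    rw [hk, dist_self, dist_comm q]
    nlinarith
  refine ⟨V i, h.tile_mem i, k, fun p hp => ?_, Subset.antisymm ?_ ?_⟩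
  · induction p using OnePoint.rec with
    | infty => exact le_refl (0 : ℝ)
    | coe p =>
      rcases (h.finPt_mem_iff i p).1 hp with hp | ⟨-, rfl⟩
      · exact (sq_nonneg (dist p q)).trans_eq (hv p hp).symm
      · exact hc.le
  · rintro p (rfl | rfl)
    · exact ⟨h.infty_mem i, rfl⟩
    · refine ⟨(h.finPt_mem_iff i q).2 (Or.inl hi), ?_⟩
      change k.idealEval (finPt q) = 0
      rw [hv q hi, dist_self]; ring
  · rintro p ⟨hp, hp0⟩
    induction p using OnePoint.rec with
    | infty => exact mem_insert _ _
    | coe p =>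
      have hp0' : k.idealEval (finPt p) = 0 := hp0
      rcases (h.finPt_mem_iff i p).1 hp with hp | ⟨-, rfl⟩
      · rw [hv p hp] at hp0'
        rw [dist_eq_zero.1 (pow_eq_zero_iff two_ne_zero |>.1 hp0')]
        exact mem_insert_of_mem _ rfl
      · exact absurd hp0' hc.ne'

theorem mem_of_pair_mem_edges (h : CuspTiling P H X τ v c V) {q : ℂ}
    (hq : {inftyPt, finPt q} ∈ edges P) : q ∈ X := by
  obtain ⟨-, W, hW, k, hsub, he⟩ := hq
  have hle : ({inftyPt, finPt q} : Set Ideal3) ⊆ W ∩ k.idealPlane := he.subset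
  obtain ⟨i, rfl⟩ := h.exists_index hW (hle (mem_insert _ _)).1
  have hqi : finPt q ∈ V i := (hle (mem_insert_of_mem _ rfl)).1
  rcases (h.finPt_mem_iff i q).1 hqi with hq | ⟨-, rfl⟩
  · exact h.subset i hq
  -- The other possible end is the centre of a square, whose vertical line is a diagonal of the
  -- octahedron. A supporting plane meeting the vertices only in this pair would be vertical and
  -- positive at all corners, hence positive at the centre.
  · exfalso
    obtain ⟨hA, h0⟩ := idealPlane_pair_infty (hle.trans inter_subset_right)
    have hev : ∀ p, k.idealEval (finPt p) = 2 * (starRingEnd ℂ k.b * p).re + k.C := fun p => by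
      change k.A * Complex.normSq p + 2 * (starRingEnd ℂ k.b * p).re + k.C = _
      rw [hA, zero_mul, zero_add]
    have hpos : ∀ p ∈ v i, 0 < 2 * (starRingEnd ℂ k.b * p).re + k.C := by
      intro p hp
      have hpV := (h.finPt_mem_iff i p).2 (Or.inl hp)
      have hge : 0 ≤ k.idealEval (finPt p) := hsub hpV
      rw [← hev]
      refine lt_of_le_of_ne hge fun heq => ?_
      have : finPt p ∈ ({inftyPt, finPt (c i)} : Set Ideal3) := he ▸ ⟨hpV, heq.symm⟩
      rcases this with hp' | hp'
      · exact OnePoint.coe_ne_infty p hp'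
      · exact h.centre_notMem i (OnePoint.coe_injective hp' ▸ h.subset i hp)
    have hconv : Convex ℝ {p : ℂ | 0 < 2 * (starRingEnd ℂ k.b * p).re + k.C} := by
      intro x hx y hy a b ha hb hab
      simp only [mem_ofPred_eq] at *
      have hlin : 2 * (starRingEnd ℂ k.b * (a • x + b • y)).re + k.C =
          a * (2 * (starRingEnd ℂ k.b * x).re + k.C) +
            b * (2 * (starRingEnd ℂ k.b * y).re + k.C) := by
        obtain rfl : b = 1 - a := by linarith
        simp
        ring
      rw [hlin]
      rcases ha.eq_or_lt with rfl | ha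
      · obtain rfl : b = 1 := by linarith
        linarith
      · nlinarith [mul_pos ha hx]
    have := convexHull_min hpos hconv (h.tile i).centre_mem_convexHull
    exact (ne_of_gt this) h0

theorem edges_infty (h : CuspTiling P H X τ v c V) :
    {e ∈ edges P | inftyPt ∈ e} = (fun q => {inftyPt, finPt q}) '' X := by
  ext e
  constructor
  · rintro ⟨he, hinf⟩
    obtain ⟨p, q, hpq, rfl⟩ := ncard_eq_two.1 he.1
    have key : ∀ p : Ideal3, inftyPt ≠ p → {inftyPt, p} ∈ edges P →
        {inftyPt, p} ∈ (fun q => ({inftyPt, finPt q} : Set Ideal3)) '' X := by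
      intro p hp hpe
      induction p using OnePoint.rec with
      | infty => exact absurd rfl hp
      | coe q => exact ⟨q, h.mem_of_pair_mem_edges hpe, rfl⟩
    rcases hinf with rfl | rfl
    · exact key q hpq he
    · rw [pair_comm] at he ⊢
      exact key p hpq.symm he
  · rintro ⟨q, hq, rfl⟩
    exact ⟨h.pair_mem_edges hq, mem_insert _ _⟩

theorem eq_of_isHoroballAt (h : CuspTiling P H X τ v c V) {p : Ideal3} {B B' : Set H3}
    (hB : B ∈ H) (hB' : B' ∈ H) (hp : IsHoroballAt p B) (hp' : IsHoroballAt p B') : B = B' := by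
  by_contra hne
  exact not_disjoint_same_centre hp hp' (h.packing.2 _ hB _ hB' hne)

/-- For `q` outside `X`, in a tile with centre `c` and circumradius `R`, disjointness from the
corner horoballs gives `2 r ≤ dist p q ^ 2` at the corners. Some corner then yields `2 r ≤ dist q c
^ 2 + R²`, and another one `1 ≤ dist x.z q ^ 2 + t ^ 2 - dist q c ^ 2 + R²`; as `2 R² ≤ 1`, adding
them suffices. -/
theorem horoball_size_le (h : CuspTiling P H X τ v c V) {q : ℂ} {r : ℝ} (hr : 0 < r)
    (hqr : horoball (finPt q) r ∈ H) {x : H3} (hx : x ∈ cuspCell X) :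
    2 * r ≤ dist x.z q ^ 2 + x.t ^ 2 := by
  by_cases hq : q ∈ X
  · have he := h.eq_of_isHoroballAt hqr (h.horoball_mem q hq) ⟨r, hr, rfl⟩
      ⟨_, one_half_pos, rfl⟩
    have h1 : (⟨q, 2 * r, by positivity⟩ : H3) ∈ horoball (finPt q) (1 / 2) := by
      rw [← he, mem_horoball_finPt]
      simp only [dist_self]
      nlinarith
    rw [mem_horoball_finPt] at h1
    simp only [dist_self] at h1
    have := hx q hq
    nlinarith
  · obtain ⟨i, hi⟩ := h.cover q
    have hsize : ∀ p ∈ v i, 2 * r ≤ dist p q ^ 2 := by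
      intro p hp
      have hpX := h.subset i hp
      have hne : horoball (finPt p) (1 / 2) ≠ horoball (finPt q) r := fun he =>
        hq (OnePoint.coe_injective (IsHoroballAt.centre_unique
          ⟨1 / 2, one_half_pos, rfl⟩ ⟨r, hr, he⟩) ▸ hpX)
      have := le_of_disjoint one_half_pos hr
        (h.packing.2 _ (h.horoball_mem p hpX) _ hqr hne)
      linarith
    obtain ⟨p, hp, h1⟩ := (h.tile i).exists_dist_sq_le (h.tile i).centre_mem_convexHull q
    obtain ⟨p', hp', h2⟩ := (h.tile i).exists_dist_sq_le hi x.z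
    have h3 := hsize p hp
    have h4 := hx p' (h.subset i hp')
    have h5 := (τ i).radius_sq_le
    rw [dist_self] at h1
    rw [dist_comm p', dist_comm q x.z] at h2
    rw [dist_comm (c i)] at h1
    linarith

theorem voronoiCell_eq (h : CuspTiling P H X τ v c V) :
    voronoiCell H (horoball inftyPt 1) = cuspCell X := by
  ext x
  constructor
  · intro hx q hq
    have := (infDist_le_iff one_half_pos (by norm_num) x).1 (hx _ (h.horoball_mem q hq))
    linarith
  · intro hx B' hB'
    obtain ⟨p, -, hp⟩ := h.packing.1 B' hB'
    induction p using OnePoint.rec with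
    | infty =>
      rw [h.eq_of_isHoroballAt h.horoball_infty_mem hB' ⟨1, one_pos, rfl⟩ hp]
    | coe q =>
      obtain ⟨r, hr, rfl⟩ := hp
      have hne : horoball inftyPt 1 ≠ horoball (finPt q) r := fun he =>
        OnePoint.infty_ne_coe q (IsHoroballAt.centre_unique ⟨1, one_pos, rfl⟩ ⟨r, hr, he⟩)
      have h1 := le_of_disjoint_infty hr (h.packing.2 _ h.horoball_infty_mem _ hB' hne)
      exact (infDist_le_iff hr h1 x).2 (h.horoball_size_le hr hB' hx)

theorem edgeFace_eq (h : CuspTiling P H X τ v c V) {q : ℂ} (hq : q ∈ X) :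
    edgeFace H (horoball inftyPt 1) {inftyPt, finPt q} = cuspFace X q := by
  rw [edgeFace, h.voronoiCell_eq]
  ext x
  refine and_congr_right fun hx => ?_
  rw [← infDist_eq_iff (hx q hq)]
  constructor
  · intro he
    exact he _ (h.horoball_mem q hq) ⟨_, mem_insert_of_mem _ rfl, _, one_half_pos, rfl⟩
  · rintro he B' hB' ⟨p, rfl | rfl, hp⟩
    · rw [h.eq_of_isHoroballAt hB' h.horoball_infty_mem hp ⟨1, one_pos, rfl⟩]
    · rw [h.eq_of_isHoroballAt hB' (h.horoball_mem q hq) hp ⟨_, one_half_pos, rfl⟩, he]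

theorem bijOn_edgeFace (h : CuspTiling P H X τ v c V) :
    BijOn (edgeFace H (horoball inftyPt 1)) {e ∈ edges P | inftyPt ∈ e} (sides (cuspCell X)) := by
  rw [h.edges_infty, h.sides_cuspCell]
  refine ⟨?_, ?_, ?_⟩
  · rintro _ ⟨q, hq, rfl⟩
    exact ⟨q, hq, (h.edgeFace_eq hq).symm⟩
  · rintro _ ⟨q, hq, rfl⟩ _ ⟨q', hq', rfl⟩ he
    simp only [h.edgeFace_eq hq, h.edgeFace_eq hq'] at he
    rw [cuspFace_injective X he]
  · rintro _ ⟨q, hq, rfl⟩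
    exact ⟨_, mem_image_of_mem _ hq, h.edgeFace_eq hq⟩

theorem idealHull_pair_inter_frontier (h : CuspTiling P H X τ v c V) {q : ℂ} (hq : q ∈ X) :
    idealHull {inftyPt, finPt q} ∩ frontier (cuspCell X) = {⟨q, 1, one_pos⟩} := by
  apply Subset.antisymm
  · rintro x ⟨hx, hxf⟩
    have hz : x.z = q := by
      refine z_mem_of_mem_idealHull (K := {q}) isClosed_singleton (convex_singleton q)
        (singleton_nonempty q) ?_ hx
      rintro p (rfl | rfl)
      · exact Or.inl rfl
      · exact Or.inr ⟨q, rfl, rfl⟩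
    rw [h.frontier_cuspCell] at hxf
    obtain ⟨hxc, q', -, he⟩ := hxf
    have h1 := hxc q hq
    have ht := x.t_pos
    rw [hz, dist_self] at h1
    refine H3.ext hz (le_antisymm ?_ ?_)
    · change x.t ≤ 1
      nlinarith [sq_nonneg (dist x.z q')]
    · change 1 ≤ x.t
      nlinarith
  · rintro _ rfl
    refine ⟨fun k hk => ?_, h.cuspFace_subset_frontier hq (apex_mem_cuspFace X q)⟩
    have h1 : 0 ≤ k.A := hk (mem_insert _ _)
    have h2 : 0 ≤ k.A * Complex.normSq q + 2 * (starRingEnd ℂ k.b * q).re + k.C :=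
      hk (mem_insert_of_mem _ rfl)
    change 0 ≤ k.A * (Complex.normSq q + 1 ^ 2) + 2 * (starRingEnd ℂ k.b * q).re + k.C
    linarith

theorem finPt_mem_iff_of_mem (h : CuspTiling P H X τ v c V) (i : ι) {q : ℂ} (hq : q ∈ X) :
    finPt q ∈ V i ↔ q ∈ v i := by
  rw [h.finPt_mem_iff]
  exact ⟨fun hi => hi.resolve_right fun hc => h.centre_notMem i (hc.2 ▸ hq), Or.inl⟩

/-- The lower vertex of an octahedron is over the centre of its square, which is neither in `X` nor
the centre of another tile. So different tiles share only `∞` and common corners. -/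
theorem tile_inter (h : CuspTiling P H X τ v c V) {i j : ι} (hij : i ≠ j) :
    V i ∩ V j = insert inftyPt (finPt '' (v i ∩ v j)) := by
  ext p
  induction p using OnePoint.rec with
  | infty => simp [h.infty_mem]
  | coe p =>
    have hr : ((p : OnePoint ℂ) ∈ insert inftyPt (finPt '' (v i ∩ v j))) ↔ p ∈ v i ∩ v j := by
      constructor
      · rintro (he | ⟨p', hp', he⟩)
        · exact absurd he (OnePoint.coe_ne_infty p)
        · exact OnePoint.coe_injective he ▸ hp'
      · exact fun hp => Or.inr ⟨p, hp, rfl⟩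
    rw [hr]
    constructor
    · rintro ⟨h1, h2⟩
      rcases (h.finPt_mem_iff i p).1 h1 with h1' | ⟨-, h1'⟩
      · exact ⟨h1', (h.finPt_mem_iff_of_mem j (h.subset i h1')).1 h2⟩
      · rcases (h.finPt_mem_iff j p).1 h2 with h2' | ⟨-, h2'⟩
        · exact absurd (h1' ▸ h.subset j h2') (h.centre_notMem i)
        · exact absurd (h.centre_injective (h1'.symm.trans h2')) hij
    · rintro ⟨h1, h2⟩
      exact ⟨(h.finPt_mem_iff i p).2 (Or.inl h1), (h.finPt_mem_iff j p).2 (Or.inl h2)⟩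

theorem exists_isFaceOfType (h : CuspTiling P H X τ v c V) {q : ℂ} (hq : q ∈ X) :
    ∃ w ∈ faceWords, IsFaceOfType P (horoball inftyPt 1) q (cuspFace X q) w := by
  obtain ⟨w, hw, u, j, hu, hj, hrange, hτ, hadj, hc⟩ := h.exists_cycle hq
  have hφ : ∀ k, unitIsometry q hu (tileCentre w k) = c (j k) := fun k => (hc k).symm
  refine ⟨w, hw, fun k => V (j k), unitIsometry q hu, h.tile_injective.comp hj, ?_, fun k => ?_,
    fun k => ?_, ?_, fun k => ?_, ?_⟩
  · ext W
    constructor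
    · rintro ⟨k, rfl⟩
      have : j k ∈ {i | q ∈ v i} := hrange ▸ mem_range_self k
      exact ⟨h.tile_mem _, h.infty_mem _, (h.finPt_mem_iff_of_mem _ hq).2 this⟩
    · rintro ⟨hW, hinf, hqW⟩
      obtain ⟨i, rfl⟩ := h.exists_index hW hinf
      have : i ∈ range j := hrange ▸ (h.finPt_mem_iff_of_mem i hq).1 hqW
      obtain ⟨k, rfl⟩ := this
      exact ⟨k, rfl⟩
  · rw [← hτ k]; exact h.regular _
  · obtain ⟨hne, r, hr, he⟩ := hadj k
    refine ⟨r, hr, ?_⟩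
    rw [h.tile_inter hne, he, image_pair]
  · change q + u * 0 = q
    rw [mul_zero, add_zero]
  · rw [hφ, h.crossSection_tile]
    exact (h.tile _).centre_mem_interior
  · rw [h.image_cuspFace, h.cell_eq_convexHull hq, modelFace, unitIsometry_image_convexHull,
      ← range_comp, ← hrange, ← range_comp]
    congr 1
    exact congrArg range (funext fun k => (hφ k).symm)

end CuspTiling

end MixedPlatonic

end

/-! ### The theorem, read off from the tiling at the cusp. -/

theorem mainTheorem12 (Γ : Subgroup (H3 ≃ᵢ H3)) (P : Set (Set Ideal3)) (H : Set (Set H3))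
    (B : Set H3) (hP : IsMixedPlatonic Γ P) (hstd : InStandardPosition P)
    (hH : IsAssociatedPacking Γ P H) (hB : B ∈ H) (hBinf : IsHoroballAt inftyPt B) :
    -- the Voronoi cell is a convex polyhedron
    IsConvexPolyhedron (voronoiCell H B) ∧
    -- its sides correspond bijectively to the edges ending at infinity
    Set.BijOn (edgeFace H B) {e ∈ edges P | inftyPt ∈ e} (sides (voronoiCell H B)) ∧
    -- and each such edge crosses the boundary of the cell once, in the corresponding side
    (∀ e ∈ edges P, inftyPt ∈ e →
      ∃ x ∈ edgeFace H B e, idealHull e ∩ frontier (voronoiCell H B) = {x}) ∧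
    -- sides that meet along an edge do so at an angle of two thirds of pi
    (∀ F ∈ sides (voronoiCell H B), ∀ F' ∈ sides (voronoiCell H B), F ≠ F' →
      (F ∩ F').Nontrivial → HasDihedralAngle (voronoiCell H B) F F' (2 * Real.pi / 3)) ∧
    -- the vertical projections of the sides are the Voronoi cells of the vertices of the
    -- peripheral tiling
    (∀ q : ℂ, {inftyPt, finPt q} ∈ edges P →
      H3.z '' edgeFace H B {inftyPt, finPt q} =
        planeVoronoiCell (tilingVertices (peripheralTiling P B)) q) ∧
    (fun F : Set H3 => H3.z '' F) '' sides (voronoiCell H B) =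
      planeVoronoi (tilingVertices (peripheralTiling P B)) ∧
    -- they form a tiling of the plane dual to the peripheral tiling
    IsPlaneTiling (planeVoronoi (tilingVertices (peripheralTiling P B))) ∧
    IsDualTiling (peripheralTiling P B)
      (planeVoronoi (tilingVertices (peripheralTiling P B))) ∧
    -- each side is of one of the four types
    (∀ q : ℂ, {inftyPt, finPt q} ∈ edges P →
      ∃ w ∈ faceWords, IsFaceOfType P B q (edgeFace H B {inftyPt, finPt q}) w) := by
  obtain ⟨σ, hσ⟩ := hstd
  have hmem : horoball inftyPt 1 ∈ H := horoball_infty_mem_of_std (hH.symmetric _ hσ)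
  obtain ⟨X, τ, v, c, h⟩ := exists_cuspTiling hP.tiling hH.packing hH.symmetric hmem
  -- Only one horoball of the packing is centred at `∞`, so `B` is `t ≥ 1`.
  obtain rfl := h.eq_of_isHoroballAt hB hmem hBinf ⟨1, one_pos, rfl⟩
  rw [h.voronoiCell_eq, h.peripheralTiling_eq, h.tilingVertices_range]
  refine ⟨h.isConvexPolyhedron_cuspCell, h.bijOn_edgeFace, fun e he hinf => ?_, ?_, fun q hq => ?_,
    ?_, h.isPlaneTiling_voronoi, h.isDualTiling_voronoi, fun q hq => ?_⟩
  · have : e ∈ {e ∈ edges P | inftyPt ∈ e} := ⟨he, hinf⟩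
    rw [h.edges_infty] at this
    obtain ⟨q, hq, rfl⟩ := this
    refine ⟨⟨q, 1, one_pos⟩, ?_, h.idealHull_pair_inter_frontier hq⟩
    rw [h.edgeFace_eq hq]
    exact apex_mem_cuspFace X q
  · rw [h.sides_cuspCell]
    rintro _ ⟨q, hq, rfl⟩ _ ⟨q', hq', rfl⟩ hne hn
    exact h.hasDihedralAngle_cuspCell hq hq' (fun he => hne (he ▸ rfl)) hn
  · rw [h.edgeFace_eq (h.mem_of_pair_mem_edges hq), h.image_cuspFace]
  · rw [h.sides_cuspCell, Set.image_image]
    exact Set.image_congr fun q _ => h.image_cuspFace q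
  · rw [h.edgeFace_eq (h.mem_of_pair_mem_edges hq)]
    exact h.exists_isFaceOfType (h.mem_of_pair_mem_edges hq)
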